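/- Let $M$ be a connected smooth $2$-dimensional manifold, $g$ a smooth Riemannian metric on $M$ and $\tau$ a smooth $1$-form on $M$ with $|\tau|_g<1$ at every point, and let $F=F_{g,\tau}$, $F(x,y)=\sqrt{g_x(y,y)}+\tau_x(y)$, be the corresponding Randers Finsler metric, with (generally nonsymmetric) distance $$d(p,q)=\inf\Big\{\int_0^1F(c(t),c'(t))\,dt \;\Big|\; c\in C^1([0,1];M),\ c(0)=p,\ c(1)=q\Big\}.$$ A diffeomorphism $\phi:U\to V$ between open subsets of $M$ is called an almost isometry of $F$ if $T(p,q,r)=T(\phi(p),\phi(q),\phi(r))$ for all $p,q,r\in U$, where $T(p,q,r)=d(p,q)+d(q,r)-d(p,r)$. A smooth vector field on $M$ is called almost Killing if its local flow acts by almost isometries, i.e. every point of $M$ has an open neighbourhood $U$ on which the flow is defined for all sufficiently small times $t$ and maps $U$ onto its image by an almost isometry. Assume that it is not the case that $g$ has constant sectional curvature and $\tau$ is closed. If there are (at least) three linearly independent almost Killing vector fields for $F$ on $M$, then $g$ has constant sectional curvature, $M$ is orientable, and there are an orientation of $M$ and a constant $c\neq 0$ such that $d\tau=c\cdot \mathrm{Vol}_g$,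 where $\mathrm{Vol}_g=\sqrt{\det g}\,dx\wedge dy$ (in positively oriented coordinates) is the volume form of $g$. -/

import Mathlib

open Set Bundle Manifold
open scoped ContDiff Topology

noncomputable section

namespace Randers

/-- The model space `ℝⁿ`. -/
abbrev Model (n : ℕ) : Type := EuclideanSpace ℝ (Fin n)

section Basic

variable {n : ℕ} {M : Type*} [TopologicalSpace M] [ChartedSpace (Model n) M]

/-! ### Finsler distance, almost isometries, almost Killing vector fields -/

/-- The length `∫₀¹ F(c(t), c'(t)) dt` of a curve `c` defined on `[0, 1]`. -/
def curveLength (F : (p : M) → TangentSpace (𝓡 n) p → ℝ) (c : ℝ → M) : ℝ :=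
  ∫ t in (0 : ℝ)..1, F (c t) (mfderivWithin 𝓘(ℝ, ℝ) (𝓡 n) c (Icc 0 1) t (1 : ℝ))

/-- The (generally nonsymmetric) distance of `F`: the infimum of the lengths of the `C¹` curves
`c : [0, 1] → M` from `p` to `q`. -/
def finslerDist (F : (p : M) → TangentSpace (𝓡 n) p → ℝ) (p q : M) : ℝ :=
  sInf {L : ℝ | ∃ c : ℝ → M, ContMDiffOn 𝓘(ℝ, ℝ) (𝓡 n) 1 c (Icc 0 1) ∧
    c 0 = p ∧ c 1 = q ∧ L = curveLength F c}

/-- The triangular function `T(p, q, r) = d(p, q) + d(q, r) - d(p, r)`. -/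
def triangular (F : (p : M) → TangentSpace (𝓡 n) p → ℝ) (p q r : M) : ℝ :=
  finslerDist F p q + finslerDist F q r - finslerDist F p r

/-- A diffeomorphism `Φ : U → V` between open subsets of `M` (`U = Φ.source`, `V = Φ.target`) is an
almost isometry of `F` if it preserves the triangular function. -/
def IsAlmostIsometry (F : (p : M) → TangentSpace (𝓡 n) p → ℝ)
    (Φ : PartialDiffeomorph (𝓡 n) (𝓡 n) M M ∞) : Prop :=
  ∀ p ∈ Φ.source, ∀ q ∈ Φ.source, ∀ r ∈ Φ.source,
    triangular F p q r = triangular F (Φ p) (Φ q) (Φ r)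

/-- `φ` is a (smooth) local flow of the vector field `K` on the open set `U`, for `|t| < ε`. -/
structure IsLocalFlow (K : (p : M) → TangentSpace (𝓡 n) p) (φ : ℝ → M → M) (ε : ℝ)
    (U : Set M) : Prop where
  pos : 0 < ε
  isOpen : IsOpen U
  smooth : ContMDiffOn (𝓘(ℝ, ℝ).prod (𝓡 n)) (𝓡 n) ∞ (fun x : ℝ × M => φ x.1 x.2)
    (Ioo (-ε) ε ×ˢ U)
  zero : ∀ p ∈ U, φ 0 p = p
  integral : ∀ p ∈ U, IsMIntegralCurveOn (fun t => φ t p) K (Ioo (-ε) ε)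

/-- A vector field is almost Killing for `F` if its local flow acts by almost isometries: around
every point there is a local flow `φ` on some `U` such that every `φ t` is an almost isometry
from `U` onto its image. -/
def IsAlmostKilling (F : (p : M) → TangentSpace (𝓡 n) p → ℝ)
    (K : (p : M) → TangentSpace (𝓡 n) p) : Prop :=
  ∀ p : M, ∃ (φ : ℝ → M → M) (ε : ℝ) (U : Set M), p ∈ U ∧ IsLocalFlow K φ ε U ∧
    ∀ t ∈ Ioo (-ε) ε, ∃ Φ : PartialDiffeomorph (𝓡 n) (𝓡 n) M M ∞,
      Φ.source = U ∧ EqOn Φ (φ t) U ∧ IsAlmostIsometry F Φ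

/-! ### Coordinate expressions -/

/-- The `i`-th partial derivative of a function on `ℝⁿ`. -/
def pd (i : Fin n) (f : Model n → ℝ) (u : Model n) : ℝ :=
  fderiv ℝ f u (EuclideanSpace.single i 1)

/-- The coordinate vector field `∂ᵢ` of the chart `e`, at the point with coordinates `u`. -/
def coordVec (e : OpenPartialHomeomorph M (Model n)) (u : Model n) (i : Fin n) :
    TangentSpace (𝓡 n) (e.symm u) :=
  mfderiv (𝓡 n) (𝓡 n) e.symm u (EuclideanSpace.single i (1 : ℝ) : Model n)

end Basic

section Tensors

variable {n : ℕ} {M : Type*} [TopologicalSpace M] [ChartedSpace (Model n) M]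
  [IsManifold (𝓡 n) ∞ M]

/-- A smooth Riemannian metric on `M`. -/
abbrev Metric (n : ℕ) (M : Type*) [TopologicalSpace M] [ChartedSpace (Model n) M]
    [IsManifold (𝓡 n) ∞ M] :=
  ContMDiffRiemannianMetric (𝓡 n) ∞ (Model n) (fun p : M => TangentSpace (𝓡 n) p)

/-- Smooth vector fields on `M`. -/
abbrev VectorField (n : ℕ) (M : Type*) [TopologicalSpace M] [ChartedSpace (Model n) M]
    [IsManifold (𝓡 n) ∞ M] :=
  ContMDiffSection (𝓡 n) (Model n) ∞ (fun p : M => TangentSpace (𝓡 n) p)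

/-- Smooth 1-forms on `M`. -/
abbrev OneForm (n : ℕ) (M : Type*) [TopologicalSpace M] [ChartedSpace (Model n) M]
    [IsManifold (𝓡 n) ∞ M] :=
  ContMDiffSection (𝓡 n) (Model n →L[ℝ] ℝ) ∞ (fun p : M => TangentSpace (𝓡 n) p →L[ℝ] ℝ)

/-- Smooth bilinear forms (sections of `T*M ⊗ T*M`) on `M`. -/
abbrev BilinForm (n : ℕ) (M : Type*) [TopologicalSpace M] [ChartedSpace (Model n) M]
    [IsManifold (𝓡 n) ∞ M] :=
  ContMDiffSection (𝓡 n) (Model n →L[ℝ] Model n →L[ℝ] ℝ) ∞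
    (fun p : M => TangentSpace (𝓡 n) p →L[ℝ] TangentSpace (𝓡 n) p →L[ℝ] ℝ)

/-- The function `F_{g,τ}(p, v) = √(g_p(v, v)) + τ_p(v)`. -/
def randers (g : Metric n M) (τ : OneForm n M) (p : M) (v : TangentSpace (𝓡 n) p) : ℝ :=
  √(g.inner p v v) + τ p v

/-- `|τ|_g < 1` at every point (fibres are finite dimensional, so this says that the dual norm is
less than `1`); equivalently, `F_{g,τ}` is a Finsler metric. -/
def NormLTOne (g : Metric n M) (τ : OneForm n M) : Prop :=
  ∀ (p : M) (v : TangentSpace (𝓡 n) p), v ≠ 0 → |τ p v| < √(g.inner p v v)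

/-- The components `g_{ij}` of the metric in the chart `e`. -/
def gram (g : Metric n M) (e : OpenPartialHomeomorph M (Model n)) (u : Model n) :
    Matrix (Fin n) (Fin n) ℝ :=
  Matrix.of fun i j => g.inner (e.symm u) (coordVec e u i) (coordVec e u j)

/-- The Christoffel symbols `Γᵏ_{ij}` of the Levi-Civita connection in the chart `e`. -/
def christoffel (g : Metric n M) (e : OpenPartialHomeomorph M (Model n)) (k i j : Fin n)
    (u : Model n) : ℝ :=
  (1 / 2) * ∑ l, (gram g e u)⁻¹ k l *
    (pd i (fun x => gram g e x j l) u + pd j (fun x => gram g e x i l) u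
      - pd l (fun x => gram g e x i j) u)

/-- The components `Rˡ_{kij}` of the curvature tensor: `R(∂ᵢ, ∂ⱼ)∂ₖ = ∑ₗ Rˡ_{kij} ∂ₗ`, where
`R(X, Y)Z = ∇_X ∇_Y Z - ∇_Y ∇_X Z - ∇_{[X, Y]} Z`. -/
def riemann (g : Metric n M) (e : OpenPartialHomeomorph M (Model n)) (l k i j : Fin n)
    (u : Model n) : ℝ :=
  pd i (christoffel g e l j k) u - pd j (christoffel g e l i k) u
    + ∑ m, (christoffel g e l i m u * christoffel g e m j k u
      - christoffel g e l j m u * christoffel g e m i k u)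

/-- `g(R(v, w)w, v)` for the tangent vectors with components `v`, `w` in the chart `e`. -/
def curvatureForm (g : Metric n M) (e : OpenPartialHomeomorph M (Model n)) (u : Model n)
    (v w : Fin n → ℝ) : ℝ :=
  ∑ i, ∑ j, ∑ k, ∑ l, ∑ m,
    gram g e u m l * riemann g e l k i j u * v i * w j * w k * v m

/-- The inner product of the tangent vectors with components `v`, `w` in the chart `e`. -/
def coordInner (g : Metric n M) (e : OpenPartialHomeomorph M (Model n)) (u : Model n)
    (v w : Fin n → ℝ) : ℝ :=
  ∑ i, ∑ j, gram g e u i j * v i * w j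

/-- All sectional curvatures of `g`, at all points, are equal to `κ`:
`g(R(v, w)w, v) = κ (g(v, v) g(w, w) - g(v, w)²)`. -/
def HasConstantSectionalCurvature (g : Metric n M) (κ : ℝ) : Prop :=
  ∀ e ∈ IsManifold.maximalAtlas (𝓡 n) ∞ M, ∀ u ∈ e.target, ∀ v w : Fin n → ℝ,
    curvatureForm g e u v w =
      κ * (coordInner g e u v v * coordInner g e u w w - coordInner g e u v w ^ 2)

/-- The components `∂ᵢ τⱼ - ∂ⱼ τᵢ` of the exterior derivative `dτ` in the chart `e`. -/
def extDerivCoord (τ : OneForm n M) (e : OpenPartialHomeomorph M (Model n)) (u : Model n)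
    (i j : Fin n) : ℝ :=
  pd i (fun x => τ (e.symm x) (coordVec e x j)) u
    - pd j (fun x => τ (e.symm x) (coordVec e x i)) u

/-- The 1-form `τ` is closed: `dτ = 0`. -/
def IsClosedForm (τ : OneForm n M) : Prop :=
  ∀ e ∈ IsManifold.maximalAtlas (𝓡 n) ∞ M, ∀ u ∈ e.target, ∀ i j : Fin n,
    extDerivCoord τ e u i j = 0

/-- `dτ = c · σ`, for a constant `c` and a bilinear form `σ`. -/
def ExtDerivEqMul (τ : OneForm n M) (c : ℝ) (σ : BilinForm n M) : Prop :=
  ∀ e ∈ IsManifold.maximalAtlas (𝓡 n) ∞ M, ∀ u ∈ e.target, ∀ i j : Fin n,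
    extDerivCoord τ e u i j = c * σ (e.symm u) (coordVec e u i) (coordVec e u j)

/-- `F_{g,τ}` is of constant curvature type with closed form: `g` has constant sectional curvature
and `dτ = 0`. -/
def IsConstCurvClosed (g : Metric n M) (τ : OneForm n M) : Prop :=
  (∃ κ : ℝ, HasConstantSectionalCurvature g κ) ∧ IsClosedForm τ

end Tensors

section Surface

variable {M : Type*} [TopologicalSpace M] [ChartedSpace (Model 2) M] [IsManifold (𝓡 2) ∞ M]

/-- `vol` is the Riemannian volume form `Vol_g` of the surface `(M, g)` for one of the orientations
of `M`: a smooth 2-form taking the values `±1` on orthonormal frames. (Such an `vol` is continuous and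
nowhere zero, hence determines an orientation; in positively oriented coordinates it is
`√(det g) dx ∧ dy`. It exists if and only if `M` is orientable.) -/
structure IsVolumeForm (g : Metric 2 M) (vol : BilinForm 2 M) : Prop where
  alternating : ∀ (p : M) (v : TangentSpace (𝓡 2) p), vol p v v = 0
  orthonormal : ∀ (p : M) (v w : TangentSpace (𝓡 2) p),
    g.inner p v v = 1 → g.inner p w w = 1 → g.inner p v w = 0 → |vol p v w| = 1

end Surface

end Randers

end

/-! Adding the differential of a function to F changes d(p,q) by an increment of that function and
leaves T alone, so T can know τ only up to exact forms. It does know g and dτ. To first order, d is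
F of the displacement (`abs_finslerDist_sub_chartRanders_le`). In T(p,q,p) = d(p,q) + d(q,p) the
linear part cancels and leaves 2√g (`chartSq_eq_of_sameTriangular`). Comparing T(p₀,p,q) on both
sides of an almost isometry exhibits the difference of the two 1-forms as the differential of a
difference of distance functions, so their exterior derivatives agree
(`extDerivCoord_eq_of_sameTriangular`). Hence an almost Killing field K satisfies L_K g = 0 and L_K
dτ = 0 (`lieDeriv_of_isAlmostKilling`).

On a surface the covariant derivative of a Killing field is antisymmetric, hence a single function,
`rotn`. The pair (K, `rotn`) solves a closed linear first order system (`LocalKilling.pd_eq`,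
`LocalKilling.pd_rotn`). By Grönwall's inequality and connectedness K is determined by its value and
rotation at one point, which are three numbers (`eq_zero_of_jet_eq_zero`). Three independent fields
therefore realise every such triple at every point (`exists_symmetryField`). In particular every
tangent vector is the value of a symmetry field, so every invariant function is constant. This is
applied to the Gauss curvature κ and to (dτ/Vol)², which is w²/det g in a chart with w = ∂₀τ₁ - ∂₁τ₀
and needs no orientation.

That κ does not depend on the chart is obtained without transforming Christoffel symbols: d(rotn²
det g) = -κ d|K|² for a Killing field (`LocalKilling.pd_rotn_sq`), both functions are intrinsic, and
K can be chosen with d|K|² ≠ 0 at the given point (`gaussCurv_trans`).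

If the constant a = (dτ/Vol)² were zero, τ would be closed and g of constant curvature, the excluded
case. So dτ vanishes nowhere, and dτ/√a is itself the volume form that orients M
(`isVolumeForm_extDerivForm`). -/

noncomputable section

namespace Randers

/-! ### Tensors and vector fields in charts. -/

section Charts

set_option linter.unusedSectionVars false

variable {n : ℕ} {M : Type*} [TopologicalSpace M] [ChartedSpace (Model n) M]
  [IsManifold (𝓡 n) ∞ M]

lemma mdifferentiable_of_mem {e : OpenPartialHomeomorph M (Model n)}
    (he : e ∈ IsManifold.maximalAtlas (𝓡 n) ∞ M) : e.MDifferentiable (𝓡 n) (𝓡 n) :=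
  ⟨(contMDiffOn_of_mem_maximalAtlas he).mdifferentiableOn (by simp),
    (contMDiffOn_symm_of_mem_maximalAtlas he).mdifferentiableOn (by simp)⟩

/-- A vector of `ℝⁿ` is the sum of its coordinates times the standard basis vectors. -/
lemma model_eq_sum (v : Model n) : v = ∑ i, v i • (EuclideanSpace.single i (1 : ℝ) : Model n) := by
  ext j
  simp [Finset.sum_apply, Pi.single_apply]

lemma mfderiv_symm_eq_sum (e : OpenPartialHomeomorph M (Model n)) (u v : Model n) :
    mfderiv (𝓡 n) (𝓡 n) e.symm u v = ∑ i, v i • coordVec e u i := by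
  conv_lhs => rw [model_eq_sum v]
  refine (map_sum (mfderiv (𝓡 n) (𝓡 n) e.symm u) _ _).trans ?_
  refine Finset.sum_congr rfl fun i _ => ?_
  exact (mfderiv (𝓡 n) (𝓡 n) e.symm u).map_smul _ _

lemma contMDiffOn_mfderiv_symm {e : OpenPartialHomeomorph M (Model n)}
    (he : e ∈ IsManifold.maximalAtlas (𝓡 n) ∞ M) (w : Model n) :
    ContMDiffOn (𝓡 n) (𝓡 n).tangent ∞
      (fun u : Model n => (⟨e.symm u, mfderiv (𝓡 n) (𝓡 n) e.symm u w⟩ : TangentBundle (𝓡 n) M))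
      e.target := by
  have h := (contMDiffOn_symm_of_mem_maximalAtlas he).contMDiffOn_tangentMapWithin
    (m := ∞) (by simp) e.open_target.uniqueMDiffOn
  have hc : ContMDiff (𝓡 n) (𝓡 n).tangent ∞
      (fun u : Model n => (⟨u, w⟩ : TangentBundle (𝓡 n) (Model n))) :=
    contMDiff_vectorSpace_iff_contDiff.2 contDiff_const
  have h2 := h.comp hc.contMDiffOn (s := e.target) (fun u hu => hu)
  refine h2.congr fun u hu => ?_
  simp only [Function.comp, tangentMapWithin]
  rw [mfderivWithin_of_isOpen e.open_target hu]

lemma contMDiffOn_coordVec {e : OpenPartialHomeomorph M (Model n)}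
    (he : e ∈ IsManifold.maximalAtlas (𝓡 n) ∞ M) (i : Fin n) :
    ContMDiffOn (𝓡 n) (𝓡 n).tangent ∞
      (fun u : Model n => (⟨e.symm u, coordVec e u i⟩ : TangentBundle (𝓡 n) M)) e.target :=
  contMDiffOn_mfderiv_symm he _

/-- The inner product of two smooth vector fields along a smooth map is smooth. -/
lemma contMDiffOn_inner (g : Metric n M) {E' H' N : Type*} [NormedAddCommGroup E']
    [NormedSpace ℝ E'] [TopologicalSpace H'] {I' : ModelWithCorners ℝ E' H'} [TopologicalSpace N]
    [ChartedSpace H' N] {s : Set N} {m : ℕ∞ω} (hm : m ≤ ∞) {b : N → M}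
    {v w : ∀ x, TangentSpace (𝓡 n) (b x)}
    (hv : ContMDiffOn I' (𝓡 n).tangent m (fun x => (⟨b x, v x⟩ : TangentBundle (𝓡 n) M)) s)
    (hw : ContMDiffOn I' (𝓡 n).tangent m (fun x => (⟨b x, w x⟩ : TangentBundle (𝓡 n) M)) s) :
    ContMDiffOn I' 𝓘(ℝ) m (fun x => g.inner (b x) (v x) (w x)) s := by
  intro x hx
  have hb : ContMDiffWithinAt I' (𝓡 n) m b s x := by
    have := hv x hx
    simp only [contMDiffWithinAt_totalSpace] at this
    exact this.1
  have : ContMDiffWithinAt I' ((𝓡 n).prod 𝓘(ℝ)) m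
      (fun x => TotalSpace.mk' ℝ (E := Bundle.Trivial M ℝ) (b x) (g.inner (b x) (v x) (w x)))
      s x := by
    apply ContMDiffWithinAt.clm_bundle_apply₂ (F₁ := Model n) (F₂ := Model n)
    · exact (g.contMDiff.of_le hm).contMDiffAt.comp_contMDiffWithinAt x hb
    · exact hv x hx
    · exact hw x hx
  simp only [contMDiffWithinAt_totalSpace] at this
  exact this.2

/-- A smooth 1-form applied to a smooth vector field along a smooth map is smooth. -/
lemma contMDiffOn_oneForm (τ : OneForm n M) {E' H' N : Type*} [NormedAddCommGroup E']
    [NormedSpace ℝ E'] [TopologicalSpace H'] {I' : ModelWithCorners ℝ E' H'} [TopologicalSpace N]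
    [ChartedSpace H' N] {s : Set N} {m : ℕ∞ω} (hm : m ≤ ∞) {b : N → M}
    {v : ∀ x, TangentSpace (𝓡 n) (b x)}
    (hv : ContMDiffOn I' (𝓡 n).tangent m (fun x => (⟨b x, v x⟩ : TangentBundle (𝓡 n) M)) s) :
    ContMDiffOn I' 𝓘(ℝ) m (fun x => τ (b x) (v x)) s := by
  intro x hx
  have hb : ContMDiffWithinAt I' (𝓡 n) m b s x := by
    have := hv x hx
    simp only [contMDiffWithinAt_totalSpace] at this
    exact this.1
  have : ContMDiffWithinAt I' ((𝓡 n).prod 𝓘(ℝ)) m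
      (fun x => TotalSpace.mk' ℝ (E := Bundle.Trivial M ℝ) (b x) (τ (b x) (v x))) s x := by
    apply ContMDiffWithinAt.clm_bundle_apply (F₁ := Model n)
    · exact (τ.contMDiff.of_le hm).contMDiffAt.comp_contMDiffWithinAt x hb
    · exact hv x hx
  simp only [contMDiffWithinAt_totalSpace] at this
  exact this.2

/-- The components of a 1-form in a chart. -/
def comp1 (τ : (p : M) → TangentSpace (𝓡 n) p →L[ℝ] ℝ) (e : OpenPartialHomeomorph M (Model n))
    (i : Fin n) (u : Model n) : ℝ :=
  τ (e.symm u) (coordVec e u i)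

lemma contDiffOn_gram (g : Metric n M) {e : OpenPartialHomeomorph M (Model n)}
    (he : e ∈ IsManifold.maximalAtlas (𝓡 n) ∞ M) (i j : Fin n) :
    ContDiffOn ℝ ∞ (fun u => gram g e u i j) e.target :=
  (contMDiffOn_inner g le_rfl (contMDiffOn_coordVec he i) (contMDiffOn_coordVec he j)).contDiffOn

lemma contDiffOn_comp1 (τ : OneForm n M) {e : OpenPartialHomeomorph M (Model n)}
    (he : e ∈ IsManifold.maximalAtlas (𝓡 n) ∞ M) (i : Fin n) :
    ContDiffOn ℝ ∞ (comp1 τ e i) e.target :=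
  (contMDiffOn_oneForm τ le_rfl (contMDiffOn_coordVec he i)).contDiffOn

/-- The components of a vector field in a chart. -/
def vecComp (K : (p : M) → TangentSpace (𝓡 n) p) (e : OpenPartialHomeomorph M (Model n))
    (u : Model n) : Model n :=
  mfderiv (𝓡 n) (𝓡 n) e (e.symm u) (K (e.symm u))

lemma contDiffOn_vecComp (K : VectorField n M) {e : OpenPartialHomeomorph M (Model n)}
    (he : e ∈ IsManifold.maximalAtlas (𝓡 n) ∞ M) :
    ContDiffOn ℝ ∞ (vecComp K e) e.target := by
  have h := (contMDiffOn_of_mem_maximalAtlas he).contMDiffOn_tangentMapWithin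
    (m := ∞) (by simp) e.open_source.uniqueMDiffOn
  have hc := K.contMDiff.comp_contMDiffOn (contMDiffOn_symm_of_mem_maximalAtlas he)
  have h2 := h.comp hc (fun u hu => e.map_target hu)
  have h3 : ContMDiffOn (𝓡 n) 𝓘(ℝ, Model n) ∞ _ e.target :=
    (contMDiff_snd_tangentBundle_modelSpace (Model n) (𝓡 n)).comp_contMDiffOn h2
  refine h3.contDiffOn.congr fun u hu => ?_
  simp only [Function.comp, tangentMapWithin, vecComp]
  rw [mfderivWithin_of_isOpen e.open_source (e.map_target hu)]

lemma mfderiv_symm_vecComp (K : (p : M) → TangentSpace (𝓡 n) p)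
    {e : OpenPartialHomeomorph M (Model n)}
    (he : e ∈ IsManifold.maximalAtlas (𝓡 n) ∞ M) {u : Model n} (hu : u ∈ e.target) :
    mfderiv (𝓡 n) (𝓡 n) e.symm u (vecComp K e u) = K (e.symm u) := by
  have h := (mdifferentiable_of_mem he).symm_comp_deriv (e.map_target hu)
  rw [e.right_inv hu] at h
  exact congrArg (fun L => L (K (e.symm u))) h

lemma eq_sum_coordVec (K : (p : M) → TangentSpace (𝓡 n) p)
    {e : OpenPartialHomeomorph M (Model n)}
    (he : e ∈ IsManifold.maximalAtlas (𝓡 n) ∞ M) {u : Model n} (hu : u ∈ e.target) :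
    K (e.symm u) = ∑ i, vecComp K e u i • coordVec e u i := by
  rw [← mfderiv_symm_vecComp K he hu, mfderiv_symm_eq_sum]

lemma mfderiv_symm_injective {e : OpenPartialHomeomorph M (Model n)}
    (he : e ∈ IsManifold.maximalAtlas (𝓡 n) ∞ M) {u : Model n} (hu : u ∈ e.target) :
    Function.Injective (mfderiv (𝓡 n) (𝓡 n) e.symm u) :=
  (mdifferentiable_of_mem he).symm.mfderiv_injective hu

/-! ### Change of charts -/

/-- The coordinate change. -/
def trans (e e' : OpenPartialHomeomorph M (Model n)) (u : Model n) : Model n := e' (e.symm u)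

lemma contDiffAt_trans {e e' : OpenPartialHomeomorph M (Model n)}
    (he : e ∈ IsManifold.maximalAtlas (𝓡 n) ∞ M) (he' : e' ∈ IsManifold.maximalAtlas (𝓡 n) ∞ M)
    {u : Model n} (hu : u ∈ e.target) (hu' : e.symm u ∈ e'.source) :
    ContDiffAt ℝ ∞ (trans e e') u := by
  have h1 := (contMDiffOn_symm_of_mem_maximalAtlas he).contMDiffAt (e.open_target.mem_nhds hu)
  have h2 := (contMDiffOn_of_mem_maximalAtlas he').contMDiffAt (e'.open_source.mem_nhds hu')
  exact (h2.comp u h1).contDiffAt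

lemma eventually_trans {e e' : OpenPartialHomeomorph M (Model n)}
    {u : Model n} (hu : u ∈ e.target) (hu' : e.symm u ∈ e'.source) :
    ∀ᶠ x in 𝓝 u, x ∈ e.target ∧ e.symm x ∈ e'.source :=
  (e.open_target.mem_nhds hu |> Filter.Eventually.and <|
    (e.continuousAt_symm hu).eventually (e'.open_source.mem_nhds hu'))

/-- The two sides lie in tangent spaces at points that are only propositionally equal, so the
equation is stated in `Model n`. -/
lemma mfderiv_symm_trans {e e' : OpenPartialHomeomorph M (Model n)}
    (he : e ∈ IsManifold.maximalAtlas (𝓡 n) ∞ M) (he' : e' ∈ IsManifold.maximalAtlas (𝓡 n) ∞ M)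
    {u : Model n} (hu : u ∈ e.target) (hu' : e.symm u ∈ e'.source) (v : Model n) :
    (mfderiv (𝓡 n) (𝓡 n) e.symm u v : Model n) =
      mfderiv (𝓡 n) (𝓡 n) e'.symm (trans e e' u) (fderiv ℝ (trans e e') u v) := by
  have h1 : MDifferentiableAt (𝓡 n) (𝓡 n) (trans e e') u :=
    ((contDiffAt_trans he he' hu hu').differentiableAt (by simp)).mdifferentiableAt
  have hm : trans e e' u ∈ e'.target := e'.map_source hu'
  have h2 : MDifferentiableAt (𝓡 n) (𝓡 n) e'.symm (trans e e' u) :=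
    (mdifferentiable_of_mem he').mdifferentiableAt_symm hm
  have h3 : e.symm =ᶠ[𝓝 u] e'.symm ∘ trans e e' := by
    filter_upwards [eventually_trans hu hu'] with x hx
    simp [trans, e'.left_inv hx.2]
  rw [h3.mfderiv_eq, mfderiv_comp u h2 h1, mfderiv_eq_fderiv]
  rfl

end Charts

/-! ### The Randers function in a chart and lengths of curves. -/

section Distance

set_option linter.unusedSectionVars false

variable {n : ℕ} {M : Type*} [TopologicalSpace M] [ChartedSpace (Model n) M]
  [IsManifold (𝓡 n) ∞ M]

/-- The function `F_{g,τ}` in a chart. -/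
def chartRanders (g : Metric n M) (τ : OneForm n M) (e : OpenPartialHomeomorph M (Model n))
    (u v : Model n) : ℝ :=
  randers g τ (e.symm u) (mfderiv (𝓡 n) (𝓡 n) e.symm u v)

lemma inner_mfderiv_symm (g : Metric n M) (e : OpenPartialHomeomorph M (Model n))
    (u v w : Model n) :
    g.inner (e.symm u) (mfderiv (𝓡 n) (𝓡 n) e.symm u v) (mfderiv (𝓡 n) (𝓡 n) e.symm u w) =
      ∑ i, ∑ j, v i * w j * gram g e u i j := by
  rw [mfderiv_symm_eq_sum, mfderiv_symm_eq_sum]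
  simp only [map_sum, sum_apply, map_smul, smul_apply,
    smul_eq_mul, gram, Matrix.of_apply]
  rw [Finset.sum_comm]
  refine Finset.sum_congr rfl fun i _ => ?_
  rw [Finset.mul_sum]
  refine Finset.sum_congr rfl fun j _ => ?_
  ring

lemma oneForm_mfderiv_symm (τ : (p : M) → TangentSpace (𝓡 n) p →L[ℝ] ℝ)
    (e : OpenPartialHomeomorph M (Model n)) (u v : Model n) :
    τ (e.symm u) (mfderiv (𝓡 n) (𝓡 n) e.symm u v) = ∑ i, v i * comp1 τ e i u := by
  rw [mfderiv_symm_eq_sum]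
  simp only [map_sum, map_smul, smul_eq_mul, comp1]

lemma continuousOn_chartRanders (g : Metric n M) (τ : OneForm n M)
    {e : OpenPartialHomeomorph M (Model n)} (he : e ∈ IsManifold.maximalAtlas (𝓡 n) ∞ M) :
    ContinuousOn (Function.uncurry (chartRanders g τ e)) (e.target ×ˢ univ) := by
  have h1 : ∀ i : Fin n, ContinuousOn (fun x : Model n × Model n => x.2 i) (e.target ×ˢ univ) := by
    intro i; fun_prop
  have hG : ∀ i j : Fin n, ContinuousOn (fun x : Model n × Model n => gram g e x.1 i j)
      (e.target ×ˢ univ) := fun i j =>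
    (contDiffOn_gram g he i j).continuousOn.comp continuousOn_fst fun x hx => hx.1
  have hT : ∀ i : Fin n, ContinuousOn (fun x : Model n × Model n => comp1 τ e i x.1)
      (e.target ×ˢ univ) := fun i =>
    (contDiffOn_comp1 τ he i).continuousOn.comp continuousOn_fst fun x hx => hx.1
  have : Function.uncurry (chartRanders g τ e) = fun x : Model n × Model n =>
      √(∑ i, ∑ j, x.2 i * x.2 j * gram g e x.1 i j) + ∑ i, x.2 i * comp1 τ e i x.1 := by
    ext ⟨u, v⟩
    simp only [Function.uncurry, chartRanders, randers]
    rw [inner_mfderiv_symm, oneForm_mfderiv_symm]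
  rw [this]
  refine ContinuousOn.add (ContinuousOn.sqrt ?_) ?_
  · exact continuousOn_finsetSum _ fun i _ => continuousOn_finsetSum _ fun j _ =>
      ((h1 i).mul (h1 j)).mul (hG i j)
  · exact continuousOn_finsetSum _ fun i _ => (h1 i).mul (hT i)

lemma mfderiv_symm_mfderiv {e : OpenPartialHomeomorph M (Model n)}
    (he : e ∈ IsManifold.maximalAtlas (𝓡 n) ∞ M) {q : M} (hq : q ∈ e.source)
    (w : TangentSpace (𝓡 n) q) :
    mfderiv (𝓡 n) (𝓡 n) e.symm (e q) (mfderiv (𝓡 n) (𝓡 n) e q w) = w :=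
  congrArg (fun L => L w) ((mdifferentiable_of_mem he).symm_comp_deriv hq)

lemma chartRanders_mfderiv (g : Metric n M) (τ : OneForm n M)
    {e : OpenPartialHomeomorph M (Model n)} (he : e ∈ IsManifold.maximalAtlas (𝓡 n) ∞ M) {q : M}
    (hq : q ∈ e.source) (w : TangentSpace (𝓡 n) q) :
    chartRanders g τ e (e q) (mfderiv (𝓡 n) (𝓡 n) e q w) = randers g τ q w := by
  have h := mfderiv_symm_mfderiv he hq w
  unfold chartRanders
  have key : ∀ (p : M) (hp : p = q) (x : Model n), x = (w : Model n) →
      randers g τ p x = randers g τ q w := by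
    rintro p rfl x rfl; rfl
  exact key _ (e.left_inv hq) _ h

lemma randers_smul (g : Metric n M) (τ : OneForm n M) (p : M) (v : TangentSpace (𝓡 n) p) {s : ℝ}
    (hs : 0 ≤ s) : randers g τ p (s • v) = s * randers g τ p v := by
  simp only [randers, map_smul, smul_apply, smul_eq_mul]
  rw [← mul_assoc, Real.sqrt_mul (by positivity), Real.sqrt_mul_self hs]
  ring

lemma randers_zero (g : Metric n M) (τ : OneForm n M) (p : M) : randers g τ p 0 = 0 := by
  simp [randers]

lemma randers_pos {g : Metric n M} {τ : OneForm n M} (hτ : NormLTOne g τ) {p : M}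
    {v : TangentSpace (𝓡 n) p} (hv : v ≠ 0) : 0 < randers g τ p v := by
  have := (abs_lt.1 (hτ p v hv)).1
  simp only [randers]; linarith

lemma randers_nonneg {g : Metric n M} {τ : OneForm n M} (hτ : NormLTOne g τ) (p : M)
    (v : TangentSpace (𝓡 n) p) : 0 ≤ randers g τ p v := by
  by_cases hv : v = 0
  · rw [hv, randers_zero]
  · exact (randers_pos hτ hv).le

lemma chartRanders_smul (g : Metric n M) (τ : OneForm n M)
    (e : OpenPartialHomeomorph M (Model n)) (u v : Model n) {s : ℝ} (hs : 0 ≤ s) :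
    chartRanders g τ e u (s • v) = s * chartRanders g τ e u v := by
  have h : mfderiv (𝓡 n) (𝓡 n) e.symm u (s • v) = s • mfderiv (𝓡 n) (𝓡 n) e.symm u v :=
    (mfderiv (𝓡 n) (𝓡 n) e.symm u).map_smul s v
  unfold chartRanders
  rw [h, randers_smul g τ _ _ hs]

lemma chartRanders_eq_norm_mul (g : Metric n M) (τ : OneForm n M)
    (e : OpenPartialHomeomorph M (Model n)) (u v : Model n) :
    chartRanders g τ e u v = ‖v‖ * chartRanders g τ e u (‖v‖⁻¹ • v) := by
  rw [← chartRanders_smul g τ e u _ (norm_nonneg v)]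
  by_cases hv : v = 0
  · simp [hv]
  · rw [smul_inv_smul₀ (norm_ne_zero_iff.2 hv)]

lemma inv_norm_smul_mem_sphere {v : Model n} (hv : v ≠ 0) :
    ‖v‖⁻¹ • v ∈ Metric.sphere (0 : Model n) 1 := by
  simp [norm_smul, norm_ne_zero_iff.2 hv]

lemma chartRanders_zero (g : Metric n M) (τ : OneForm n M)
    (e : OpenPartialHomeomorph M (Model n)) (u : Model n) : chartRanders g τ e u 0 = 0 := by
  simpa using chartRanders_smul g τ e u 0 (le_refl 0)

lemma chartRanders_pos {g : Metric n M} {τ : OneForm n M} (hτ : NormLTOne g τ)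
    {e : OpenPartialHomeomorph M (Model n)} (he : e ∈ IsManifold.maximalAtlas (𝓡 n) ∞ M)
    {u v : Model n} (hu : u ∈ e.target) (hv : v ≠ 0) : 0 < chartRanders g τ e u v := by
  refine randers_pos hτ fun h => hv ?_
  apply mfderiv_symm_injective he hu
  rw [h]
  exact (map_zero (mfderiv (𝓡 n) (𝓡 n) e.symm u)).symm

lemma chartRanders_nonneg {g : Metric n M} {τ : OneForm n M} (hτ : NormLTOne g τ)
    (e : OpenPartialHomeomorph M (Model n)) (u v : Model n) : 0 ≤ chartRanders g τ e u v :=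
  randers_nonneg hτ _ _

/-- On the compact unit sphere continuity is uniform in the vector; positive homogeneity carries the
estimate to all vectors. -/
lemma eventually_abs_chartRanders_sub_le (g : Metric n M) (τ : OneForm n M)
    {e : OpenPartialHomeomorph M (Model n)} (he : e ∈ IsManifold.maximalAtlas (𝓡 n) ∞ M)
    {u : Model n} (hu : u ∈ e.target) {ε : ℝ} (hε : 0 < ε) :
    ∀ᶠ z in 𝓝 u, ∀ w, |chartRanders g τ e z w - chartRanders g τ e u w| ≤ ε * ‖w‖ := by
  obtain ⟨V, hV, h⟩ := (isCompact_sphere (0 : Model n) 1).mem_uniformity_of_prod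
    (f := chartRanders g τ e) (s := e.target) (q := u)
    ((continuousOn_chartRanders g τ he).mono (prod_mono_right (subset_univ _))) hu
    (Metric.dist_mem_uniformity hε)
  rw [e.open_target.nhdsWithin_eq hu] at hV
  filter_upwards [hV] with z hz w
  by_cases hw : w = 0
  · simp [hw, chartRanders_zero]
  · have := h z hz _ (inv_norm_smul_mem_sphere hw)
    simp only [Real.dist_eq] at this
    rw [chartRanders_eq_norm_mul g τ e z, chartRanders_eq_norm_mul g τ e u, ← mul_sub, abs_mul,
      abs_norm, mul_comm]
    exact mul_le_mul_of_nonneg_right (le_of_lt this) (norm_nonneg w)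

lemma exists_bounds_chartRanders {g : Metric n M} {τ : OneForm n M} (hτ : NormLTOne g τ)
    {e : OpenPartialHomeomorph M (Model n)} (he : e ∈ IsManifold.maximalAtlas (𝓡 n) ∞ M)
    {u : Model n} (hu : u ∈ e.target) :
    ∃ δ > 0, ∃ C > 0, ∀ w, δ * ‖w‖ ≤ chartRanders g τ e u w ∧
      chartRanders g τ e u w ≤ C * ‖w‖ := by
  have hc : ContinuousOn (chartRanders g τ e u) (Metric.sphere 0 1) :=
    (continuousOn_chartRanders g τ he).comp (f := fun w => (u, w)) (by fun_prop)
      fun w _ => ⟨hu, mem_univ _⟩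
  obtain ⟨δ, hδ, h1⟩ := (isCompact_sphere (0 : Model n) 1).exists_forall_le' hc (a := 0)
    fun w hw => chartRanders_pos hτ he hu (by rintro rfl; simp at hw)
  obtain ⟨C, h2⟩ := (isCompact_sphere (0 : Model n) 1).exists_bound_of_continuousOn hc
  refine ⟨δ, hδ, max C 1, by positivity, fun w => ?_⟩
  by_cases hw : w = 0
  · simp [hw, chartRanders_zero]
  · have hs := inv_norm_smul_mem_sphere hw
    have h3 := h1 _ hs
    have h4 := (le_abs_self _).trans ((h2 _ hs).trans (le_max_left C 1))
    rw [chartRanders_eq_norm_mul g τ e u w]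
    have := norm_nonneg w
    constructor <;> nlinarith

/-- Cauchy–Schwarz for the metric. -/
lemma inner_le_sqrt_mul_sqrt (g : Metric n M) (p : M) (v w : TangentSpace (𝓡 n) p) :
    g.inner p v w ≤ √(g.inner p v v) * √(g.inner p w w) := by
  have hnn : ∀ x : TangentSpace (𝓡 n) p, 0 ≤ g.inner p x x := by
    intro x
    by_cases hx : x = 0
    · simp [hx]
    · exact (g.pos p x hx).le
  rw [← Real.sqrt_mul (hnn v)]
  refine Real.le_sqrt_of_sq_le ?_
  have key := discrim_le_zero (a := g.inner p v v) (b := 2 * g.inner p v w) (c := g.inner p w w)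
    (fun s => by
      have := hnn (s • v + w)
      simp only [map_add, map_smul, add_apply, smul_apply,
        smul_eq_mul, g.symm p w v] at this
      linarith)
  simp only [discrim] at key
  nlinarith

/-- Every tangent vector is normed by a covector dominated by the Finsler function. -/
lemma exists_calibration (g : Metric n M) (τ : OneForm n M) (p : M)
    (v : TangentSpace (𝓡 n) p) :
    ∃ β : TangentSpace (𝓡 n) p →L[ℝ] ℝ, (∀ w, β w ≤ randers g τ p w) ∧ β v = randers g τ p v := by
  by_cases hv : v = 0
  · refine ⟨τ p, fun w => ?_, by simp [hv, randers_zero]⟩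
    simp only [randers]
    linarith [Real.sqrt_nonneg (g.inner p w w)]
  · have hp : 0 < √(g.inner p v v) := Real.sqrt_pos.2 (g.pos p v hv)
    -- The covector is g(v,·)/|v| + τ, and its domination by F is the Cauchy–Schwarz inequality.
    refine ⟨(√(g.inner p v v))⁻¹ • g.inner p v + τ p, fun w => ?_, ?_⟩
    · have h := inner_le_sqrt_mul_sqrt g p v w
      simp only [randers, add_apply, smul_apply,
        smul_eq_mul]
      have : (√(g.inner p v v))⁻¹ * g.inner p v w ≤ √(g.inner p w w) := by
        rw [inv_mul_le_iff₀ hp]; exact h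
      linarith
    · simp only [randers, add_apply, smul_apply,
        smul_eq_mul, add_left_inj]
      rw [inv_mul_eq_div, Real.div_sqrt]

/-! ### Lengths of curves -/

lemma continuousOn_randers_velocity (g : Metric n M) (τ : OneForm n M) {c : ℝ → M}
    (hc : ContMDiffOn 𝓘(ℝ, ℝ) (𝓡 n) 1 c (Icc 0 1)) :
    ContinuousOn (fun t => randers g τ (c t)
      (mfderivWithin 𝓘(ℝ, ℝ) (𝓡 n) c (Icc 0 1) t (1 : ℝ))) (Icc 0 1) := by
  have h := hc.contMDiffOn_tangentMapWithin (m := 0) (by simp)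
    (uniqueDiffOn_Icc (zero_lt_one (α := ℝ))).uniqueMDiffOn
  have hk : ContMDiff 𝓘(ℝ, ℝ) 𝓘(ℝ, ℝ).tangent 0
      (fun t : ℝ => (⟨t, (1 : ℝ)⟩ : TangentBundle 𝓘(ℝ, ℝ) ℝ)) :=
    contMDiff_vectorSpace_iff_contDiff.2 contDiff_const
  have h2 : ContMDiffOn 𝓘(ℝ, ℝ) (𝓡 n).tangent 0 (fun t : ℝ =>
      (⟨c t, mfderivWithin 𝓘(ℝ, ℝ) (𝓡 n) c (Icc 0 1) t (1 : ℝ)⟩ : TangentBundle (𝓡 n) M))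
      (Icc 0 1) := h.comp hk.contMDiffOn (s := Icc 0 1) (fun t ht => ht)
  exact ((contMDiffOn_inner g (by simp) h2 h2).continuousOn.sqrt).add
    (contMDiffOn_oneForm τ (by simp) h2).continuousOn

lemma curveLength_nonneg {g : Metric n M} {τ : OneForm n M} (hτ : NormLTOne g τ) (c : ℝ → M) :
    0 ≤ curveLength (randers g τ) c :=
  intervalIntegral.integral_nonneg zero_le_one fun _ _ => randers_nonneg hτ _ _

lemma finslerDist_le {g : Metric n M} {τ : OneForm n M} (hτ : NormLTOne g τ) {c : ℝ → M}
    (hc : ContMDiffOn 𝓘(ℝ, ℝ) (𝓡 n) 1 c (Icc 0 1)) :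
    finslerDist (randers g τ) (c 0) (c 1) ≤ curveLength (randers g τ) c := by
  refine csInf_le ⟨0, ?_⟩ ⟨c, hc, rfl, rfl, rfl⟩
  rintro L ⟨c', -, -, -, rfl⟩
  exact curveLength_nonneg hτ c'

/-- A covector dominated by the Finsler function along the initial piece of a curve bounds the
length of the curve from below. -/
lemma sub_le_curveLength {g : Metric n M} {τ : OneForm n M} (hτ : NormLTOne g τ)
    {e : OpenPartialHomeomorph M (Model n)} (he : e ∈ IsManifold.maximalAtlas (𝓡 n) ∞ M)
    {c : ℝ → M} (hc : ContMDiffOn 𝓘(ℝ, ℝ) (𝓡 n) 1 c (Icc 0 1)) {b : ℝ} (hb0 : 0 ≤ b)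
    (hb1 : b ≤ 1) (hsrc : ∀ t ∈ Icc 0 b, c t ∈ e.source) (β : Model n →L[ℝ] ℝ)
    (hβ : ∀ t ∈ Icc 0 b, ∀ w, β w ≤ chartRanders g τ e (e (c t)) w) :
    β (e (c b)) - β (e (c 0)) ≤ curveLength (randers g τ) c := by
  have hcont := continuousOn_randers_velocity g τ hc
  set φ : ℝ → ℝ := fun t => randers g τ (c t)
    (mfderivWithin 𝓘(ℝ, ℝ) (𝓡 n) c (Icc 0 1) t (1 : ℝ)) with hφ
  have hsub : Icc 0 b ⊆ Icc (0 : ℝ) 1 := Icc_subset_Icc_right hb1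
  have h1 : β (e (c b)) - β (e (c 0)) ≤ ∫ t in (0 : ℝ)..b, φ t := by
    -- The derivative of `β (e (c t))` is `β` of the coordinate velocity, at most the Finsler speed;
    -- the rest of the curve has nonnegative length.
    refine intervalIntegral.sub_le_integral_of_hasDeriv_right_of_le
      (g := fun t => β (e (c t)))
      (g' := fun t => β (mfderiv (𝓡 n) (𝓡 n) e (c t)
        (mfderivWithin 𝓘(ℝ, ℝ) (𝓡 n) c (Icc 0 1) t (1 : ℝ)))) hb0 ?_ ?_
      ((hcont.mono hsub).integrableOn_Icc) ?_
    · exact β.continuous.comp_continuousOn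
        (e.continuousOn.comp (hc.continuousOn.mono hsub) hsrc)
    · intro t ht
      have htI : Icc (0 : ℝ) 1 ∈ 𝓝 t := Icc_mem_nhds ht.1 (ht.2.trans_le hb1)
      have hct : MDifferentiableAt 𝓘(ℝ, ℝ) (𝓡 n) c t :=
        ((hc t (hsub (Ioo_subset_Icc_self ht))).contMDiffAt htI).mdifferentiableAt (by simp)
      have het := (mdifferentiable_of_mem he).mdifferentiableAt (hsrc t (Ioo_subset_Icc_self ht))
      have h0 : HasFDerivAt (fun s => e (c s)) _ t :=
        (het.hasMFDerivAt.comp t hct.hasMFDerivAt).hasFDerivAt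
      have h' : HasDerivAt (fun s => β (e (c s))) _ t := (β.hasFDerivAt.comp t h0).hasDerivAt
      rw [mfderivWithin_eq_mfderiv ((uniqueDiffOn_Icc zero_lt_one).uniqueMDiffOn t
        (hsub (Ioo_subset_Icc_self ht))) hct]
      exact h'.hasDerivWithinAt
    · intro t ht
      have hs := hsrc t (Ioo_subset_Icc_self ht)
      refine (hβ t (Ioo_subset_Icc_self ht) _).trans (le_of_eq ?_)
      exact chartRanders_mfderiv g τ he hs _
  have h2 : ∫ t in (0 : ℝ)..b, φ t ≤ ∫ t in (0 : ℝ)..1, φ t := by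
    refine intervalIntegral.integral_mono_interval le_rfl hb0 hb1 ?_
      (hcont.intervalIntegrable_of_Icc zero_le_one)
    exact Filter.Eventually.of_forall fun t => randers_nonneg hτ _ _
  exact h1.trans h2

end Distance

/-! ### First order comparison of the distance with the Finsler function. -/

section Distance

set_option linter.unusedSectionVars false

variable {n : ℕ} {M : Type*} [TopologicalSpace M] [ChartedSpace (Model n) M]
  [IsManifold (𝓡 n) ∞ M]

/-- The segment from `x` to `y` in a chart. -/
def chartSegment (e : OpenPartialHomeomorph M (Model n)) (x y : Model n) (t : ℝ) : M :=
  e.symm (x + t • (y - x))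

lemma contMDiffOn_chartSegment {e : OpenPartialHomeomorph M (Model n)}
    (he : e ∈ IsManifold.maximalAtlas (𝓡 n) ∞ M) {x y : Model n}
    (h : ∀ t ∈ Icc (0 : ℝ) 1, x + t • (y - x) ∈ e.target) :
    ContMDiffOn 𝓘(ℝ, ℝ) (𝓡 n) 1 (chartSegment e x y) (Icc 0 1) := by
  have h1 := (contMDiffOn_symm_of_mem_maximalAtlas he).of_le (m := 1) (by simp)
  have h2 : ContMDiff 𝓘(ℝ, ℝ) (𝓡 n) 1 (fun t : ℝ => x + t • (y - x)) := by
    apply ContDiff.contMDiff; fun_prop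
  exact h1.comp h2.contMDiffOn h

lemma randers_chartSegment (g : Metric n M) (τ : OneForm n M)
    {e : OpenPartialHomeomorph M (Model n)}
    (he : e ∈ IsManifold.maximalAtlas (𝓡 n) ∞ M) {x y : Model n} {t : ℝ} (ht : t ∈ Icc (0 : ℝ) 1)
    (h : x + t • (y - x) ∈ e.target) :
    randers g τ (chartSegment e x y t)
      (mfderivWithin 𝓘(ℝ, ℝ) (𝓡 n) (chartSegment e x y) (Icc 0 1) t (1 : ℝ)) =
      chartRanders g τ e (x + t • (y - x)) (y - x) := by
  have h1 := ((mdifferentiable_of_mem he).mdifferentiableAt_symm h).hasMFDerivAt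
  have h2 : HasMFDerivAt 𝓘(ℝ, ℝ) (𝓡 n) (fun t : ℝ => x + t • (y - x)) t
      (ContinuousLinearMap.toSpanSingleton ℝ (y - x)) := by
    apply HasFDerivAt.hasMFDerivAt
    have h := ((hasDerivAt_id t).smul_const (y - x)).const_add x
    rw [one_smul] at h
    exact h.hasFDerivAt
  have h3 : HasMFDerivAt 𝓘(ℝ, ℝ) (𝓡 n) (chartSegment e x y) t _ :=
    HasMFDerivAt.comp (I' := 𝓡 n) t h1 h2
  rw [mfderivWithin_eq_mfderiv ((uniqueDiffOn_Icc zero_lt_one).uniqueMDiffOn t ht)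
    h3.mdifferentiableAt, h3.mfderiv]
  unfold chartRanders chartSegment
  congr 1
  change mfderiv (𝓡 n) (𝓡 n) e.symm (x + t • (y - x)) ((1 : ℝ) • (y - x)) = _
  rw [one_smul]

/-- The distance is bounded by the length of the segment in a chart. -/
lemma finslerDist_le_of_segment {g : Metric n M} {τ : OneForm n M} (hτ : NormLTOne g τ)
    {e : OpenPartialHomeomorph M (Model n)} (he : e ∈ IsManifold.maximalAtlas (𝓡 n) ∞ M)
    {x y : Model n} (h : ∀ t ∈ Icc (0 : ℝ) 1, x + t • (y - x) ∈ e.target) {B : ℝ}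
    (hB : ∀ t ∈ Icc (0 : ℝ) 1, chartRanders g τ e (x + t • (y - x)) (y - x) ≤ B) :
    finslerDist (randers g τ) (e.symm x) (e.symm y) ≤ B := by
  have hc := contMDiffOn_chartSegment he h
  have h1 := finslerDist_le hτ hc
  have h0 : chartSegment e x y 0 = e.symm x := by simp [chartSegment]
  have h2 : chartSegment e x y 1 = e.symm y := by simp [chartSegment]
  rw [h0, h2] at h1
  refine h1.trans ?_
  have h3 : curveLength (randers g τ) (chartSegment e x y) ≤ ∫ _ in (0 : ℝ)..1, B := by
    refine intervalIntegral.integral_mono_on zero_le_one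
      ((continuousOn_randers_velocity g τ hc).intervalIntegrable_of_Icc zero_le_one)
      intervalIntegrable_const fun t ht => ?_
    rw [randers_chartSegment g τ he ht (h t ht)]
    exact hB t ht
  simpa using h3

/-- A connecting curve must be supplied, because `sInf` of the empty set is the default value 0. -/
lemma le_finslerDist {g : Metric n M} {τ : OneForm n M} {p q : M} {B : ℝ}
    (hne : ∃ c : ℝ → M, ContMDiffOn 𝓘(ℝ, ℝ) (𝓡 n) 1 c (Icc 0 1) ∧ c 0 = p ∧ c 1 = q)
    (h : ∀ c : ℝ → M, ContMDiffOn 𝓘(ℝ, ℝ) (𝓡 n) 1 c (Icc 0 1) → c 0 = p → c 1 = q →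
      B ≤ curveLength (randers g τ) c) : B ≤ finslerDist (randers g τ) p q := by
  obtain ⟨c, hc, h0, h1⟩ := hne
  refine le_csInf ⟨_, c, hc, h0, h1, rfl⟩ ?_
  rintro L ⟨c', hc', h0', h1', rfl⟩
  exact h c' hc' h0' h1'

/-- A curve starting in a coordinate ball either stays inside the ball, or its initial piece reaches
the boundary of the ball inside the closed ball. -/
lemma stays_or_exits [T2Space M] {e : OpenPartialHomeomorph M (Model n)} {u : Model n} {r : ℝ}
    (hr : Metric.closedBall u r ⊆ e.target) {c : ℝ → M} (hc : ContinuousOn c (Icc 0 1))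
    (h0 : c 0 ∈ e.source) (h0' : e (c 0) ∈ Metric.ball u r) :
    (∀ t ∈ Icc (0 : ℝ) 1, c t ∈ e.source ∧ e (c t) ∈ Metric.closedBall u r) ∨
    ∃ b ∈ Icc (0 : ℝ) 1, (∀ t ∈ Icc (0 : ℝ) b, c t ∈ e.source ∧ e (c t) ∈ Metric.closedBall u r) ∧
      dist (e (c b)) u = r := by
  set B : Set M := e.source ∩ e ⁻¹' Metric.ball u r with hB
  set B' : Set M := e.symm '' Metric.closedBall u r with hB'
  have hBo : IsOpen B := e.isOpen_inter_preimage Metric.isOpen_ball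
  have hBc : IsClosed B' := ((isCompact_closedBall u r).image_of_continuousOn
    (e.continuousOn_symm.mono hr)).isClosed
  have hBB : B ⊆ B' := fun p hp => ⟨e p, Metric.ball_subset_closedBall hp.2, e.left_inv hp.1⟩
  have hB'1 : ∀ p ∈ B', p ∈ e.source ∧ e p ∈ Metric.closedBall u r := by
    rintro p ⟨z, hz, rfl⟩
    exact ⟨e.map_target (hr hz), by rwa [e.right_inv (hr hz)]⟩
  set S : Set ℝ := Icc (0 : ℝ) 1 ∩ c ⁻¹' Bᶜ with hS
  have hSc : IsClosed S := hc.preimage_isClosed_of_isClosed isClosed_Icc hBo.isClosed_compl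
  by_cases hne : S.Nonempty
  · right
    have hbdd : BddBelow S := ⟨0, fun t ht => ht.1.1⟩
    have hmem := hSc.csInf_mem hne hbdd
    -- The first time at which the curve is outside the open ball; by continuity the point reached
    -- lies in the compact closed ball, hence on its boundary.
    set b := sInf S
    have hlt : ∀ t ∈ Ico (0 : ℝ) b, c t ∈ B := by
      intro t ht
      by_contra hcon
      exact absurd (csInf_le hbdd (show t ∈ S from ⟨⟨ht.1, ht.2.le.trans hmem.1.2⟩, hcon⟩))
        (not_le.2 ht.2)
    have hbpos : 0 < b := by
      rcases hmem.1.1.lt_or_eq with h | h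
      · exact h
      · exact absurd (h ▸ (⟨h0, h0'⟩ : c 0 ∈ B)) hmem.2
    have hcb : c b ∈ B' := by
      have hcl : b ∈ closure (Ico (0 : ℝ) b) := by
        rw [closure_Ico hbpos.ne]; exact ⟨hbpos.le, le_rfl⟩
      have hcw : ContinuousWithinAt c (Ico 0 b) b :=
        (hc b hmem.1).mono fun t ht => ⟨ht.1, ht.2.le.trans hmem.1.2⟩
      have := hcw.mem_closure hcl (fun t ht => hBB (hlt t ht))
      rwa [hBc.closure_eq] at this
    have hcb' := hB'1 _ hcb
    refine ⟨b, hmem.1, fun t ht => ?_, ?_⟩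
    · rcases ht.2.lt_or_eq with h | h
      · exact hB'1 _ (hBB (hlt t ⟨ht.1, h⟩))
      · rw [h]; exact hcb'
    · refine le_antisymm (Metric.mem_closedBall.1 hcb'.2) (not_lt.1 fun h => ?_)
      exact hmem.2 ⟨hcb'.1, h⟩
  · left
    intro t ht
    refine hB'1 _ (hBB ?_)
    by_contra hcon
    exact hne ⟨t, ht, hcon⟩

/-- In a chart, the distance agrees with the Finsler function to first order. -/
theorem abs_finslerDist_sub_chartRanders_le [T2Space M] {g : Metric n M} {τ : OneForm n M}
    (hτ : NormLTOne g τ)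
    {e : OpenPartialHomeomorph M (Model n)} (he : e ∈ IsManifold.maximalAtlas (𝓡 n) ∞ M)
    {u : Model n} (hu : u ∈ e.target) {ε : ℝ} (hε : 0 < ε) :
    ∃ r > 0, ∀ x ∈ Metric.ball u r, ∀ y ∈ Metric.ball u r,
      |finslerDist (randers g τ) (e.symm x) (e.symm y) - chartRanders g τ e u (y - x)| ≤
        ε * ‖y - x‖ := by
  obtain ⟨δ, hδ, C, hC, hbd⟩ := exists_bounds_chartRanders hτ he hu
  -- `η` is the allowed oscillation of the Finsler function on the ball
  set η : ℝ := min (min ε (δ / 2)) (ε * δ / (2 * C)) with hη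
  have hη0 : 0 < η := by positivity
  have hηε : η ≤ ε := (min_le_left _ _).trans (min_le_left _ _)
  have hηδ : η ≤ δ / 2 := (min_le_left _ _).trans (min_le_right _ _)
  have hηC : η * (2 * C) ≤ ε * δ := by
    rw [← le_div_iff₀ (by positivity)]; exact min_le_right _ _
  obtain ⟨r, hr, hball⟩ := Metric.eventually_nhds_iff_ball.1
    ((eventually_abs_chartRanders_sub_le g τ he hu hη0).and (e.open_target.mem_nhds hu))
  set R := r / 2 with hR
  have hR0 : 0 < R := by positivity
  have hcb : ∀ z ∈ Metric.closedBall u R, z ∈ Metric.ball u r := fun z hz =>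
    (Metric.mem_closedBall.1 hz).trans_lt (by linarith)
  have hlow : ∀ z ∈ Metric.closedBall u R, ∀ w, δ / 2 * ‖w‖ ≤ chartRanders g τ e z w := by
    intro z hz w
    have h1 := (abs_le.1 ((hball z (hcb z hz)).1 w)).1
    have h2 := (hbd w).1
    nlinarith [norm_nonneg w]
  -- A curve from `ball u ρ` to distance `R` from `u` moves at least `R / 2`, so its length is at
  -- least δR/4 ≥ 2Cρ, which exceeds any F-length of `y - x`. Curves that leave the ball thus need
  -- no fine estimate.
  set ρ : ℝ := min (R / 2) (δ * R / (8 * C)) with hρ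
  have hρ0 : 0 < ρ := by positivity
  have hρR : ρ ≤ R / 2 := min_le_left _ _
  have hρC : ρ * (8 * C) ≤ δ * R := by
    rw [← le_div_iff₀ (by positivity)]; exact min_le_right _ _
  refine ⟨ρ, hρ0, fun x hx y hy => ?_⟩
  have hseg : ∀ t ∈ Icc (0 : ℝ) 1, x + t • (y - x) ∈ Metric.ball u ρ := fun t ht => by
    have := (convex_ball u ρ).add_smul_sub_mem hx hy ht
    exact this
  have hρr : Metric.ball u ρ ⊆ Metric.ball u r := Metric.ball_subset_ball (by linarith)
  have hsegt : ∀ t ∈ Icc (0 : ℝ) 1, x + t • (y - x) ∈ e.target := fun t ht =>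
    (hball _ (hρr (hseg t ht))).2
  have hxy : ‖y - x‖ ≤ 2 * ρ := by
    rw [← dist_eq_norm]
    have h1 := dist_triangle_right y x u
    have := Metric.mem_ball.1 hx
    have := Metric.mem_ball.1 hy
    linarith
  set w := y - x with hw
  have hxt := (hball _ (hρr hx)).2
  have hyt := (hball _ (hρr hy)).2
  rw [abs_le]
  constructor
  · have hgoal : chartRanders g τ e u w - ε * ‖w‖ ≤
        finslerDist (randers g τ) (e.symm x) (e.symm y) := by
      refine le_finslerDist ⟨_, contMDiffOn_chartSegment he hsegt, by simp [chartSegment],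
        by simp [chartSegment]⟩ ?_
      intro c hc hc0 hc1
      have hc0s : c 0 ∈ e.source := hc0 ▸ e.map_target hxt
      have hec0 : e (c 0) = x := by rw [hc0, e.right_inv hxt]
      have hec1 : e (c 1) = y := by rw [hc1, e.right_inv hyt]
      rcases stays_or_exits (fun z hz => (hball z (hcb z hz)).2) hc.continuousOn hc0s
        (by rw [hec0]; exact Metric.ball_subset_ball (by linarith) hx) with h | ⟨b, hb, h, hbr⟩
      · obtain ⟨β, hβ1, hβ2⟩ := exists_calibration g τ (e.symm u)
          (mfderiv (𝓡 n) (𝓡 n) e.symm u w)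
        set β' : Model n →L[ℝ] ℝ := β.comp (mfderiv (𝓡 n) (𝓡 n) e.symm u) with hβ'
        have hβ'1 : ∀ v, β' v ≤ chartRanders g τ e u v := fun v => hβ1 _
        have hβ'2 : β' w = chartRanders g τ e u w := hβ2
        -- On the ball the calibration at `u` is at most (1 + 2η/δ)F, and (1 - s)(1 + s) ≤ 1, so
        -- shrinking by `k` makes it admissible for F there. The loss (2η/δ)F(w) is at most ε‖w‖ by
        -- the choice of `η`.
        set k : ℝ := 1 - 2 * η / δ with hk
        have hk0 : 0 ≤ k := by
          rw [hk, sub_nonneg, div_le_one hδ]; linarith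
        have hkl := sub_le_curveLength hτ he hc zero_le_one le_rfl (fun t ht => (h t ht).1)
          (k • β') (fun t ht v => by
            have h1 := (abs_le.1 ((hball _ (hcb _ (h t ht).2)).1 v)).1
            have h2 := hlow _ (h t ht).2 v
            have h3 := hβ'1 v
            have h4 : η * ‖v‖ ≤ 2 * η / δ * chartRanders g τ e (e (c t)) v := by
              rw [div_mul_eq_mul_div, le_div_iff₀ hδ]; nlinarith
            have h5 : β' v ≤ (1 + 2 * η / δ) * chartRanders g τ e (e (c t)) v := by linarith
            have h6 : 0 ≤ chartRanders g τ e (e (c t)) v := chartRanders_nonneg hτ e _ _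
            calc (k • β') v = k * β' v := rfl
              _ ≤ k * ((1 + 2 * η / δ) * chartRanders g τ e (e (c t)) v) :=
                mul_le_mul_of_nonneg_left h5 hk0
              _ = (1 - (2 * η / δ) ^ 2) * chartRanders g τ e (e (c t)) v := by rw [hk]; ring
              _ ≤ chartRanders g τ e (e (c t)) v := by nlinarith [sq_nonneg (2 * η / δ)])
        rw [hec0, hec1, ← map_sub, ← hw] at hkl
        refine le_trans ?_ hkl
        have h7 : (k • β') w = k * chartRanders g τ e u w := by rw [← hβ'2]; rfl
        rw [h7, hk]
        have h8 := (hbd w).2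
        have h9 : 2 * η / δ * chartRanders g τ e u w ≤ ε * ‖w‖ := by
          rw [div_mul_eq_mul_div, div_le_iff₀ hδ]
          nlinarith [mul_le_mul_of_nonneg_right hηC (norm_nonneg w)]
        linarith
      -- Exit case: the covector δ/2 · ⟨a/‖a‖, ·⟩ is dominated by F on the ball and measures the
      -- displacement `a`.
      · set a := e (c b) - x with ha
        have hkl := sub_le_curveLength hτ he hc hb.1 hb.2 (fun t ht => (h t ht).1)
          ((δ / 2 * ‖a‖⁻¹) • innerSL ℝ a) (fun t ht v => by
            refine le_trans ?_ (hlow _ (h t ht).2 v)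
            have h1 := real_inner_le_norm a v
            have h2 : ‖a‖⁻¹ * (‖a‖ * ‖v‖) ≤ ‖v‖ := by
              rw [← mul_assoc]
              exact mul_le_of_le_one_left (norm_nonneg _) (inv_mul_le_one)
            have h3 : ‖a‖⁻¹ * inner ℝ a v ≤ ‖v‖ :=
              (mul_le_mul_of_nonneg_left h1 (by positivity)).trans h2
            simp only [smul_apply, innerSL_apply_apply, smul_eq_mul]
            nlinarith)
        rw [hec0, ← map_sub, ← ha] at hkl
        have ha2 : R / 2 ≤ ‖a‖ := by
          have h1 := dist_triangle (e (c b)) x u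
          have h2 := Metric.mem_ball.1 hx
          rw [ha, ← dist_eq_norm]; linarith
        have h5 : ((δ / 2 * ‖a‖⁻¹) • innerSL ℝ a) a = δ / 2 * ‖a‖ := by
          have : ‖a‖ ≠ 0 := by linarith
          simp only [smul_apply, innerSL_apply_apply, smul_eq_mul, real_inner_self_eq_norm_sq]
          field_simp
        rw [h5] at hkl
        refine le_trans ?_ hkl
        have h8 := (hbd w).2
        have h9 : C * ‖w‖ ≤ C * (2 * ρ) := mul_le_mul_of_nonneg_left hxy hC.le
        nlinarith [norm_nonneg w, mul_nonneg hε.le (norm_nonneg w)]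
    linarith
  -- The upper bound is the length of the coordinate segment.
  · have := finslerDist_le_of_segment hτ he hsegt (B := chartRanders g τ e u w + ε * ‖w‖)
      fun t ht => by
        have h1 := (abs_le.1 ((hball _ (hρr (hseg t ht))).1 w)).2
        nlinarith [norm_nonneg w]
    linarith

end Distance

/-! ### The triangular function determines g and dτ. -/

section Triangular

set_option linter.unusedSectionVars false

variable {n : ℕ} {M : Type*} [TopologicalSpace M] [ChartedSpace (Model n) M]
  [IsManifold (𝓡 n) ∞ M]

/-- The `i`-th coordinate functional on `ℝⁿ`. -/
def coordProj (i : Fin n) : Model n →L[ℝ] ℝ := EuclideanSpace.proj i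

lemma coordProj_apply (i : Fin n) (v : Model n) : coordProj i v = v i := rfl

/-- The squared norm of `g` in a chart. -/
def chartSq (g : Metric n M) (e : OpenPartialHomeomorph M (Model n)) (u v : Model n) : ℝ :=
  g.inner (e.symm u) (mfderiv (𝓡 n) (𝓡 n) e.symm u v) (mfderiv (𝓡 n) (𝓡 n) e.symm u v)

lemma chartSq_eq_sum (g : Metric n M) (e : OpenPartialHomeomorph M (Model n)) (u v : Model n) :
    chartSq g e u v = ∑ i, ∑ j, v i * v j * gram g e u i j := inner_mfderiv_symm g e u v v

lemma chartSq_nonneg (g : Metric n M) (e : OpenPartialHomeomorph M (Model n)) (u v : Model n) :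
    0 ≤ chartSq g e u v := by
  unfold chartSq
  generalize mfderiv (𝓡 n) (𝓡 n) e.symm u v = x
  by_cases hx : x = 0
  · simp [hx]
  · exact (g.pos _ x hx).le

lemma chartRanders_eq (g : Metric n M) (τ : OneForm n M) (e : OpenPartialHomeomorph M (Model n))
    (u v : Model n) :
    chartRanders g τ e u v = √(chartSq g e u v) + ∑ i, v i * comp1 τ e i u := by
  rw [← oneForm_mfderiv_symm]; rfl

lemma gram_symm (g : Metric n M) (e : OpenPartialHomeomorph M (Model n)) (u : Model n)
    (i j : Fin n) : gram g e u i j = gram g e u j i := g.symm _ _ _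

/-- Polarization. -/
lemma gram_eq_of_chartSq_eq {g : Metric n M} {e e' : OpenPartialHomeomorph M (Model n)}
    {u : Model n} (h : ∀ v, chartSq g e u v = chartSq g e' u v) : gram g e u = gram g e' u := by
  ext i j
  have key : ∀ e : OpenPartialHomeomorph M (Model n),
      chartSq g e u (EuclideanSpace.single i 1 + EuclideanSpace.single j 1) =
      chartSq g e u (EuclideanSpace.single i 1) + chartSq g e u (EuclideanSpace.single j 1) +
        2 * gram g e u i j := by
    intro e
    have h1 : mfderiv (𝓡 n) (𝓡 n) e.symm u
        (EuclideanSpace.single i (1 : ℝ) + EuclideanSpace.single j (1 : ℝ) : Model n) =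
        coordVec e u i + coordVec e u j := (mfderiv (𝓡 n) (𝓡 n) e.symm u).map_add _ _
    have h2 : g.inner (e.symm u) (coordVec e u j) (coordVec e u i) = gram g e u i j :=
      g.symm _ _ _
    unfold chartSq
    rw [h1]
    simp only [map_add, add_apply]
    rw [h2]
    change _ = gram g e u i i + gram g e u j j + _
    simp only [gram, Matrix.of_apply]
    ring
  have h1 := key e
  have h2 := key e'
  rw [h, h, h] at h1
  linarith

/-- The function of `T` on two charts agreeing on an open set. -/
def SameTriangular (g : Metric n M) (τ : OneForm n M) (e e' : OpenPartialHomeomorph M (Model n))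
    (O : Set (Model n)) : Prop :=
  ∀ x ∈ O, ∀ y ∈ O, ∀ z ∈ O, triangular (randers g τ) (e.symm x) (e.symm y) (e.symm z) =
    triangular (randers g τ) (e'.symm x) (e'.symm y) (e'.symm z)

variable [T2Space M] {g : Metric n M} {τ : OneForm n M}
  {e e' : OpenPartialHomeomorph M (Model n)} {O : Set (Model n)}

lemma finslerDist_self (hτ : NormLTOne g τ) (he : e ∈ IsManifold.maximalAtlas (𝓡 n) ∞ M)
    {u : Model n} (hu : u ∈ e.target) : finslerDist (randers g τ) (e.symm u) (e.symm u) = 0 := by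
  obtain ⟨r, hr, h⟩ := abs_finslerDist_sub_chartRanders_le hτ he hu one_pos
  have := h u (Metric.mem_ball_self hr) u (Metric.mem_ball_self hr)
  simpa [chartRanders_zero] using this

lemma chartRanders_neg (g : Metric n M) (τ : OneForm n M)
    (e : OpenPartialHomeomorph M (Model n)) (u v : Model n) :
    chartRanders g τ e u (-v) = √(chartSq g e u v) - ∑ i, v i * comp1 τ e i u := by
  rw [chartRanders_eq]
  have h : chartSq g e u (-v) = chartSq g e u v := by
    simp [chartSq_eq_sum]
  simp [h, sub_eq_add_neg]

/-- T(u,y,u) is d(u,y) + d(y,u) because d(u,u) = 0, and F(v) + F(-v) = 2√g(v,v). Taking y = u + sv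
with s small makes the first order errors at most ε after division by s. -/
lemma chartSq_eq_of_sameTriangular (hτ : NormLTOne g τ)
    (he : e ∈ IsManifold.maximalAtlas (𝓡 n) ∞ M) (he' : e' ∈ IsManifold.maximalAtlas (𝓡 n) ∞ M)
    (hO : IsOpen O) (hOe : O ⊆ e.target) (hOe' : O ⊆ e'.target) (hT : SameTriangular g τ e e' O)
    {u : Model n} (hu : u ∈ O) (v : Model n) : chartSq g e u v = chartSq g e' u v := by
  suffices h : √(chartSq g e u v) = √(chartSq g e' u v) by
    rwa [Real.sqrt_inj (chartSq_nonneg _ _ _ _) (chartSq_nonneg _ _ _ _)] at h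
  refine eq_of_abs_sub_le_all fun ε hε => ?_
  set η := ε / (2 * (‖v‖ + 1)) with hη
  have hη0 : 0 < η := by positivity
  obtain ⟨r, hr, h1⟩ := abs_finslerDist_sub_chartRanders_le hτ he (hOe hu) hη0
  obtain ⟨r', hr', h1'⟩ := abs_finslerDist_sub_chartRanders_le hτ he' (hOe' hu) hη0
  have hcont : Filter.Tendsto (fun s : ℝ => u + s • v) (𝓝[>] 0) (𝓝 u) := by
    have : Continuous (fun s : ℝ => u + s • v) := by fun_prop
    simpa using (this.tendsto 0).mono_left nhdsWithin_le_nhds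
  obtain ⟨s, hs0, hsr, hsr', hsO⟩ : ∃ s : ℝ, 0 < s ∧ u + s • v ∈ Metric.ball u r ∧
      u + s • v ∈ Metric.ball u r' ∧ u + s • v ∈ O := by
    have := ((eventually_mem_nhdsWithin (a := (0 : ℝ)) (s := Ioi 0)).and
      ((hcont.eventually (Metric.ball_mem_nhds u hr)).and
        ((hcont.eventually (Metric.ball_mem_nhds u hr')).and
          (hcont.eventually (hO.mem_nhds hu))))).exists
    exact this
  set y := u + s • v with hy
  have hyu : y - u = s • v := by simp [hy]
  have huy : u - y = s • (-v) := by simp [hy]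
  have a1 := h1 u (Metric.mem_ball_self hr) y hsr
  have a2 := h1 y hsr u (Metric.mem_ball_self hr)
  have b1 := h1' u (Metric.mem_ball_self hr') y hsr'
  have b2 := h1' y hsr' u (Metric.mem_ball_self hr')
  rw [hyu, chartRanders_smul _ _ _ _ _ hs0.le, chartRanders_eq, norm_smul, Real.norm_of_nonneg hs0.le]
    at a1 b1
  rw [huy, chartRanders_smul _ _ _ _ _ hs0.le, chartRanders_neg, norm_smul, norm_neg,
    Real.norm_of_nonneg hs0.le] at a2 b2
  have hTT := hT u hu y hsO u hu
  simp only [triangular] at hTT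
  rw [finslerDist_self hτ he (hOe hu), finslerDist_self hτ he' (hOe' hu)] at hTT
  rw [abs_le] at a1 a2 b1 b2
  have hηv : 2 * (η * ‖v‖) ≤ ε := by
    have : η * (2 * (‖v‖ + 1)) = ε := by rw [hη]; field_simp
    nlinarith
  have hsη : 2 * (η * (s * ‖v‖)) ≤ s * ε := by nlinarith
  rw [abs_le]
  constructor
  · nlinarith
  · nlinarith

/-- The difference of the two forms is the differential of the difference of the distances from a
fixed point. -/
lemma hasFDerivAt_of_sameTriangular (hτ : NormLTOne g τ)
    (he : e ∈ IsManifold.maximalAtlas (𝓡 n) ∞ M) (he' : e' ∈ IsManifold.maximalAtlas (𝓡 n) ∞ M)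
    (hO : IsOpen O) (hOe : O ⊆ e.target) (hOe' : O ⊆ e'.target) (hT : SameTriangular g τ e e' O)
    {u₀ u : Model n} (hu₀ : u₀ ∈ O) (hu : u ∈ O) :
    HasFDerivAt (fun y => finslerDist (randers g τ) (e'.symm u₀) (e'.symm y) -
        finslerDist (randers g τ) (e.symm u₀) (e.symm y))
      (∑ i, (comp1 τ e' i u - comp1 τ e i u) • coordProj i)
      u := by
  rw [hasFDerivAt_iff_isLittleO, Asymptotics.isLittleO_iff]
  intro ε hε
  obtain ⟨r, hr, h1⟩ := abs_finslerDist_sub_chartRanders_le hτ he (hOe hu) (half_pos hε)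
  obtain ⟨r', hr', h1'⟩ := abs_finslerDist_sub_chartRanders_le hτ he' (hOe' hu) (half_pos hε)
  filter_upwards [Metric.ball_mem_nhds u hr, Metric.ball_mem_nhds u hr', hO.mem_nhds hu]
    with y hy hy' hyO
  have a1 := h1 u (Metric.mem_ball_self hr) y hy
  have b1 := h1' u (Metric.mem_ball_self hr') y hy'
  rw [chartRanders_eq] at a1 b1
  rw [chartSq_eq_of_sameTriangular hτ he he' hO hOe hOe' hT hu] at a1
  -- Equality of T(u₀,u,y) says that the increment from `u` to `y` of the difference of distances
  -- from `u₀` is the difference of the two distances from `u` to `y`. To first order this is the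
  -- difference of the Finsler functions at `u`, whose metric parts cancel.
  have hTT := hT u₀ hu₀ u hu y hyO
  simp only [triangular] at hTT
  have hsum : (∑ i, (comp1 τ e' i u - comp1 τ e i u) •
      coordProj i) (y - u) =
      ∑ i, (y - u) i * comp1 τ e' i u - ∑ i, (y - u) i * comp1 τ e i u := by
    rw [← Finset.sum_sub_distrib, sum_apply]
    refine Finset.sum_congr rfl fun i _ => ?_
    simp only [smul_apply, coordProj_apply, smul_eq_mul]
    ring
  rw [hsum, Real.norm_eq_abs]
  rw [abs_le] at a1 b1 ⊢
  constructor <;> linarith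

/-- The difference of the two forms is the differential of one function on all of `O`, and this
differential is again differentiable. Its derivative is then symmetric, so the difference is closed.
-/
theorem extDerivCoord_eq_of_sameTriangular (hτ : NormLTOne g τ)
    (he : e ∈ IsManifold.maximalAtlas (𝓡 n) ∞ M) (he' : e' ∈ IsManifold.maximalAtlas (𝓡 n) ∞ M)
    (hO : IsOpen O) (hOe : O ⊆ e.target) (hOe' : O ⊆ e'.target) (hT : SameTriangular g τ e e' O)
    {u : Model n} (hu : u ∈ O) (i j : Fin n) :
    extDerivCoord τ e' u i j = extDerivCoord τ e u i j := by
  have hd : ∀ k, HasFDerivAt (fun y => comp1 τ e' k y - comp1 τ e k y)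
      (fderiv ℝ (comp1 τ e' k) u - fderiv ℝ (comp1 τ e k) u) u := by
    intro k
    have h1 := ((contDiffOn_comp1 τ he k).contDiffAt (e.open_target.mem_nhds (hOe hu)))
    have h1' := ((contDiffOn_comp1 τ he' k).contDiffAt (e'.open_target.mem_nhds (hOe' hu)))
    exact (h1'.differentiableAt (by simp)).hasFDerivAt.sub (h1.differentiableAt (by simp)).hasFDerivAt
  have h2 := HasFDerivAt.fun_sum (u := Finset.univ) fun k _ => (hd k).smul_const
    (coordProj k)
  have h3 := second_derivative_symmetric_of_eventually (x := u)
    (Filter.eventually_of_mem (hO.mem_nhds hu) fun y hy =>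
      hasFDerivAt_of_sameTriangular hτ he he' hO hOe hOe' hT hu hy) h2
    (EuclideanSpace.single i 1) (EuclideanSpace.single j 1)
  simp only [sum_apply, ContinuousLinearMap.smulRight_apply,
    smul_apply, coordProj_apply, smul_eq_mul, PiLp.single_apply, mul_ite,
    mul_one, mul_zero, Finset.sum_ite_eq', Finset.mem_univ, if_true, sub_apply] at h3
  simp only [extDerivCoord, pd]
  change fderiv ℝ (comp1 τ e' j) u _ - fderiv ℝ (comp1 τ e' i) u _ =
    fderiv ℝ (comp1 τ e j) u _ - fderiv ℝ (comp1 τ e i) u _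
  linarith

end Triangular

/-! ### Lie derivatives and pullbacks in coordinates. -/

section Calculus

variable {n : ℕ}

/-- Exchange of the time and space derivatives, from the symmetry of the second derivative of ψ on
the product. It turns the derivative of the flow's Jacobian into the Jacobian of the field. -/
lemma hasDerivAt_fderiv_slice {E F : Type*} [NormedAddCommGroup E] [NormedSpace ℝ E]
    [NormedAddCommGroup F] [NormedSpace ℝ F] {ψ : ℝ × E → F} {u₀ : E}
    (hψ : ContDiffAt ℝ 2 ψ (0, u₀)) {k : E → F}
    (hk : ∀ᶠ u in 𝓝 u₀, HasDerivAt (fun t => ψ (t, u)) (k u) 0) (v : E) :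
    HasDerivAt (fun t => fderiv ℝ (fun u => ψ (t, u)) u₀ v) (fderiv ℝ k u₀ v) 0 := by
  have hd : ∀ᶠ z in 𝓝 ((0 : ℝ), u₀), DifferentiableAt ℝ ψ z := by
    filter_upwards [(hψ.eventually (by simp))] with z hz using hz.differentiableAt (by simp)
  have hD : DifferentiableAt ℝ (fderiv ℝ ψ) (0, u₀) :=
    (hψ.fderiv_right (m := 1) (by norm_num)).differentiableAt (by simp)
  have hsymm : IsSymmSndFDerivAt ℝ ψ (0, u₀) := hψ.isSymmSndFDerivAt (by simp)
  have ht : Filter.Tendsto (fun t : ℝ => (t, u₀)) (𝓝 0) (𝓝 (0, u₀)) := by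
    have : Continuous (fun t : ℝ => (t, u₀)) := by fun_prop
    exact this.tendsto 0
  have hu : Filter.Tendsto (fun u : E => ((0 : ℝ), u)) (𝓝 u₀) (𝓝 (0, u₀)) := by
    have : Continuous (fun u : E => ((0 : ℝ), u)) := by fun_prop
    exact this.tendsto u₀
  have h1 : (fun t => fderiv ℝ (fun u => ψ (t, u)) u₀ v) =ᶠ[𝓝 0]
      fun t => fderiv ℝ ψ (t, u₀) (0, v) := by
    filter_upwards [ht.eventually hd] with t h
    have h' : HasFDerivAt (fun u => ψ (t, u)) _ u₀ :=
      h.hasFDerivAt.comp u₀ (hasFDerivAt_prodMk_right t u₀)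
    rw [h'.fderiv]; rfl
  have h2 : k =ᶠ[𝓝 u₀] fun u => fderiv ℝ ψ (0, u) (1, 0) := by
    filter_upwards [hu.eventually hd, hk] with u h hk
    have h' : HasFDerivAt (fun t => ψ (t, u)) _ (0 : ℝ) :=
      h.hasFDerivAt.comp (0 : ℝ) (hasFDerivAt_prodMk_left (0 : ℝ) u)
    rw [← hk.deriv, h'.hasDerivAt.deriv]; rfl
  have h3 : HasFDerivAt (fun t => fderiv ℝ ψ (t, u₀)) _ (0 : ℝ) :=
    hD.hasFDerivAt.comp (0 : ℝ) (hasFDerivAt_prodMk_left (0 : ℝ) u₀)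
  have h4 : HasFDerivAt (fun u => fderiv ℝ ψ (0, u)) _ u₀ :=
    hD.hasFDerivAt.comp u₀ (hasFDerivAt_prodMk_right (0 : ℝ) u₀)
  have h5 : HasFDerivAt (fun u => fderiv ℝ ψ (0, u) (1, 0)) _ u₀ :=
    h4.clm_apply (hasFDerivAt_const ((1 : ℝ), (0 : E)) u₀)
  have h6 : HasDerivAt (fun t => fderiv ℝ ψ (t, u₀) (0, v)) _ (0 : ℝ) :=
    (h3.clm_apply (hasFDerivAt_const ((0 : ℝ), v) (0 : ℝ))).hasDerivAt
  rw [h2.fderiv_eq, h5.fderiv]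
  refine (h6.congr_of_eventuallyEq h1).congr_deriv ?_
  simpa using hsymm (1, 0) (0, v)

/-- A two-tensor that is invariant under a family of maps starting at the identity has vanishing
Lie derivative. -/
lemma lieDeriv_eq_zero {ψ : ℝ × Model n → Model n} {u₀ : Model n}
    (hψ : ContDiffAt ℝ 2 ψ (0, u₀)) {k : Model n → Model n} (hk0 : DifferentiableAt ℝ k u₀)
    (hk : ∀ᶠ u in 𝓝 u₀, HasDerivAt (fun t => ψ (t, u)) (k u) 0)
    (h0 : ∀ᶠ u in 𝓝 u₀, ψ (0, u) = u) {h : Fin n → Fin n → Model n → ℝ}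
    (hh : ∀ i j, DifferentiableAt ℝ (h i j) u₀) {i j : Fin n}
    (hinv : ∀ᶠ t in 𝓝 (0 : ℝ), h i j u₀ =
      ∑ a, ∑ b, fderiv ℝ (fun u => ψ (t, u)) u₀ (EuclideanSpace.single i 1) a *
        fderiv ℝ (fun u => ψ (t, u)) u₀ (EuclideanSpace.single j 1) b * h a b (ψ (t, u₀))) :
    ∑ c, k u₀ c * pd c (h i j) u₀ + ∑ a, pd i (fun u => k u a) u₀ * h a j u₀ +
      ∑ b, pd j (fun u => k u b) u₀ * h i b u₀ = 0 := by
  have hA : ∀ i a, HasDerivAt (fun t => fderiv ℝ (fun u => ψ (t, u)) u₀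
      (EuclideanSpace.single i 1) a) (pd i (fun u => k u a) u₀) 0 := by
    intro i a
    have h1 := hasDerivAt_fderiv_slice hψ hk (EuclideanSpace.single i (1 : ℝ))
    have h2 := (coordProj a).hasFDerivAt.comp_hasDerivAt (0 : ℝ) h1
    refine h2.congr_deriv ?_
    have h3 : HasFDerivAt (fun u => k u a) _ u₀ :=
      (coordProj a).hasFDerivAt.comp u₀ hk0.hasFDerivAt
    rw [pd, h3.fderiv]; rfl
  have hA0 : ∀ i a, fderiv ℝ (fun u => ψ (0, u)) u₀ (EuclideanSpace.single i 1) a =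
      if a = i then 1 else 0 := by
    intro i a
    have : (fun u => ψ (0, u)) =ᶠ[𝓝 u₀] id := h0
    rw [this.fderiv_eq, fderiv_id]
    simp
  have hψ0 : ψ (0, u₀) = u₀ := h0.self_of_nhds
  have hH : ∀ a b, HasDerivAt (fun t => h a b (ψ (t, u₀))) (∑ c, k u₀ c * pd c (h a b) u₀) 0 := by
    intro a b
    have h1 : HasFDerivAt (h a b) (fderiv ℝ (h a b) u₀) (ψ (0, u₀)) := by
      rw [hψ0]; exact (hh a b).hasFDerivAt
    refine (h1.comp_hasDerivAt (0 : ℝ) hk.self_of_nhds).congr_deriv ?_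
    conv_lhs => rw [model_eq_sum (k u₀)]
    rw [map_sum]
    simp only [map_smul, smul_eq_mul, pd]
  -- The pullback is constant in t; its derivative at t = 0, where the Jacobian is the identity, is
  -- the Lie derivative.
  have hsum := HasDerivAt.fun_sum (u := Finset.univ) fun a _ =>
    HasDerivAt.fun_sum (u := Finset.univ) fun b _ => ((hA i a).mul (hA j b)).mul (hH a b)
  have hconst : HasDerivAt (fun _ : ℝ => h i j u₀) 0 0 := hasDerivAt_const _ _
  have := (hconst.congr_of_eventuallyEq (hinv.mono fun t ht => ht.symm)).unique hsum
  simp only [Pi.mul_apply, hA0, hψ0] at this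
  rw [eq_comm] at this
  simp only [mul_ite, ite_mul, mul_one, one_mul, mul_zero, zero_mul, add_mul,
    Finset.sum_add_distrib, Finset.sum_ite_eq', Finset.mem_univ, if_true,
    Finset.sum_ite_irrel, Finset.sum_const_zero] at this
  linarith

/-- The components of the exterior derivative of a 1-form with components `T`. -/
def extd (T : Fin n → Model n → ℝ) (u : Model n) (i j : Fin n) : ℝ := pd i (T j) u - pd j (T i) u

/-- The exterior derivative commutes with pullback. -/
lemma extd_pullback {T T' : Fin n → Model n → ℝ} {ψ : Model n → Model n} {u : Model n}
    (hψ : ContDiffAt ℝ 2 ψ u) (hT' : ∀ a, DifferentiableAt ℝ (T' a) (ψ u))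
    (h : ∀ᶠ x in 𝓝 u, ∀ i, T i x =
      ∑ a, fderiv ℝ ψ x (EuclideanSpace.single i 1) a * T' a (ψ x)) (i j : Fin n) :
    extd T u i j = ∑ a, ∑ b, fderiv ℝ ψ u (EuclideanSpace.single i 1) a *
      fderiv ℝ ψ u (EuclideanSpace.single j 1) b * extd T' (ψ u) a b := by
  have hD : DifferentiableAt ℝ (fderiv ℝ ψ) u :=
    (hψ.fderiv_right (m := 1) (by norm_num)).differentiableAt (by simp)
  have hsymm : IsSymmSndFDerivAt ℝ ψ u := hψ.isSymmSndFDerivAt (by simp)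
  have hψ1 := (hψ.differentiableAt (by simp)).hasFDerivAt
  have key : ∀ i j, pd i (T j) u = ∑ a, (fderiv ℝ (fderiv ℝ ψ) u (EuclideanSpace.single i 1)
      (EuclideanSpace.single j 1) a * T' a (ψ u) + fderiv ℝ ψ u (EuclideanSpace.single j 1) a *
        ∑ b, fderiv ℝ ψ u (EuclideanSpace.single i 1) b * pd b (T' a) (ψ u)) := by
    intro i j
    have h1 : T j =ᶠ[𝓝 u] fun x =>
        ∑ a, fderiv ℝ ψ x (EuclideanSpace.single j 1) a * T' a (ψ x) := h.mono fun x hx => hx j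
    have h2 : ∀ a, HasFDerivAt (fun x => fderiv ℝ ψ x (EuclideanSpace.single j 1) a) _ u := fun a =>
      (coordProj a).hasFDerivAt.comp u (hD.hasFDerivAt.clm_apply
        (hasFDerivAt_const (EuclideanSpace.single j (1 : ℝ) : Model n) u))
    have h3 : ∀ a, HasFDerivAt (fun x => T' a (ψ x)) _ u := fun a =>
      (hT' a).hasFDerivAt.comp u hψ1
    have h4 : HasFDerivAt (fun x => ∑ a, fderiv ℝ ψ x (EuclideanSpace.single j 1) a * T' a (ψ x))
        _ u := HasFDerivAt.fun_sum (u := Finset.univ) fun a _ => (h2 a).mul (h3 a)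
    rw [pd, h1.fderiv_eq, h4.fderiv, sum_apply]
    refine Finset.sum_congr rfl fun a _ => ?_
    have h5 : fderiv ℝ (T' a) (ψ u) (fderiv ℝ ψ u (EuclideanSpace.single i 1)) =
        ∑ b, fderiv ℝ ψ u (EuclideanSpace.single i 1) b * pd b (T' a) (ψ u) := by
      conv_lhs => rw [model_eq_sum (fderiv ℝ ψ u (EuclideanSpace.single i 1))]
      rw [map_sum]
      simp only [map_smul, smul_eq_mul, pd]
    rw [← h5]
    simp [coordProj_apply]
    ring
  -- The terms with second derivatives of ψ are symmetric in i and j and drop out of the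
  -- antisymmetrization.
  have hs : ∀ a, fderiv ℝ (fderiv ℝ ψ) u (EuclideanSpace.single i 1)
      (EuclideanSpace.single j 1) a = fderiv ℝ (fderiv ℝ ψ) u (EuclideanSpace.single j 1)
      (EuclideanSpace.single i 1) a := fun a => by rw [hsymm]
  unfold extd
  rw [key i j, key j i]
  simp only [Finset.sum_add_distrib, hs, mul_sub, Finset.sum_sub_distrib, Finset.mul_sum]
  rw [add_sub_add_left_eq_sub]
  congr 1
  · rw [Finset.sum_comm]
    refine Finset.sum_congr rfl fun a _ => Finset.sum_congr rfl fun b _ => by ring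
  · refine Finset.sum_congr rfl fun a _ => Finset.sum_congr rfl fun b _ => by ring

end Calculus

/-! ### Change of charts, and charts moved by diffeomorphisms. -/

section Flow

set_option linter.unusedSectionVars false

variable {n : ℕ} {M : Type*} [TopologicalSpace M] [ChartedSpace (Model n) M]
  [IsManifold (𝓡 n) ∞ M]

lemma gram_trans (g : Metric n M) {e e' : OpenPartialHomeomorph M (Model n)}
    (he : e ∈ IsManifold.maximalAtlas (𝓡 n) ∞ M) (he' : e' ∈ IsManifold.maximalAtlas (𝓡 n) ∞ M)
    {u : Model n} (hu : u ∈ e.target) (hu' : e.symm u ∈ e'.source) (i j : Fin n) :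
    gram g e u i j = ∑ a, ∑ b, fderiv ℝ (trans e e') u (EuclideanSpace.single i 1) a *
      fderiv ℝ (trans e e') u (EuclideanSpace.single j 1) b * gram g e' (trans e e' u) a b := by
  rw [← inner_mfderiv_symm]
  -- Transport along an equality of base points, where the tangent spaces are all `Model n` by
  -- definition.
  have key : ∀ (p q : M) (_ : q = p) (x y x' y' : Model n), x = x' → y = y' →
      g.inner p (show TangentSpace (𝓡 n) p from x) (show TangentSpace (𝓡 n) p from y) =
      g.inner q (show TangentSpace (𝓡 n) q from x') (show TangentSpace (𝓡 n) q from y') := by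
    rintro p q rfl x y x' y' rfl rfl; rfl
  exact key _ _ (e'.left_inv hu') _ _ _ _ (mfderiv_symm_trans he he' hu hu' _)
    (mfderiv_symm_trans he he' hu hu' _)

lemma comp1_trans (τ : (p : M) → TangentSpace (𝓡 n) p →L[ℝ] ℝ)
    {e e' : OpenPartialHomeomorph M (Model n)}
    (he : e ∈ IsManifold.maximalAtlas (𝓡 n) ∞ M) (he' : e' ∈ IsManifold.maximalAtlas (𝓡 n) ∞ M)
    {u : Model n} (hu : u ∈ e.target) (hu' : e.symm u ∈ e'.source) (i : Fin n) :
    comp1 τ e i u = ∑ a, fderiv ℝ (trans e e') u (EuclideanSpace.single i 1) a *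
      comp1 τ e' a (trans e e' u) := by
  rw [← oneForm_mfderiv_symm]
  have key : ∀ (p q : M) (_ : q = p) (x x' : Model n), x = x' →
      τ p (show TangentSpace (𝓡 n) p from x) = τ q (show TangentSpace (𝓡 n) q from x') := by
    rintro p q rfl x x' rfl; rfl
  exact key _ _ (e'.left_inv hu') _ _ (mfderiv_symm_trans he he' hu hu' _)

/-- The transformation law of the exterior derivative. -/
lemma extd_comp1_trans {τ : (p : M) → TangentSpace (𝓡 n) p →L[ℝ] ℝ}
    {e e' : OpenPartialHomeomorph M (Model n)}
    (hτ : ∀ i, ContDiffOn ℝ ∞ (comp1 τ e' i) e'.target)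
    (he : e ∈ IsManifold.maximalAtlas (𝓡 n) ∞ M) (he' : e' ∈ IsManifold.maximalAtlas (𝓡 n) ∞ M)
    {u : Model n} (hu : u ∈ e.target) (hu' : e.symm u ∈ e'.source) (i j : Fin n) :
    extd (comp1 τ e) u i j = ∑ a, ∑ b,
      fderiv ℝ (trans e e') u (EuclideanSpace.single i 1) a *
      fderiv ℝ (trans e e') u (EuclideanSpace.single j 1) b *
        extd (comp1 τ e') (trans e e' u) a b := by
  refine extd_pullback ((contDiffAt_trans he he' hu hu').of_le ENat.LEInfty.out) (fun a => ?_) ?_ i j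
  · exact ((hτ a).contDiffAt (e'.open_target.mem_nhds (e'.map_source hu'))).differentiableAt
      (by simp)
  · filter_upwards [eventually_trans hu hu'] with x hx i
    exact comp1_trans τ he he' hx.1 hx.2 i

lemma extDerivCoord_eq_extd (τ : OneForm n M) (e : OpenPartialHomeomorph M (Model n))
    (u : Model n) (i j : Fin n) : extDerivCoord τ e u i j = extd (comp1 τ e) u i j := rfl

/-- The chart obtained by moving a chart with a diffeomorphism between open subsets. -/
def movedChart (Φ : PartialDiffeomorph (𝓡 n) (𝓡 n) M M ∞)
    (e : OpenPartialHomeomorph M (Model n)) : OpenPartialHomeomorph M (Model n) :=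
  Φ.toOpenPartialHomeomorph.symm.trans e

lemma movedChart_mem (Φ : PartialDiffeomorph (𝓡 n) (𝓡 n) M M ∞)
    {e : OpenPartialHomeomorph M (Model n)} (he : e ∈ IsManifold.maximalAtlas (𝓡 n) ∞ M) :
    movedChart Φ e ∈ IsManifold.maximalAtlas (𝓡 n) ∞ M := by
  refine OpenPartialHomeomorph.mem_maximalAtlas_of_contMDiffOn _ ?_ ?_
  · exact (contMDiffOn_of_mem_maximalAtlas he).comp (t := e.source)
      (Φ.contMDiffOn_invFun.mono fun x hx => hx.1) fun x hx => hx.2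
  · exact Φ.contMDiffOn_toFun.comp (t := Φ.source)
      ((contMDiffOn_symm_of_mem_maximalAtlas he).mono fun x hx => hx.1) fun x hx => hx.2

/-- The inverse of the moved chart is Φ ∘ e⁻¹ by definition. Thus an almost isometry becomes a
statement about two charts over the same coordinates, the form to which the results on T apply. -/
lemma sameTriangular_movedChart {g : Metric n M} {τ : OneForm n M}
    {Φ : PartialDiffeomorph (𝓡 n) (𝓡 n) M M ∞} (hΦ : IsAlmostIsometry (randers g τ) Φ)
    (e : OpenPartialHomeomorph M (Model n)) :
    SameTriangular g τ e (movedChart Φ e) (movedChart Φ e).target :=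
  fun _ hx _ hy _ hz => hΦ _ hx.2 _ hy.2 _ hz.2

end Flow

/-! ### Almost Killing fields are infinitesimal symmetries of g and dτ. -/

section Flow

set_option linter.unusedSectionVars false

variable {n : ℕ} {M : Type*} [TopologicalSpace M] [ChartedSpace (Model n) M]
  [IsManifold (𝓡 n) ∞ M]

/-- The flow in a chart. -/
def chartFlow (φ : ℝ → M → M) (e : OpenPartialHomeomorph M (Model n)) (z : ℝ × Model n) : Model n :=
  e (φ z.1 (e.symm z.2))

variable {K : (p : M) → TangentSpace (𝓡 n) p} {φ : ℝ → M → M} {ε : ℝ} {U : Set M}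
  {e : OpenPartialHomeomorph M (Model n)}

lemma eventually_mem_flow (h : IsLocalFlow K φ ε U) {u₀ : Model n} (hu₀ : u₀ ∈ e.target)
    (hU : e.symm u₀ ∈ U) : ∀ᶠ z : ℝ × Model n in 𝓝 (0, u₀),
      z.1 ∈ Ioo (-ε) ε ∧ z.2 ∈ e.target ∧ e.symm z.2 ∈ U ∧ φ z.1 (e.symm z.2) ∈ e.source := by
  have h1 : ∀ᶠ z : ℝ × Model n in 𝓝 (0, u₀), z.1 ∈ Ioo (-ε) ε :=
    continuousAt_fst.eventually (Ioo_mem_nhds (by simpa using h.pos) h.pos)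
  have h2 : ∀ᶠ z : ℝ × Model n in 𝓝 (0, u₀), z.2 ∈ e.target :=
    continuousAt_snd.eventually (e.open_target.mem_nhds hu₀)
  have hs : ContinuousAt (fun z : ℝ × Model n => e.symm z.2) (0, u₀) :=
    ContinuousAt.comp (f := Prod.snd) (x := ((0 : ℝ), u₀)) (e.continuousAt_symm hu₀) continuousAt_snd
  have h3 : ∀ᶠ z : ℝ × Model n in 𝓝 (0, u₀), e.symm z.2 ∈ U := hs.eventually (h.isOpen.mem_nhds hU)
  have hφ : ContinuousAt (fun x : ℝ × M => φ x.1 x.2) (0, e.symm u₀) :=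
    h.smooth.continuousOn.continuousAt ((isOpen_Ioo.prod h.isOpen).mem_nhds
      ⟨⟨by simpa using h.pos, h.pos⟩, hU⟩)
  have hc : ContinuousAt (fun z : ℝ × Model n => φ z.1 (e.symm z.2)) (0, u₀) :=
    ContinuousAt.comp (f := fun z : ℝ × Model n => (z.1, e.symm z.2)) (x := ((0 : ℝ), u₀)) hφ
      (continuousAt_fst.prodMk hs)
  have h4 : ∀ᶠ z : ℝ × Model n in 𝓝 (0, u₀), φ z.1 (e.symm z.2) ∈ e.source :=
    hc.eventually (e.open_source.mem_nhds (by
      change φ 0 (e.symm u₀) ∈ e.source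
      rw [h.zero _ hU]; exact e.map_target hu₀))
  filter_upwards [h1, h2, h3, h4] with z a b c d using ⟨a, b, c, d⟩

lemma contDiffAt_chartFlow (he : e ∈ IsManifold.maximalAtlas (𝓡 n) ∞ M) (h : IsLocalFlow K φ ε U)
    {u₀ : Model n} (hu₀ : u₀ ∈ e.target) (hU : e.symm u₀ ∈ U) :
    ContDiffAt ℝ ∞ (chartFlow φ e) (0, u₀) := by
  obtain ⟨z1, z2, z3, z4⟩ := (eventually_mem_flow h hu₀ hU).self_of_nhds
  have h1 : ContMDiffAt (𝓘(ℝ, ℝ).prod (𝓡 n)) (𝓡 n) ∞ (fun x : ℝ × M => φ x.1 x.2)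
      (0, e.symm u₀) := h.smooth.contMDiffAt ((isOpen_Ioo.prod h.isOpen).mem_nhds ⟨z1, hU⟩)
  have h2 : ContMDiffAt (𝓡 n) (𝓡 n) ∞ e.symm u₀ :=
    (contMDiffOn_symm_of_mem_maximalAtlas he).contMDiffAt (e.open_target.mem_nhds hu₀)
  have h3 : ContMDiffAt (𝓡 n) (𝓡 n) ∞ e (φ 0 (e.symm u₀)) :=
    (contMDiffOn_of_mem_maximalAtlas he).contMDiffAt (e.open_source.mem_nhds z4)
  have h4 : ContMDiffAt (𝓘(ℝ, ℝ).prod (𝓡 n)) (𝓘(ℝ, ℝ).prod (𝓡 n)) ∞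
      (fun z : ℝ × Model n => (z.1, e.symm z.2)) (0, u₀) :=
    contMDiffAt_fst.prodMk (ContMDiffAt.comp (I' := 𝓡 n) (f := Prod.snd) ((0 : ℝ), u₀) h2
      contMDiffAt_snd)
  have h5 : ContMDiffAt (𝓘(ℝ, ℝ).prod (𝓡 n)) (𝓡 n) ∞ (chartFlow φ e) (0, u₀) :=
    ContMDiffAt.comp (I' := 𝓡 n) (f := fun z : ℝ × Model n => φ z.1 (e.symm z.2)) (0, u₀) h3
      (ContMDiffAt.comp (I' := 𝓘(ℝ, ℝ).prod (𝓡 n))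
        (f := fun z : ℝ × Model n => (z.1, e.symm z.2)) (0, u₀) h1 h4)
  -- Identifies the product manifold structure on ℝ × ℝⁿ with its structure as a normed space.
  rw [← modelWithCornersSelf_prod, chartedSpaceSelf_prod] at h5
  exact h5.contDiffAt

lemma hasDerivAt_chartFlow (he : e ∈ IsManifold.maximalAtlas (𝓡 n) ∞ M) (h : IsLocalFlow K φ ε U)
    {u : Model n} (hu : u ∈ e.target) (hU : e.symm u ∈ U) :
    HasDerivAt (fun t => chartFlow φ e (t, u)) (vecComp K e u) 0 := by
  have h0 : (0 : ℝ) ∈ Ioo (-ε) ε := ⟨by simpa using h.pos, h.pos⟩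
  have hz := h.zero _ hU
  have h1 := (h.integral _ hU 0 h0).hasMFDerivAt (Ioo_mem_nhds h0.1 h0.2)
  have h2 : HasMFDerivAt (𝓡 n) (𝓡 n) e (φ 0 (e.symm u))
      (mfderiv (𝓡 n) (𝓡 n) e (φ 0 (e.symm u))) :=
    ((mdifferentiable_of_mem he).mdifferentiableAt (by rw [hz]; exact e.map_target hu)).hasMFDerivAt
  have h3 : HasFDerivAt (fun t => e (φ t (e.symm u))) _ (0 : ℝ) :=
    (h2.comp (0 : ℝ) h1).hasFDerivAt
  have h4 : HasDerivAt (fun t => chartFlow φ e (t, u)) _ 0 :=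
    ((ContinuousLinearMap.id ℝ (Model n)).hasFDerivAt.comp (0 : ℝ) h3).hasDerivAt
  refine h4.congr_deriv ?_
  have key : ∀ p q : M, p = q → (mfderiv (𝓡 n) (𝓡 n) e p (K p) : Model n) =
    mfderiv (𝓡 n) (𝓡 n) e q (K q) := by rintro p q rfl; rfl
  refine Eq.trans ?_ (key _ _ hz)
  change mfderiv (𝓡 n) (𝓡 n) e (φ 0 (e.symm u)) ((1 : ℝ) • K (φ 0 (e.symm u))) = _
  rw [one_smul]

variable [T2Space M]

/-- The flow of an almost Killing field preserves the metric and the exterior derivative of the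
1-form. -/
lemma lieDeriv_of_isAlmostKilling {g : Metric n M} {τ : OneForm n M} (hτ : NormLTOne g τ)
    {K : VectorField n M} (hK : IsAlmostKilling (randers g τ) (fun p => K p))
    (he : e ∈ IsManifold.maximalAtlas (𝓡 n) ∞ M) {u₀ : Model n} (hu₀ : u₀ ∈ e.target)
    (i j : Fin n) :
    (∑ c, vecComp K e u₀ c * pd c (fun u => gram g e u i j) u₀ +
      ∑ a, pd i (fun u => vecComp K e u a) u₀ * gram g e u₀ a j +
      ∑ b, pd j (fun u => vecComp K e u b) u₀ * gram g e u₀ i b = 0) ∧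
    (∑ c, vecComp K e u₀ c * pd c (fun u => extd (comp1 τ e) u i j) u₀ +
      ∑ a, pd i (fun u => vecComp K e u a) u₀ * extd (comp1 τ e) u₀ a j +
      ∑ b, pd j (fun u => vecComp K e u b) u₀ * extd (comp1 τ e) u₀ i b = 0) := by
  obtain ⟨φ, ε, U, hU, h, hiso⟩ := hK (e.symm u₀)
  have hev := eventually_mem_flow h hu₀ hU
  have ht : Filter.Tendsto (fun t : ℝ => (t, u₀)) (𝓝 0) (𝓝 (0, u₀)) := by
    have : Continuous (fun t : ℝ => (t, u₀)) := by fun_prop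
    exact this.tendsto 0
  have hu : Filter.Tendsto (fun u : Model n => ((0 : ℝ), u)) (𝓝 u₀) (𝓝 (0, u₀)) := by
    have : Continuous (fun u : Model n => ((0 : ℝ), u)) := by fun_prop
    exact this.tendsto u₀
  have hψ : ContDiffAt ℝ 2 (chartFlow φ e) (0, u₀) :=
    (contDiffAt_chartFlow he h hu₀ hU).of_le ENat.LEInfty.out
  have hk : ∀ᶠ u in 𝓝 u₀, HasDerivAt (fun t => chartFlow φ e (t, u)) (vecComp K e u) 0 := by
    filter_upwards [hu.eventually hev] with u hu using hasDerivAt_chartFlow he h hu.2.1 hu.2.2.1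
  have h0 : ∀ᶠ u in 𝓝 u₀, chartFlow φ e (0, u) = u := by
    filter_upwards [hu.eventually hev] with u hu
    simp only [chartFlow]
    rw [h.zero _ hu.2.2.1, e.right_inv hu.2.1]
  have hnhds := e.open_target.mem_nhds hu₀
  have hk0 : DifferentiableAt ℝ (vecComp K e) u₀ :=
    ((contDiffOn_vecComp K he).contDiffAt hnhds).differentiableAt (by simp)
  -- The transition map from the chart moved by the time t flow back to `e` is the flow in
  -- coordinates. Equality of components in the two charts, combined with the transformation law,
  -- then becomes invariance under pullback by the flow.
  have hmove : ∀ᶠ t in 𝓝 (0 : ℝ), ∃ Φ : PartialDiffeomorph (𝓡 n) (𝓡 n) M M ∞,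
      IsAlmostIsometry (randers g τ) Φ ∧ u₀ ∈ (movedChart Φ e).target ∧
      (movedChart Φ e).symm u₀ ∈ e.source ∧
      (fun u => chartFlow φ e (t, u)) =ᶠ[𝓝 u₀] trans (movedChart Φ e) e := by
    filter_upwards [ht.eventually hev] with t htz
    obtain ⟨Φ, hΦU, hΦ, hΦi⟩ := hiso t htz.1
    have hmem : ∀ u, u ∈ (movedChart Φ e).target ↔ u ∈ e.target ∧ e.symm u ∈ U := by
      intro u; rw [← hΦU]; rfl
    have hsymm : ∀ u ∈ (movedChart Φ e).target, (movedChart Φ e).symm u = φ t (e.symm u) :=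
      fun u hu => hΦ ((hmem u).1 hu).2
    have hu₀' := (hmem u₀).2 ⟨hu₀, hU⟩
    refine ⟨Φ, hΦi, hu₀', ?_, ?_⟩
    · rw [hsymm _ hu₀']; exact htz.2.2.2
    · filter_upwards [(movedChart Φ e).open_target.mem_nhds hu₀'] with u hu
      simp only [trans, chartFlow, hsymm u hu]
  constructor
  · refine lieDeriv_eq_zero hψ hk0 hk h0 (h := fun i j u => gram g e u i j)
      (fun i j => ((contDiffOn_gram g he i j).contDiffAt hnhds).differentiableAt (by simp)) ?_
    filter_upwards [hmove] with t ⟨Φ, hΦ, hu', hs, heq⟩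
    have he' := movedChart_mem Φ he
    have h1 := gram_eq_of_chartSq_eq fun v => chartSq_eq_of_sameTriangular hτ he he'
      (movedChart Φ e).open_target (fun u hu => hu.1) subset_rfl
      (sameTriangular_movedChart hΦ e) hu' v
    rw [h1, gram_trans g he' he hu' hs, heq.fderiv_eq]
    have : chartFlow φ e (t, u₀) = trans (movedChart Φ e) e u₀ := heq.self_of_nhds
    rw [this]
  · have hT := fun a => (contDiffOn_comp1 τ he a)
    refine lieDeriv_eq_zero hψ hk0 hk h0 (h := fun i j u => extd (comp1 τ e) u i j) ?_ ?_
    · intro i j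
      have hp : ∀ i j, DifferentiableAt ℝ (pd i (comp1 τ e j)) u₀ := fun i j =>
        (((((hT j).contDiffAt hnhds).fderiv_right (m := 1)
          (by rw [one_add_one_eq_two]; exact ENat.LEInfty.out)).differentiableAt
          (by simp)).clm_apply (differentiableAt_const _))
      exact (hp i j).sub (hp j i)
    · filter_upwards [hmove] with t ⟨Φ, hΦ, hu', hs, heq⟩
      have he' := movedChart_mem Φ he
      have h1 := extDerivCoord_eq_of_sameTriangular hτ he he'
        (movedChart Φ e).open_target (fun u hu => hu.1) subset_rfl
        (sameTriangular_movedChart hΦ e) hu' i j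
      rw [extDerivCoord_eq_extd, extDerivCoord_eq_extd] at h1
      rw [← h1, extd_comp1_trans hT he' he hu' hs, heq.fderiv_eq]
      have : chartFlow φ e (t, u₀) = trans (movedChart Φ e) e u₀ := heq.self_of_nhds
      rw [this]

end Flow

/-! ### Rules for partial derivatives. -/

section PartialDerivatives

variable {n : ℕ} {f g : Model n → ℝ} {u : Model n} {i j : Fin n}

lemma pd_add (hf : DifferentiableAt ℝ f u) (hg : DifferentiableAt ℝ g u) :
    pd i (fun x => f x + g x) u = pd i f u + pd i g u := by
  rw [pd, fderiv_fun_add hf hg]; rfl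

lemma pd_sub (hf : DifferentiableAt ℝ f u) (hg : DifferentiableAt ℝ g u) :
    pd i (fun x => f x - g x) u = pd i f u - pd i g u := by
  rw [pd, fderiv_fun_sub hf hg]; rfl

lemma pd_neg : pd i (fun x => - f x) u = - pd i f u := by
  rw [pd, fderiv_fun_neg]; rfl

lemma pd_mul (hf : DifferentiableAt ℝ f u) (hg : DifferentiableAt ℝ g u) :
    pd i (fun x => f x * g x) u = pd i f u * g u + f u * pd i g u := by
  rw [pd, fderiv_fun_mul hf hg]
  simp [pd]; ring

lemma pd_congr (h : f =ᶠ[𝓝 u] g) : pd i f u = pd i g u := by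
  rw [pd, pd, h.fderiv_eq]

lemma pd_comm (hf : ContDiffAt ℝ 2 f u) : pd i (pd j f) u = pd j (pd i f) u := by
  have hD : DifferentiableAt ℝ (fderiv ℝ f) u :=
    (hf.fderiv_right (m := 1) (by norm_num)).differentiableAt (by simp)
  have key : ∀ i j : Fin n, pd i (pd j f) u =
      fderiv ℝ (fderiv ℝ f) u (EuclideanSpace.single i 1) (EuclideanSpace.single j 1) := by
    intro i j
    have h : HasFDerivAt (pd j f) _ u := hD.hasFDerivAt.clm_apply
      (hasFDerivAt_const (EuclideanSpace.single j (1 : ℝ) : Model n) u)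
    rw [pd, h.fderiv]; simp
  rw [key, key]
  exact hf.isSymmSndFDerivAt (by simp) _ _

lemma fderiv_eq_sum_pd (v : Model n) : fderiv ℝ f u v = ∑ i, v i * pd i f u := by
  conv_lhs => rw [model_eq_sum v]
  rw [map_sum]
  simp only [map_smul, smul_eq_mul, pd]

lemma _root_.ContDiffOn.pd {O : Set (Model n)} (hO : IsOpen O) (hf : ContDiffOn ℝ ∞ f O) :
    ContDiffOn ℝ ∞ (Randers.pd i f) O :=
  (hf.fderiv_of_isOpen hO (m := ∞) (by simp)).clm_apply contDiffOn_const

end PartialDerivatives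

/-! ### Levi-Civita connection, curvature and Killing fields on a plane domain. -/

section LocalGeometry

/-- The Christoffel symbols of a matrix valued function. -/
def chr {n : ℕ} (G : Model n → Matrix (Fin n) (Fin n) ℝ) (k i j : Fin n) (u : Model n) : ℝ :=
  (1 / 2) * ∑ l, (G u)⁻¹ k l *
    (pd i (fun x => G x j l) u + pd j (fun x => G x i l) u - pd l (fun x => G x i j) u)

/-- The curvature tensor of a matrix valued function. -/
def riem {n : ℕ} (G : Model n → Matrix (Fin n) (Fin n) ℝ) (l k i j : Fin n) (u : Model n) : ℝ :=
  pd i (chr G l j k) u - pd j (chr G l i k) u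
    + ∑ m, (chr G l i m u * chr G m j k u - chr G l j m u * chr G m i k u)

/-- The Gauss curvature of a matrix valued function on the plane. -/
def gaussCurv (G : Model 2 → Matrix (Fin 2) (Fin 2) ℝ) (u : Model 2) : ℝ :=
  (G u 0 0 * riem G 0 1 0 1 u + G u 0 1 * riem G 1 1 0 1 u) / (G u).det

/-- A smooth metric on an open set of the plane. -/
structure LocalMetric (G : Model 2 → Matrix (Fin 2) (Fin 2) ℝ) (O : Set (Model 2)) : Prop where
  isOpen : IsOpen O
  smooth : ∀ i j, ContDiffOn ℝ ∞ (fun u => G u i j) O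
  symm : ∀ u i j, G u i j = G u j i
  det_pos : ∀ u ∈ O, 0 < (G u).det

/-- A smooth Killing vector field on an open set of the plane. -/
structure LocalKilling (G : Model 2 → Matrix (Fin 2) (Fin 2) ℝ) (K : Model 2 → Model 2)
    (O : Set (Model 2)) : Prop where
  smooth : ContDiffOn ℝ ∞ K O
  eq : ∀ u ∈ O, ∀ i j, ∑ c, K u c * pd c (fun x => G x i j) u +
    ∑ a, pd i (fun x => K x a) u * G u a j + ∑ b, pd j (fun x => K x b) u * G u i b = 0

variable {G : Model 2 → Matrix (Fin 2) (Fin 2) ℝ} {O : Set (Model 2)}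

namespace LocalMetric

lemma det_eq (h : LocalMetric G O) (u : Model 2) :
    (G u).det = G u 0 0 * G u 1 1 - G u 0 1 * G u 0 1 := by
  rw [Matrix.det_fin_two, h.symm u 1 0]

lemma contDiffOn_det (h : LocalMetric G O) : ContDiffOn ℝ ∞ (fun u => (G u).det) O := by
  simp only [h.det_eq]
  exact ((h.smooth 0 0).mul (h.smooth 1 1)).sub ((h.smooth 0 1).mul (h.smooth 0 1))

lemma contDiffOn_inv (h : LocalMetric G O) (i j : Fin 2) :
    ContDiffOn ℝ ∞ (fun u => (G u)⁻¹ i j) O := by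
  have key : ∀ u, (G u)⁻¹ i j = ((G u).det)⁻¹ * (G u).adjugate i j := by
    intro u; rw [Matrix.inv_def, Ring.inverse_eq_inv', Matrix.smul_apply, smul_eq_mul]
  simp only [key]
  refine (h.contDiffOn_det.inv fun u hu => (h.det_pos u hu).ne').mul ?_
  simp only [Matrix.adjugate_fin_two]
  fin_cases i <;> fin_cases j <;> simp
  · exact h.smooth 1 1
  · exact (h.smooth 0 1).neg
  · exact (h.smooth 1 0).neg
  · exact h.smooth 0 0

lemma contDiffOn_chr (h : LocalMetric G O) (k i j : Fin 2) : ContDiffOn ℝ ∞ (chr G k i j) O := by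
  unfold chr
  refine contDiffOn_const.mul (ContDiffOn.sum fun l _ => (h.contDiffOn_inv k l).mul ?_)
  exact (((h.smooth j l).pd h.isOpen).add ((h.smooth i l).pd h.isOpen)).sub
    ((h.smooth i j).pd h.isOpen)

lemma contDiffOn_riem (h : LocalMetric G O) (l k i j : Fin 2) :
    ContDiffOn ℝ ∞ (riem G l k i j) O := by
  unfold riem
  refine (((h.contDiffOn_chr _ _ _).pd h.isOpen).sub ((h.contDiffOn_chr _ _ _).pd h.isOpen)).add
    (ContDiffOn.sum fun m _ => ?_)
  exact ((h.contDiffOn_chr _ _ _).mul (h.contDiffOn_chr _ _ _)).sub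
    ((h.contDiffOn_chr _ _ _).mul (h.contDiffOn_chr _ _ _))

lemma contDiffOn_gaussCurv (h : LocalMetric G O) : ContDiffOn ℝ ∞ (gaussCurv G) O := by
  unfold gaussCurv
  exact (((h.smooth 0 0).mul (h.contDiffOn_riem _ _ _ _)).add
    ((h.smooth 0 1).mul (h.contDiffOn_riem _ _ _ _))).div h.contDiffOn_det
      fun u hu => (h.det_pos u hu).ne'

lemma differentiableAt_of (h : LocalMetric G O) {f : Model 2 → ℝ} (hf : ContDiffOn ℝ ∞ f O)
    {u : Model 2} (hu : u ∈ O) : DifferentiableAt ℝ f u :=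
  (hf.contDiffAt (h.isOpen.mem_nhds hu)).differentiableAt (by simp)

lemma pd_pd_comm (h : LocalMetric G O) {f : Model 2 → ℝ} (hf : ContDiffOn ℝ ∞ f O)
    {u : Model 2} (hu : u ∈ O) (i j : Fin 2) : pd i (pd j f) u = pd j (pd i f) u :=
  pd_comm ((hf.contDiffAt (h.isOpen.mem_nhds hu)).of_le ENat.LEInfty.out)

lemma pd_congr_on (h : LocalMetric G O) {f f' : Model 2 → ℝ} (hf : ∀ u ∈ O, f u = f' u)
    {u : Model 2} (hu : u ∈ O) (i : Fin 2) : pd i f u = pd i f' u :=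
  pd_congr (Filter.eventually_of_mem (h.isOpen.mem_nhds hu) hf)

lemma chr_symm (h : LocalMetric G O) (k i j : Fin 2) (u : Model 2) :
    chr G k i j u = chr G k j i u := by
  unfold chr
  congr 1
  refine Finset.sum_congr rfl fun l _ => ?_
  rw [show (fun x => G x i j) = fun x => G x j i from funext fun x => h.symm x i j]
  ring

lemma chr_symm' (h : LocalMetric G O) (k : Fin 2) (u : Model 2) :
    chr G k 1 0 u = chr G k 0 1 u := h.chr_symm k 1 0 u

lemma gram_mul_chr (h : LocalMetric G O) {u : Model 2} (hu : u ∈ O) (m i j : Fin 2) :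
    ∑ k, G u m k * chr G k i j u = (1 / 2) * (pd i (fun x => G x j m) u + pd j (fun x => G x i m) u
      - pd m (fun x => G x i j) u) := by
  have hinv : G u * (G u)⁻¹ = 1 := Matrix.mul_nonsing_inv _ (h.det_pos u hu).ne'.isUnit
  have h1 : ∀ l, ∑ k, G u m k * (G u)⁻¹ k l = if m = l then 1 else 0 := by
    intro l
    rw [← Matrix.mul_apply, hinv, Matrix.one_apply]
  simp only [chr, Finset.mul_sum]
  rw [Finset.sum_comm]
  have h2 : ∀ l, ∑ k, G u m k * (1 / 2 * ((G u)⁻¹ k l * (pd i (fun x => G x j l) u +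
      pd j (fun x => G x i l) u - pd l (fun x => G x i j) u))) =
      (if m = l then 1 else 0) * (1 / 2 * (pd i (fun x => G x j l) u +
      pd j (fun x => G x i l) u - pd l (fun x => G x i j) u)) := by
    intro l
    rw [← h1 l, Finset.sum_mul]
    exact Finset.sum_congr rfl fun k _ => by ring
  simp only [h2]
  simp

/-- The Christoffel symbols define a metric connection. -/
lemma pd_gram (h : LocalMetric G O) {u : Model 2} (hu : u ∈ O) (i j k : Fin 2) :
    pd i (fun x => G x j k) u =
      ∑ l, (chr G l i j u * G u l k + chr G l i k u * G u j l) := by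
  have h1 := h.gram_mul_chr hu k i j
  have h2 := h.gram_mul_chr hu j i k
  rw [Finset.sum_add_distrib]
  have e1 : ∑ l, chr G l i j u * G u l k = ∑ l, G u k l * chr G l i j u :=
    Finset.sum_congr rfl fun l _ => by rw [h.symm u l k, mul_comm]
  have e2 : ∑ l, chr G l i k u * G u j l = ∑ l, G u j l * chr G l i k u :=
    Finset.sum_congr rfl fun l _ => by rw [mul_comm]
  rw [e1, e2, h1, h2, show (fun x => G x k j) = fun x => G x j k from funext fun x => h.symm x k j]
  ring

/-- The trace of metric compatibility: the logarithmic derivative of √det G is the contracted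
Christoffel symbol. -/
lemma pd_det (h : LocalMetric G O) {u : Model 2} (hu : u ∈ O) (i : Fin 2) :
    pd i (fun x => (G x).det) u = 2 * (G u).det * (chr G 0 i 0 u + chr G 1 i 1 u) := by
  have d := fun i j => h.differentiableAt_of (h.smooth i j) hu
  simp only [h.det_eq]
  rw [pd_sub ((d 0 0).fun_mul (d 1 1)) ((d 0 1).fun_mul (d 0 1)), pd_mul (d 0 0) (d 1 1),
    pd_mul (d 0 1) (d 0 1), h.pd_gram hu, h.pd_gram hu, h.pd_gram hu]
  simp only [Fin.sum_univ_two, h.symm u 1 0]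
  ring

/-- The curvature tensor of a surface is determined by the Gauss curvature. -/
lemma riem_eq (h : LocalMetric G O) {u : Model 2} (hu : u ∈ O) :
    riem G 0 0 0 1 u = gaussCurv G u * G u 0 1 ∧ riem G 0 1 0 1 u = gaussCurv G u * G u 1 1 ∧
    riem G 1 0 0 1 u = - (gaussCurv G u * G u 0 0) ∧
    riem G 1 1 0 1 u = - (gaussCurv G u * G u 0 1) := by
  have d := fun i j => h.differentiableAt_of (h.smooth i j) hu
  have dc := fun k i j => h.differentiableAt_of (h.contDiffOn_chr k i j) hu
  -- the lowered curvature tensor is antisymmetric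
  have key : ∀ j k : Fin 2, (j = 0 ∧ k = 0) ∨ (j = 0 ∧ k = 1) ∨ (j = 1 ∧ k = 1) →
      ∑ l, (riem G l j 0 1 u * G u l k + riem G l k 0 1 u * G u j l) = 0 := by
    intro j k _
    have hc := h.pd_pd_comm (h.smooth j k) hu 0 1
    -- Metric compatibility is differentiated once more; commuting ∂₀ and ∂₁ on G leaves the
    -- curvature terms.
    have e : ∀ a b : Fin 2, pd a (pd b fun x => G x j k) u =
        ∑ l, (pd a (chr G l b j) u * G u l k + chr G l b j u * pd a (fun x => G x l k) u +
          (pd a (chr G l b k) u * G u j l + chr G l b k u * pd a (fun x => G x j l) u)) := by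
      intro a b
      rw [h.pd_congr_on (fun x hx => h.pd_gram hx b j k) hu a]
      simp only [Fin.sum_univ_two]
      rw [pd_add, pd_add, pd_add, pd_mul (dc _ _ _) (d _ _), pd_mul (dc _ _ _) (d _ _),
        pd_mul (dc _ _ _) (d _ _), pd_mul (dc _ _ _) (d _ _)]
      all_goals first
        | exact (dc _ _ _).mul (d _ _)
        | exact ((dc _ _ _).mul (d _ _)).add ((dc _ _ _).mul (d _ _))
    rw [e, e] at hc
    simp only [Fin.sum_univ_two, h.pd_gram hu] at hc
    simp only [Fin.sum_univ_two, riem]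
    linear_combination hc
  have k00 := key 0 0 (by simp)
  have k01 := key 0 1 (by simp)
  have k11 := key 1 1 (by simp)
  simp only [Fin.sum_univ_two, h.symm u 1 0] at k00 k01 k11
  have hD := (h.det_pos u hu).ne'
  have hk : gaussCurv G u * (G u).det = G u 0 0 * riem G 0 1 0 1 u + G u 0 1 * riem G 1 1 0 1 u := by
    rw [gaussCurv, div_mul_cancel₀ _ hD]
  have hDe := h.det_eq u
  rw [hDe] at hk hD
  -- The antisymmetry relations and the definition of κ are four linear equations for the four
  -- components, solved after multiplication by the determinant.
  refine ⟨mul_left_cancel₀ hD ?_, mul_left_cancel₀ hD ?_, mul_left_cancel₀ hD ?_,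
    mul_left_cancel₀ hD ?_⟩
  · linear_combination G u 1 1 / 2 * k00 - G u 0 1 * k01 - G u 0 1 * hk
  · linear_combination - G u 0 1 / 2 * k11 - G u 1 1 * hk
  · linear_combination G u 0 0 * k01 - G u 0 1 / 2 * k00 + G u 0 0 * hk
  · linear_combination G u 0 0 / 2 * k11 + G u 0 1 * hk

end LocalMetric

/-- The rotation of a vector field: the covariant derivative of a Killing field is this function
times `√(det G)` times the complex structure. -/
def rotn (G : Model 2 → Matrix (Fin 2) (Fin 2) ℝ) (K : Model 2 → Model 2) (u : Model 2) : ℝ :=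
  (∑ k, G u 1 k * (pd 0 (fun x => K x k) u + ∑ l, chr G k 0 l u * K u l)) / (G u).det

variable {K : Model 2 → Model 2}

namespace LocalKilling

lemma contDiffOn_comp (hK : LocalKilling G K O) (k : Fin 2) :
    ContDiffOn ℝ ∞ (fun x => K x k) O :=
  (coordProj k).contDiff.comp_contDiffOn hK.smooth

lemma contDiffOn_rotn (h : LocalMetric G O) (hK : LocalKilling G K O) :
    ContDiffOn ℝ ∞ (rotn G K) O := by
  unfold rotn
  refine (ContDiffOn.sum fun k _ => (h.smooth 1 k).mul ?_).div h.contDiffOn_det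
    fun u hu => (h.det_pos u hu).ne'
  exact ((hK.contDiffOn_comp k).pd h.isOpen).add
    (ContDiffOn.sum fun l _ => (h.contDiffOn_chr _ _ _).mul (hK.contDiffOn_comp l))

/-- The first order system for a Killing field: the first derivatives. -/
lemma pd_eq (h : LocalMetric G O) (hK : LocalKilling G K O) {u : Model 2} (hu : u ∈ O) :
    pd 0 (fun x => K x 0) u =
      -(chr G 0 0 0 u * K u 0 + chr G 0 0 1 u * K u 1) - rotn G K u * G u 0 1 ∧
    pd 0 (fun x => K x 1) u =
      -(chr G 1 0 0 u * K u 0 + chr G 1 0 1 u * K u 1) + rotn G K u * G u 0 0 ∧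
    pd 1 (fun x => K x 0) u =
      -(chr G 0 0 1 u * K u 0 + chr G 0 1 1 u * K u 1) - rotn G K u * G u 1 1 ∧
    pd 1 (fun x => K x 1) u =
      -(chr G 1 0 1 u * K u 0 + chr G 1 1 1 u * K u 1) + rotn G K u * G u 0 1 := by
  have k00 := hK.eq u hu 0 0
  have k01 := hK.eq u hu 0 1
  have k11 := hK.eq u hu 1 1
  have hD := (h.det_pos u hu).ne'
  have hb : rotn G K u * (G u).det =
      ∑ k, G u 1 k * (pd 0 (fun x => K x k) u + ∑ l, chr G k 0 l u * K u l) := by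
    rw [rotn, div_mul_cancel₀ _ hD]
  rw [h.det_eq u] at hD hb
  simp only [Fin.sum_univ_two, h.pd_gram hu, h.symm u 1 0, h.chr_symm'] at k00 k01 k11 hb
  -- Three Killing equations for the symmetric part of the lowered ∇K and the definition of `rotn`
  -- for its antisymmetric part determine the four derivatives.
  refine ⟨mul_left_cancel₀ hD ?_, mul_left_cancel₀ hD ?_, mul_left_cancel₀ hD ?_,
    mul_left_cancel₀ hD ?_⟩
  · linear_combination G u 1 1 / 2 * k00 + G u 0 1 * hb
  · linear_combination - G u 0 1 / 2 * k00 - G u 0 0 * hb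
  · linear_combination G u 1 1 * k01 - G u 0 1 / 2 * k11 + G u 1 1 * hb
  · linear_combination G u 0 0 / 2 * k11 - G u 0 1 * k01 - G u 0 1 * hb

/-- The first order system for a Killing field: the rotation. -/
lemma pd_rotn (h : LocalMetric G O) (hK : LocalKilling G K O) {u : Model 2} (hu : u ∈ O) :
    pd 0 (rotn G K) u = -((chr G 0 0 0 u + chr G 1 0 1 u) * rotn G K u) - gaussCurv G u * K u 1 ∧
    pd 1 (rotn G K) u = -((chr G 0 0 1 u + chr G 1 1 1 u) * rotn G K u) + gaussCurv G u * K u 0 := by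
  have d := fun i j => h.differentiableAt_of (h.smooth i j) hu
  have dc := fun k i j => h.differentiableAt_of (h.contDiffOn_chr k i j) hu
  have dK := fun k => h.differentiableAt_of (hK.contDiffOn_comp k) hu
  have db := h.differentiableAt_of (hK.contDiffOn_rotn h) hu
  have e : ∀ (a : Fin 2) (c c' m : Model 2 → ℝ) (_ : DifferentiableAt ℝ c u)
      (_ : DifferentiableAt ℝ c' u) (_ : DifferentiableAt ℝ m u),
      (pd a (fun x => -(c x * K x 0 + c' x * K x 1) - rotn G K x * m x) u =
        -(pd a c u * K u 0 + c u * pd a (fun x => K x 0) u +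
          (pd a c' u * K u 1 + c' u * pd a (fun x => K x 1) u)) -
          (pd a (rotn G K) u * m u + rotn G K u * pd a m u)) ∧
      (pd a (fun x => -(c x * K x 0 + c' x * K x 1) + rotn G K x * m x) u =
        -(pd a c u * K u 0 + c u * pd a (fun x => K x 0) u +
          (pd a c' u * K u 1 + c' u * pd a (fun x => K x 1) u)) +
          (pd a (rotn G K) u * m u + rotn G K u * pd a m u)) := by
    intro a c c' m hc hc' hm
    have h1 := hc.fun_mul (dK 0)
    have h2 := hc'.fun_mul (dK 1)
    have h3 := db.fun_mul hm
    constructor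
    · rw [pd_sub (h1.fun_add h2).fun_neg h3, pd_neg, pd_add h1 h2, pd_mul hc (dK 0),
        pd_mul hc' (dK 1), pd_mul db hm]
    · rw [pd_add (h1.fun_add h2).fun_neg h3, pd_neg, pd_add h1 h2, pd_mul hc (dK 0),
        pd_mul hc' (dK 1), pd_mul db hm]
  -- The integrability conditions ∂₀∂₁Kᵏ = ∂₁∂₀Kᵏ for the first order system are two linear
  -- equations for the gradient of `rotn`; their curvature terms reduce to κ.
  have i0 := h.pd_pd_comm (hK.contDiffOn_comp 0) hu 0 1
  have i1 := h.pd_pd_comm (hK.contDiffOn_comp 1) hu 0 1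
  rw [h.pd_congr_on (fun x hx => (hK.pd_eq h hx).2.2.1) hu 0,
    h.pd_congr_on (fun x hx => (hK.pd_eq h hx).1) hu 1,
    (e 0 _ _ _ (dc _ _ _) (dc _ _ _) (d _ _)).1, (e 1 _ _ _ (dc _ _ _) (dc _ _ _) (d _ _)).1] at i0
  rw [h.pd_congr_on (fun x hx => (hK.pd_eq h hx).2.2.2) hu 0,
    h.pd_congr_on (fun x hx => (hK.pd_eq h hx).2.1) hu 1,
    (e 0 _ _ _ (dc _ _ _) (dc _ _ _) (d _ _)).2, (e 1 _ _ _ (dc _ _ _) (dc _ _ _) (d _ _)).2] at i1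
  obtain ⟨p00, p01, p10, p11⟩ := hK.pd_eq h hu
  obtain ⟨r1, r2, r3, r4⟩ := h.riem_eq hu
  have hD := (h.det_pos u hu).ne'
  rw [h.det_eq u] at hD
  have hs : ∀ k, pd 0 (chr G k 1 0) u = pd 0 (chr G k 0 1) u := fun k => by
    rw [show chr G k 1 0 = chr G k 0 1 from funext fun x => h.chr_symm k 1 0 x]
  simp only [riem, Fin.sum_univ_two, h.chr_symm', hs] at r1 r2 r3 r4
  simp only [p00, p01, p10, p11, h.pd_gram hu, Fin.sum_univ_two, h.chr_symm', h.symm u 1 0] at i0 i1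
  have f0 : G u 1 1 * pd 0 (rotn G K) u - G u 0 1 * pd 1 (rotn G K) u =
      - (G u 1 1 * (chr G 0 0 0 u + chr G 1 0 1 u) - G u 0 1 * (chr G 0 0 1 u + chr G 1 1 1 u)) *
        rotn G K u - gaussCurv G u * (G u 0 1 * K u 0 + G u 1 1 * K u 1) := by
    linear_combination - i0 - K u 0 * r1 - K u 1 * r2
  have f1 : G u 0 1 * pd 0 (rotn G K) u - G u 0 0 * pd 1 (rotn G K) u =
      - (G u 0 1 * (chr G 0 0 0 u + chr G 1 0 1 u) - G u 0 0 * (chr G 0 0 1 u + chr G 1 1 1 u)) *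
        rotn G K u - gaussCurv G u * (G u 0 0 * K u 0 + G u 0 1 * K u 1) := by
    linear_combination i1 + K u 0 * r3 + K u 1 * r4
  constructor
  · apply mul_left_cancel₀ hD
    linear_combination G u 0 0 * f0 - G u 0 1 * f1
  · apply mul_left_cancel₀ hD
    linear_combination G u 0 1 * f0 - G u 1 1 * f1

/-- A Killing field preserves the Gauss curvature. -/
lemma gaussCurv_invariant (h : LocalMetric G O) (hK : LocalKilling G K O) {u : Model 2}
    (hu : u ∈ O) :
    K u 0 * pd 0 (gaussCurv G) u + K u 1 * pd 1 (gaussCurv G) u = 0 := by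
  have dc := fun k i j => h.differentiableAt_of (h.contDiffOn_chr k i j) hu
  have dK := fun k => h.differentiableAt_of (hK.contDiffOn_comp k) hu
  have db := h.differentiableAt_of (hK.contDiffOn_rotn h) hu
  have dg := h.differentiableAt_of h.contDiffOn_gaussCurv hu
  -- The integrability condition for `rotn` itself: after substitution of the system only the
  -- derivative of κ along K remains.
  have i := h.pd_pd_comm (hK.contDiffOn_rotn h) hu 0 1
  rw [h.pd_congr_on (fun x hx => (hK.pd_rotn h hx).2) hu 0,
    h.pd_congr_on (fun x hx => (hK.pd_rotn h hx).1) hu 1,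
    pd_add (((dc _ _ _).fun_add (dc _ _ _)).fun_mul db).fun_neg (dg.fun_mul (dK 0)), pd_neg,
    pd_mul ((dc _ _ _).fun_add (dc _ _ _)) db, pd_add (dc _ _ _) (dc _ _ _), pd_mul dg (dK 0),
    pd_sub (((dc _ _ _).fun_add (dc _ _ _)).fun_mul db).fun_neg (dg.fun_mul (dK 1)), pd_neg,
    pd_mul ((dc _ _ _).fun_add (dc _ _ _)) db, pd_add (dc _ _ _) (dc _ _ _), pd_mul dg (dK 1)] at i
  obtain ⟨p00, p01, p10, p11⟩ := hK.pd_eq h hu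
  obtain ⟨q0, q1⟩ := hK.pd_rotn h hu
  obtain ⟨r1, r2, r3, r4⟩ := h.riem_eq hu
  have hs : ∀ k, pd 0 (chr G k 1 0) u = pd 0 (chr G k 0 1) u := fun k => by
    rw [show chr G k 1 0 = chr G k 0 1 from funext fun x => h.chr_symm k 1 0 x]
  simp only [riem, Fin.sum_univ_two, h.chr_symm', hs] at r1 r4
  rw [p00, p11, q0, q1] at i
  linear_combination i + rotn G K u * (r1 + r4)

/-- The squared norm of a vector field. -/
def _root_.Randers.sqn (G : Model 2 → Matrix (Fin 2) (Fin 2) ℝ) (K : Model 2 → Model 2)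
    (u : Model 2) : ℝ :=
  G u 0 0 * (K u 0 * K u 0) + 2 * (G u 0 1 * (K u 0 * K u 1)) + G u 1 1 * (K u 1 * K u 1)

lemma contDiffOn_sqn (h : LocalMetric G O) (hK : LocalKilling G K O) :
    ContDiffOn ℝ ∞ (sqn G K) O := by
  have a := h.smooth
  have b := hK.contDiffOn_comp
  exact (((a 0 0).mul ((b 0).mul (b 0))).add (contDiffOn_const.mul
    ((a 0 1).mul ((b 0).mul (b 1))))).add ((a 1 1).mul ((b 1).mul (b 1)))

/-- d|K|² = 2g(∇K, K), where ∇K is a multiple of a quarter turn. -/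
lemma pd_sqn (h : LocalMetric G O) (hK : LocalKilling G K O) {u : Model 2} (hu : u ∈ O) :
    pd 0 (sqn G K) u = 2 * (rotn G K u * (G u).det * K u 1) ∧
    pd 1 (sqn G K) u = - (2 * (rotn G K u * (G u).det * K u 0)) := by
  have d := fun i j => h.differentiableAt_of (h.smooth i j) hu
  have dK := fun k => h.differentiableAt_of (hK.contDiffOn_comp k) hu
  have e : ∀ a : Fin 2, pd a (sqn G K) u =
      pd a (fun x => G x 0 0) u * (K u 0 * K u 0) + G u 0 0 * (pd a (fun x => K x 0) u * K u 0 +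
        K u 0 * pd a (fun x => K x 0) u) + 2 * (pd a (fun x => G x 0 1) u * (K u 0 * K u 1) +
      G u 0 1 * (pd a (fun x => K x 0) u * K u 1 + K u 0 * pd a (fun x => K x 1) u)) +
      (pd a (fun x => G x 1 1) u * (K u 1 * K u 1) + G u 1 1 * (pd a (fun x => K x 1) u * K u 1 +
        K u 1 * pd a (fun x => K x 1) u)) := by
    intro a
    have m := fun i j => (dK i).fun_mul (dK j)
    have c : DifferentiableAt ℝ (fun _ : Model 2 => (2 : ℝ)) u := differentiableAt_const _
    have hc : pd a (fun _ : Model 2 => (2 : ℝ)) u = 0 := by simp [pd]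
    unfold sqn
    rw [pd_add (((d 0 0).fun_mul (m 0 0)).fun_add (c.fun_mul ((d 0 1).fun_mul (m 0 1))))
      ((d 1 1).fun_mul (m 1 1)), pd_add ((d 0 0).fun_mul (m 0 0)) (c.fun_mul ((d 0 1).fun_mul (m 0 1))),
      pd_mul (d 0 0) (m 0 0), pd_mul (d 1 1) (m 1 1), pd_mul c ((d 0 1).fun_mul (m 0 1)), hc,
      pd_mul (d 0 1) (m 0 1), pd_mul (dK 0) (dK 0), pd_mul (dK 0) (dK 1), pd_mul (dK 1) (dK 1)]
    ring
  obtain ⟨p00, p01, p10, p11⟩ := hK.pd_eq h hu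
  rw [e, e, p00, p01, p10, p11, h.det_eq u]
  simp only [h.pd_gram hu, Fin.sum_univ_two, h.chr_symm', h.symm u 1 0]
  constructor <;> ring

/-- The differential of the squared rotation `det G * rotn²` is `- κ` times the differential of the
squared norm. -/
lemma pd_rotn_sq (h : LocalMetric G O) (hK : LocalKilling G K O) {u : Model 2} (hu : u ∈ O)
    (i : Fin 2) : pd i (fun x => rotn G K x * rotn G K x * (G x).det) u =
      - gaussCurv G u * pd i (sqn G K) u := by
  have db := h.differentiableAt_of (hK.contDiffOn_rotn h) hu
  have dD := h.differentiableAt_of h.contDiffOn_det hu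
  rw [pd_mul (db.fun_mul db) dD, pd_mul db db, h.pd_det hu]
  obtain ⟨q0, q1⟩ := hK.pd_rotn h hu
  obtain ⟨s0, s1⟩ := hK.pd_sqn h hu
  fin_cases i
  · simp only [Fin.zero_eta, Fin.isValue, q0, s0]; ring
  · simp only [Fin.mk_one, Fin.isValue, q1, s1, h.chr_symm']; ring

/-- The rotation in terms of the exterior derivative of the dual 1-form. -/
lemma extd_dual (h : LocalMetric G O) (hK : LocalKilling G K O) {u : Model 2} (hu : u ∈ O) :
    extd (fun i x => G x i 0 * K x 0 + G x i 1 * K x 1) u 0 1 =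
      2 * (rotn G K u * (G u).det) := by
  have d := fun i j => h.differentiableAt_of (h.smooth i j) hu
  have dK := fun k => h.differentiableAt_of (hK.contDiffOn_comp k) hu
  have m := fun i j k => (d i j).fun_mul (dK k)
  unfold extd
  rw [pd_add (m 1 0 0) (m 1 1 1), pd_add (m 0 0 0) (m 0 1 1), pd_mul (d 1 0) (dK 0),
    pd_mul (d 1 1) (dK 1), pd_mul (d 0 0) (dK 0), pd_mul (d 0 1) (dK 1)]
  obtain ⟨p00, p01, p10, p11⟩ := hK.pd_eq h hu
  rw [p00, p01, p10, p11, h.det_eq u]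
  simp only [h.pd_gram hu, Fin.sum_univ_two, h.chr_symm', h.symm u 1 0]
  ring

/-- A function invariant as a density under a Killing field, divided by the area density. -/
lemma density_invariant (h : LocalMetric G O) (hK : LocalKilling G K O) {w : Model 2 → ℝ}
    (hw : ContDiffOn ℝ ∞ w O) {u : Model 2} (hu : u ∈ O)
    (hinv : K u 0 * pd 0 w u + K u 1 * pd 1 w u +
      (pd 0 (fun x => K x 0) u + pd 1 (fun x => K x 1) u) * w u = 0) :
    K u 0 * pd 0 (fun x => w x * w x / (G x).det) u +
      K u 1 * pd 1 (fun x => w x * w x / (G x).det) u = 0 := by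
  have dw := h.differentiableAt_of hw hu
  have dD := h.differentiableAt_of h.contDiffOn_det hu
  have hD := (h.det_pos u hu).ne'
  have dq : DifferentiableAt ℝ (fun x => w x * w x / (G x).det) u :=
    h.differentiableAt_of ((hw.mul hw).div h.contDiffOn_det
    fun u hu => (h.det_pos u hu).ne') hu
  -- The derivative of w² = (w²/det G) · det G, so that the quotient rule is avoided. Contracted
  -- with K, the Christoffel terms cancel against the divergence term of `hinv`.
  have key : ∀ i : Fin 2, 2 * (pd i w u * w u) =
      pd i (fun x => w x * w x / (G x).det) u * (G u).det +
      w u * w u * (2 * (chr G 0 i 0 u + chr G 1 i 1 u)) := by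
    intro i
    have h1 := h.pd_congr_on (f := fun x => w x * w x)
      (f' := fun x => (w x * w x / (G x).det) * (G x).det)
      (fun x hx => (div_mul_cancel₀ _ (h.det_pos x hx).ne').symm) hu i
    rw [pd_mul dw dw, pd_mul dq dD, h.pd_det hu] at h1
    have h2 : w u * w u / (G u).det * (2 * (G u).det * (chr G 0 i 0 u + chr G 1 i 1 u)) =
        w u * w u * (2 * (chr G 0 i 0 u + chr G 1 i 1 u)) := by field_simp
    rw [h2] at h1
    linear_combination h1
  obtain ⟨p00, p01, p10, p11⟩ := hK.pd_eq h hu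
  have k0 := key 0
  have k1 := key 1
  rw [h.chr_symm'] at k1
  rw [p00, p11] at hinv
  apply mul_left_cancel₀ hD
  linear_combination 2 * w u * hinv - K u 0 * k0 - K u 1 * k1

end LocalKilling

end LocalGeometry

/-! ### A Killing field is determined by its value and rotation at a point. -/

section Uniqueness

variable {G : Model 2 → Matrix (Fin 2) (Fin 2) ℝ} {O : Set (Model 2)} {K : Model 2 → Model 2}

/-- A nonnegative function whose gradient is dominated by its values and which vanishes at a point
vanishes near the point. -/
lemma eventually_eq_zero_of_abs_pd_le {n : ℕ} {f : Model n → ℝ} {u : Model n} {C : ℝ}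
    (h0 : f u = 0) (hpos : ∀ x, 0 ≤ f x)
    (h : ∀ᶠ x in 𝓝 u, DifferentiableAt ℝ f x ∧ ∀ i, |pd i f x| ≤ C * f x) :
    ∀ᶠ x in 𝓝 u, f x = 0 := by
  obtain ⟨r, hr, hb⟩ := Metric.eventually_nhds_iff_ball.1 h
  filter_upwards [Metric.ball_mem_nhds u hr] with x hx
  have hline : ∀ t ∈ Icc (0 : ℝ) 1, u + t • (x - u) ∈ Metric.ball u r := fun t ht =>
    (convex_ball u r).add_smul_sub_mem (Metric.mem_ball_self hr) hx ht
  have hd : ∀ t ∈ Icc (0 : ℝ) 1, HasDerivAt (fun t : ℝ => f (u + t • (x - u)))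
      (fderiv ℝ f (u + t • (x - u)) (x - u)) t := by
    intro t ht
    have h1 := ((hasDerivAt_id t).smul_const (x - u)).const_add u
    rw [one_smul] at h1
    exact (hb _ (hline t ht)).1.hasFDerivAt.comp_hasDerivAt t h1
  set S := ∑ i, |(x - u) i| with hS
  -- Grönwall's inequality on the segment from `u` to `x`, with initial value 0.
  have key := norm_le_gronwallBound_of_norm_deriv_right_le (f := fun t : ℝ => f (u + t • (x - u)))
    (f' := fun t => fderiv ℝ f (u + t • (x - u)) (x - u)) (δ := 0) (K := S * C) (ε := 0)
    (a := 0) (b := 1) (fun t ht => (hd t ht).continuousAt.continuousWithinAt)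
    (fun t ht => (hd t (Ico_subset_Icc_self ht)).hasDerivWithinAt) (by simp [h0]) ?_ 1
    ⟨zero_le_one, le_rfl⟩
  · simp only [gronwallBound_ε0, zero_mul, one_smul, add_sub_cancel] at key
    exact norm_le_zero_iff.1 key
  · intro t ht
    have ht' := Ico_subset_Icc_self ht
    rw [fderiv_eq_sum_pd, add_zero, Real.norm_of_nonneg (hpos _), Real.norm_eq_abs, hS,
      mul_assoc, Finset.sum_mul]
    refine (Finset.abs_sum_le_sum_abs _ _).trans (Finset.sum_le_sum fun i _ => ?_)
    rw [abs_mul]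
    exact mul_le_mul_of_nonneg_left ((hb _ (hline t ht')).2 i) (abs_nonneg _)

set_option maxHeartbeats 1000000 in
/-- A Killing field is determined near a point by its value and its rotation at the point. -/
lemma LocalKilling.eventually_eq_zero (h : LocalMetric G O) (hK : LocalKilling G K O)
    {u : Model 2} (hu : u ∈ O) (h0 : K u = 0) (hr : rotn G K u = 0) :
    ∀ᶠ x in 𝓝 u, K x = 0 := by
  set f : Model 2 → ℝ := fun x => K x 0 * K x 0 + K x 1 * K x 1 + rotn G K x * rotn G K x with hf
  -- One continuous function dominating every coefficient of the first order system, hence bounded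
  -- by `B` near `u`.
  set c : Model 2 → ℝ := fun x => (∑ k, ∑ i, ∑ j, |chr G k i j x|) + (∑ i, ∑ j, |G x i j|) +
    |gaussCurv G x| with hc
  have hcont : ContinuousAt c u := by
    have h1 : ∀ {f : Model 2 → ℝ}, ContDiffOn ℝ ∞ f O → ContinuousAt (fun x => |f x|) u :=
      fun hf => (h.differentiableAt_of hf hu).continuousAt.abs
    exact ((tendsto_finsetSum _ fun k _ => tendsto_finsetSum _ fun i _ =>
      tendsto_finsetSum _ fun j _ => h1 (h.contDiffOn_chr k i j)).add
      (tendsto_finsetSum _ fun i _ => tendsto_finsetSum _ fun j _ => h1 (h.smooth i j))).add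
      (h1 h.contDiffOn_gaussCurv)
  have hB : ∀ᶠ x in 𝓝 u, c x < c u + 1 := hcont.eventually_lt_const (by linarith)
  set B := c u + 1
  have hz : ∀ᶠ x in 𝓝 u, f x = 0 := by
    refine eventually_eq_zero_of_abs_pd_le (C := 24 * B) (by simp [hf, h0, hr])
      (fun x => by simp only [hf]; nlinarith [mul_self_nonneg (K x 0), mul_self_nonneg (K x 1),
        mul_self_nonneg (rotn G K x)]) ?_
    filter_upwards [hB, h.isOpen.mem_nhds hu] with x hx hxO
    have dK := fun k => h.differentiableAt_of (hK.contDiffOn_comp k) hxO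
    have db := h.differentiableAt_of (hK.contDiffOn_rotn h) hxO
    have d1 := ((dK 0).fun_mul (dK 0)).fun_add ((dK 1).fun_mul (dK 1))
    have d2 := db.fun_mul db
    refine ⟨d1.fun_add d2, fun i => ?_⟩
    have hpd : pd i f x = 2 * (K x 0 * pd i (fun x => K x 0) x + K x 1 * pd i (fun x => K x 1) x +
        rotn G K x * pd i (rotn G K) x) := by
      simp only [hf]
      rw [pd_add d1 d2, pd_add ((dK 0).fun_mul (dK 0)) ((dK 1).fun_mul (dK 1)), pd_mul (dK 0) (dK 0),
        pd_mul (dK 1) (dK 1), pd_mul db db]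
      ring
    have hB0 : 0 ≤ B := le_trans (by simp only [hc]; positivity) hx.le
    set a := |K x 0| with ha
    set b := |K x 1| with hb
    set r := |rotn G K x| with hrr
    -- Bounds one row of the system. The coefficient of `rotn` is allowed 2B, since in the equations
    -- for `rotn` it is a sum of two Christoffel symbols.
    have bound : ∀ {p q s k : ℝ} (_ : |p| ≤ B) (_ : |q| ≤ B) (_ : |s| ≤ 2 * B)
        (_ : |k| ≤ |p * K x 0| + |q * K x 1| + |s * rotn G K x|), |k| ≤ 2 * B * (a + b + r) := by
      intro p q s k hp hq hs hk
      rw [abs_mul, abs_mul, abs_mul] at hk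
      have e1 := mul_le_mul_of_nonneg_right hp (abs_nonneg (K x 0))
      have e2 := mul_le_mul_of_nonneg_right hq (abs_nonneg (K x 1))
      have e3 := mul_le_mul_of_nonneg_right hs (abs_nonneg (rotn G K x))
      have e4 := mul_nonneg hB0 (abs_nonneg (K x 0))
      have e5 := mul_nonneg hB0 (abs_nonneg (K x 1))
      simp only [ha, hb, hrr]
      linarith
    have tri : ∀ p q s : ℝ, |(-(p + q) - s)| ≤ |p| + |q| + |s| ∧ |(-(p + q) + s)| ≤ |p| + |q| + |s| := by
      intro p q s
      constructor
      · refine (abs_sub _ _).trans ?_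
        rw [abs_neg]; linarith [abs_add_le p q]
      · refine (abs_add_le _ _).trans ?_
        rw [abs_neg]; linarith [abs_add_le p q]
    have hΓ : ∀ k i j, |chr G k i j x| ≤ B := by
      intro k i j
      refine le_trans ?_ hx.le
      have s1 := Finset.single_le_sum (f := fun j => |chr G k i j x|) (fun _ _ => abs_nonneg _)
        (Finset.mem_univ j)
      have s2 := Finset.single_le_sum (f := fun i => ∑ j, |chr G k i j x|)
        (fun _ _ => Finset.sum_nonneg fun _ _ => abs_nonneg _) (Finset.mem_univ i)
      have s3 := Finset.single_le_sum (f := fun k => ∑ i, ∑ j, |chr G k i j x|)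
        (fun _ _ => Finset.sum_nonneg fun _ _ => Finset.sum_nonneg fun _ _ => abs_nonneg _)
        (Finset.mem_univ k)
      have s4 : 0 ≤ ∑ i, ∑ j, |G x i j| := by positivity
      have s5 := abs_nonneg (gaussCurv G x)
      simp only [hc] at s1 s2 s3 ⊢
      linarith
    have hG : ∀ i j, |G x i j| ≤ B := by
      intro i j
      refine le_trans ?_ hx.le
      have s1 := Finset.single_le_sum (f := fun j => |G x i j|) (fun _ _ => abs_nonneg _)
        (Finset.mem_univ j)
      have s2 := Finset.single_le_sum (f := fun i => ∑ j, |G x i j|)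
        (fun _ _ => Finset.sum_nonneg fun _ _ => abs_nonneg _) (Finset.mem_univ i)
      have s4 : 0 ≤ ∑ k, ∑ i, ∑ j, |chr G k i j x| := by positivity
      have s5 := abs_nonneg (gaussCurv G x)
      simp only [hc] at s1 s2 ⊢
      linarith
    have hκ : |gaussCurv G x| ≤ B := by
      refine le_trans ?_ hx.le
      have s4 : 0 ≤ ∑ k, ∑ i, ∑ j, |chr G k i j x| := by positivity
      have s5 : 0 ≤ ∑ i, ∑ j, |G x i j| := by positivity
      simp only [hc]
      linarith
    have hG2 : ∀ i j, |G x i j| ≤ 2 * B := fun i j => (hG i j).trans (by linarith)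
    have hΓ2 : ∀ i, |chr G 0 0 i x + chr G 1 i 1 x| ≤ 2 * B := fun i =>
      (abs_add_le _ _).trans (by linarith [hΓ 0 0 i, hΓ 1 i 1])
    have hB00 : |(0 : ℝ)| ≤ B := by simpa using hB0
    have three : |pd i (fun x => K x 0) x| ≤ 2 * B * (a + b + r) ∧
        |pd i (fun x => K x 1) x| ≤ 2 * B * (a + b + r) ∧
        |pd i (rotn G K) x| ≤ 2 * B * (a + b + r) := by
      obtain ⟨p00, p01, p10, p11⟩ := hK.pd_eq h hxO
      obtain ⟨q0, q1⟩ := hK.pd_rotn h hxO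
      fin_cases i
      · refine ⟨bound (hΓ 0 0 0) (hΓ 0 0 1) (hG2 0 1) ?_, bound (hΓ 1 0 0) (hΓ 1 0 1) (hG2 0 0) ?_,
          bound hB00 hκ (by simpa using hΓ2 0) ?_⟩
        · rw [show (⟨0, by norm_num⟩ : Fin 2) = 0 from rfl, p00, mul_comm (G x 0 1)]
          exact (tri _ _ _).1
        · rw [show (⟨0, by norm_num⟩ : Fin 2) = 0 from rfl, p01, mul_comm (G x 0 0)]
          exact (tri _ _ _).2
        · rw [show (⟨0, by norm_num⟩ : Fin 2) = 0 from rfl, q0]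
          have := (tri ((chr G 0 0 0 x + chr G 1 0 1 x) * rotn G K x) 0 (gaussCurv G x * K x 1)).1
          simp only [add_zero, abs_zero, zero_mul, zero_add] at this ⊢
          linarith
      · refine ⟨bound (hΓ 0 0 1) (hΓ 0 1 1) (hG2 1 1) ?_, bound (hΓ 1 0 1) (hΓ 1 1 1) (hG2 0 1) ?_,
          bound hκ hB00 (by simpa using hΓ2 1) ?_⟩
        · rw [show (⟨1, by norm_num⟩ : Fin 2) = 1 from rfl, p10, mul_comm (G x 1 1)]
          exact (tri _ _ _).1
        · rw [show (⟨1, by norm_num⟩ : Fin 2) = 1 from rfl, p11, mul_comm (G x 0 1)]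
          exact (tri _ _ _).2
        · rw [show (⟨1, by norm_num⟩ : Fin 2) = 1 from rfl, q1]
          have := (tri ((chr G 0 0 1 x + chr G 1 1 1 x) * rotn G K x) 0 (gaussCurv G x * K x 0)).2
          simp only [add_zero, abs_zero, zero_mul] at this ⊢
          linarith
    obtain ⟨t0, t1, t2⟩ := three
    have m0 := mul_le_mul_of_nonneg_left t0 (abs_nonneg (K x 0))
    have m1 := mul_le_mul_of_nonneg_left t1 (abs_nonneg (K x 1))
    have m2 := mul_le_mul_of_nonneg_left t2 (abs_nonneg (rotn G K x))
    rw [← abs_mul] at m0 m1 m2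
    -- With (a + b + r)² ≤ 3f this gives |∂f| ≤ 12Bf, within the constant 24B used above.
    have habs : |pd i f x| ≤ 4 * B * (a + b + r) ^ 2 := by
      rw [hpd, abs_mul, abs_two]
      have := abs_add_three (K x 0 * pd i (fun x => K x 0) x) (K x 1 * pd i (fun x => K x 1) x)
        (rotn G K x * pd i (rotn G K) x)
      simp only [← ha, ← hb, ← hrr] at m0 m1 m2
      nlinarith
    have hsq : (a + b + r) ^ 2 ≤ 3 * f x := by
      have e0 := abs_mul_abs_self (K x 0)
      have e1 := abs_mul_abs_self (K x 1)
      have e2 := abs_mul_abs_self (rotn G K x)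
      simp only [← ha, ← hb, ← hrr] at e0 e1 e2
      simp only [hf, ← e0, ← e1, ← e2]
      nlinarith [sq_nonneg (a - b), sq_nonneg (a - r), sq_nonneg (b - r)]
    have hfx : 0 ≤ f x := by
      simp only [hf]
      nlinarith [mul_self_nonneg (K x 0), mul_self_nonneg (K x 1), mul_self_nonneg (rotn G K x)]
    nlinarith [mul_le_mul_of_nonneg_left hsq hB0, mul_nonneg hB0 hfx]
  filter_upwards [hz] with x hx
  simp only [hf] at hx
  have p0 := mul_self_nonneg (K x 0)
  have p1 := mul_self_nonneg (K x 1)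
  have p2 := mul_self_nonneg (rotn G K x)
  have z0 : K x 0 = 0 := mul_self_eq_zero.1 (le_antisymm (by linarith) p0)
  have z1 : K x 1 = 0 := mul_self_eq_zero.1 (le_antisymm (by linarith) p1)
  ext k
  fin_cases k
  · exact z0
  · exact z1

end Uniqueness

/-! ### Symmetry fields on a connected surface and their jets. -/

section Surfaces

set_option linter.unusedSectionVars false

variable {M : Type*} [TopologicalSpace M] [ChartedSpace (Model 2) M] [IsManifold (𝓡 2) ∞ M]

lemma gram_det_pos (g : Metric 2 M) {e : OpenPartialHomeomorph M (Model 2)}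
    (he : e ∈ IsManifold.maximalAtlas (𝓡 2) ∞ M) {u : Model 2} (hu : u ∈ e.target) :
    0 < (gram g e u).det := by
  have hpos : ∀ v : Model 2, v ≠ 0 → 0 < v 0 * v 0 * gram g e u 0 0 +
      2 * (v 0 * v 1 * gram g e u 0 1) + v 1 * v 1 * gram g e u 1 1 := by
    intro v hv
    have h1 : mfderiv (𝓡 2) (𝓡 2) e.symm u v ≠ 0 := fun h => hv <|
      mfderiv_symm_injective he hu (h.trans (map_zero (mfderiv (𝓡 2) (𝓡 2) e.symm u)).symm)
    have h2 := g.pos _ _ h1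
    have h3 := chartSq_eq_sum g e u v
    unfold chartSq at h3
    rw [h3] at h2
    simp only [Fin.sum_univ_two, gram_symm g e u 1 0] at h2
    linarith
  have h1 : 0 < gram g e u 1 1 := by
    have := hpos !₂[0, 1] (fun h => by simpa using congrFun (congrArg WithLp.ofLp h) 1)
    simpa using this
  -- The squared norm of this vector is g₁₁ · det g.
  have h2 := hpos !₂[gram g e u 1 1, - gram g e u 0 1] (fun h => by
    have := congrFun (congrArg WithLp.ofLp h) 0
    simp at this
    exact h1.ne' this)
  simp only [Matrix.det_fin_two, gram_symm g e u 1 0]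
  simp at h2
  have h3 : 0 < gram g e u 1 1 * (gram g e u 0 0 * gram g e u 1 1 - gram g e u 0 1 * gram g e u 0 1) := by
    linarith
  exact (pos_iff_pos_of_mul_pos h3).1 h1

lemma localMetric_gram (g : Metric 2 M) {e : OpenPartialHomeomorph M (Model 2)}
    (he : e ∈ IsManifold.maximalAtlas (𝓡 2) ∞ M) : LocalMetric (gram g e) e.target :=
  ⟨e.open_target, contDiffOn_gram g he, gram_symm g e, fun _ hu => gram_det_pos g he hu⟩

/-- The area component of the exterior derivative of a covector field. -/
def curlComp (τ : (p : M) → TangentSpace (𝓡 2) p →L[ℝ] ℝ) (e : OpenPartialHomeomorph M (Model 2))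
    (u : Model 2) : ℝ :=
  extd (comp1 τ e) u 0 1

/-- The components of a vector field in a chart, as functions. -/
def fieldComp (K : VectorField 2 M) (e : OpenPartialHomeomorph M (Model 2)) (a : Fin 2)
    (u : Model 2) : ℝ :=
  vecComp K e u a

lemma fieldComp_add (K L : VectorField 2 M) (e : OpenPartialHomeomorph M (Model 2)) (a : Fin 2)
    (u : Model 2) : fieldComp (K + L) e a u = fieldComp K e a u + fieldComp L e a u :=
  congrArg (coordProj a) (map_add (mfderiv (𝓡 2) (𝓡 2) e (e.symm u)) (K (e.symm u)) (L (e.symm u)))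

lemma fieldComp_smul (c : ℝ) (K : VectorField 2 M) (e : OpenPartialHomeomorph M (Model 2))
    (a : Fin 2) (u : Model 2) : fieldComp (c • K) e a u = c * fieldComp K e a u :=
  congrArg (coordProj a) ((mfderiv (𝓡 2) (𝓡 2) e (e.symm u)).map_smul c (K (e.symm u)))

lemma fieldComp_zero (e : OpenPartialHomeomorph M (Model 2)) (a : Fin 2) :
    fieldComp (0 : VectorField 2 M) e a = fun _ => 0 :=
  funext fun u => congrArg (coordProj a) (map_zero (mfderiv (𝓡 2) (𝓡 2) e (e.symm u)))

lemma differentiableAt_fieldComp (K : VectorField 2 M) {e : OpenPartialHomeomorph M (Model 2)}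
    (he : e ∈ IsManifold.maximalAtlas (𝓡 2) ∞ M) {u : Model 2} (hu : u ∈ e.target) (a : Fin 2) :
    DifferentiableAt ℝ (fieldComp K e a) u :=
  ((coordProj a).contDiff.comp_contDiffOn (contDiffOn_vecComp K he)).contDiffAt
    (e.open_target.mem_nhds hu) |>.differentiableAt (by simp)

lemma pd_fieldComp_add (K L : VectorField 2 M) {e : OpenPartialHomeomorph M (Model 2)}
    (he : e ∈ IsManifold.maximalAtlas (𝓡 2) ∞ M) {u : Model 2} (hu : u ∈ e.target) (i a : Fin 2) :
    pd i (fieldComp (K + L) e a) u = pd i (fieldComp K e a) u + pd i (fieldComp L e a) u := by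
  rw [← pd_add (differentiableAt_fieldComp K he hu a) (differentiableAt_fieldComp L he hu a)]
  exact congrArg (fun f => pd i f u) (funext fun x => fieldComp_add K L e a x)

lemma pd_fieldComp_smul (c : ℝ) (K : VectorField 2 M) {e : OpenPartialHomeomorph M (Model 2)}
    (he : e ∈ IsManifold.maximalAtlas (𝓡 2) ∞ M) {u : Model 2} (hu : u ∈ e.target) (i a : Fin 2) :
    pd i (fieldComp (c • K) e a) u = c * pd i (fieldComp K e a) u := by
  have h1 := pd_mul (i := i) (differentiableAt_const c) (differentiableAt_fieldComp K he hu a)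
  have h2 : pd i (fun _ : Model 2 => c) u = 0 := by simp [pd]
  rw [h2, zero_mul, zero_add] at h1
  rw [← h1]
  exact congrArg (fun f => pd i f u) (funext fun x => fieldComp_smul c K e a x)

lemma rotn_vecComp (G : Model 2 → Matrix (Fin 2) (Fin 2) ℝ) (K : VectorField 2 M)
    (e : OpenPartialHomeomorph M (Model 2)) (u : Model 2) :
    rotn G (vecComp K e) u = (∑ k, G u 1 k * (pd 0 (fieldComp K e k) u +
      ∑ l, chr G k 0 l u * fieldComp K e l u)) / (G u).det := rfl

/-- The fields which are infinitesimal symmetries of `g` and of `dτ`. -/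
def symmetryFields (g : Metric 2 M) (τ : OneForm 2 M) : Submodule ℝ (VectorField 2 M) where
  carrier := {K | ∀ e ∈ IsManifold.maximalAtlas (𝓡 2) ∞ M, ∀ u ∈ e.target,
    (∀ i j, ∑ c, fieldComp K e c u * pd c (fun x => gram g e x i j) u +
      ∑ a, pd i (fieldComp K e a) u * gram g e u a j +
      ∑ b, pd j (fieldComp K e b) u * gram g e u i b = 0) ∧
    fieldComp K e 0 u * pd 0 (curlComp τ e) u + fieldComp K e 1 u * pd 1 (curlComp τ e) u +
      (pd 0 (fieldComp K e 0) u + pd 1 (fieldComp K e 1) u) * curlComp τ e u = 0}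
  add_mem' := by
    intro K L hK hL e he u hu
    obtain ⟨k1, k2⟩ := hK e he u hu
    obtain ⟨l1, l2⟩ := hL e he u hu
    simp only [pd_fieldComp_add K L he hu, fieldComp_add]
    refine ⟨fun i j => ?_, by linear_combination k2 + l2⟩
    have hk := k1 i j
    have hl := l1 i j
    simp only [Fin.sum_univ_two] at hk hl ⊢
    linear_combination hk + hl
  zero_mem' := by
    intro e he u hu
    simp [fieldComp_zero, pd]
  smul_mem' := by
    intro c K hK e he u hu
    obtain ⟨k1, k2⟩ := hK e he u hu
    simp only [pd_fieldComp_smul c K he hu, fieldComp_smul]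
    refine ⟨fun i j => ?_, by linear_combination c * k2⟩
    have hk := k1 i j
    simp only [Fin.sum_univ_two] at hk ⊢
    linear_combination c * hk

/-- A 2-form on a surface has a single component, on which the Lie derivative acts as on a density:
the diagonal components of dτ vanish and the divergence of K remains. -/
lemma mem_symmetryFields_of_isAlmostKilling [T2Space M] {g : Metric 2 M} {τ : OneForm 2 M}
    (hτ : NormLTOne g τ) {K : VectorField 2 M}
    (hK : IsAlmostKilling (randers g τ) (fun p => K p)) : K ∈ symmetryFields g τ := by
  intro e he u hu
  refine ⟨fun i j => (lieDeriv_of_isAlmostKilling hτ hK he hu i j).1, ?_⟩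
  have h := (lieDeriv_of_isAlmostKilling hτ hK he hu 0 1).2
  have e1 : ∀ i, extd (comp1 τ e) u i i = 0 := fun i => sub_self _
  simp only [Fin.sum_univ_two, e1] at h
  have h' : fieldComp K e 0 u * pd 0 (curlComp τ e) u +
      fieldComp K e 1 u * pd 1 (curlComp τ e) u +
      (pd 0 (fieldComp K e 0) u * curlComp τ e u + pd 0 (fieldComp K e 1) u * 0) +
      (pd 1 (fieldComp K e 0) u * 0 + pd 1 (fieldComp K e 1) u * curlComp τ e u) = 0 := h
  linarith

variable {g : Metric 2 M} {τ : OneForm 2 M}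

lemma localKilling_of_mem {K : VectorField 2 M} (hK : K ∈ symmetryFields g τ)
    {e : OpenPartialHomeomorph M (Model 2)} (he : e ∈ IsManifold.maximalAtlas (𝓡 2) ∞ M) :
    LocalKilling (gram g e) (vecComp K e) e.target :=
  ⟨contDiffOn_vecComp K he, fun u hu => (hK e he u hu).1⟩

lemma vecComp_eq_zero_iff (K : (p : M) → TangentSpace (𝓡 2) p)
    {e : OpenPartialHomeomorph M (Model 2)} (he : e ∈ IsManifold.maximalAtlas (𝓡 2) ∞ M)
    {u : Model 2} (hu : u ∈ e.target) : vecComp K e u = 0 ↔ K (e.symm u) = 0 := by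
  constructor
  · intro h
    rw [← mfderiv_symm_vecComp K he hu, h]
    exact map_zero (mfderiv (𝓡 2) (𝓡 2) e.symm u)
  · intro h
    unfold vecComp
    rw [h]
    exact map_zero (mfderiv (𝓡 2) (𝓡 2) e (e.symm u))

lemma eventually_vecComp_eq_zero {K : (p : M) → TangentSpace (𝓡 2) p}
    {e : OpenPartialHomeomorph M (Model 2)} (he : e ∈ IsManifold.maximalAtlas (𝓡 2) ∞ M)
    {u : Model 2} (hu : u ∈ e.target) :
    (∀ᶠ x in 𝓝 u, vecComp K e x = 0) ↔ ∀ᶠ q in 𝓝 (e.symm u), K q = 0 := by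
  constructor
  · intro h
    have hm := e.map_target hu
    have h1 : Filter.Tendsto e (𝓝 (e.symm u)) (𝓝 u) := by
      have := e.continuousAt hm
      rwa [ContinuousAt, e.right_inv hu] at this
    filter_upwards [h1.eventually h, e.open_source.mem_nhds hm] with q hq hqs
    rw [vecComp_eq_zero_iff K he (e.map_source hqs), e.left_inv hqs] at hq
    exact hq
  · intro h
    filter_upwards [(e.continuousAt_symm hu).eventually h, e.open_target.mem_nhds hu] with x hx hxt
    exact (vecComp_eq_zero_iff K he hxt).2 hx

lemma rotn_eq_zero {G : Model 2 → Matrix (Fin 2) (Fin 2) ℝ} {K : Model 2 → Model 2} {u : Model 2}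
    (h : ∀ᶠ x in 𝓝 u, K x = 0) : rotn G K u = 0 := by
  have h1 : ∀ k, pd 0 (fun x => K x k) u = 0 := by
    intro k
    have : (fun x => K x k) =ᶠ[𝓝 u] fun _ => 0 := h.mono fun x hx => by simp [hx]
    rw [pd_congr this]; simp [pd]
  simp [rotn, h1, h.self_of_nhds]

/-- On a connected surface, a symmetry field whose value and rotation vanish at a point is zero. -/
lemma eq_zero_of_jet_eq_zero [ConnectedSpace M] {K : VectorField 2 M} (hK : K ∈ symmetryFields g τ)
    {e : OpenPartialHomeomorph M (Model 2)} (he : e ∈ IsManifold.maximalAtlas (𝓡 2) ∞ M)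
    {u : Model 2} (hu : u ∈ e.target) (h0 : vecComp K e u = 0)
    (h1 : rotn (gram g e) (vecComp K e) u = 0) : K = 0 := by
  -- Z is open by definition. It is closed because value and rotation vanish at a limit point by
  -- continuity, and K then vanishes near it by local uniqueness.
  set Z : Set M := {p | ∀ᶠ q in 𝓝 p, K q = 0} with hZ
  have hopen : IsOpen Z := isOpen_iff_mem_nhds.2 fun p hp => eventually_eventually_nhds.2 hp
  have hclosed : IsClosed Z := by
    rw [← closure_subset_iff_isClosed]
    intro p hp
    have hfr : ∃ᶠ q in 𝓝 p, q ∈ Z := mem_closure_iff_frequently.1 hp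
    set c := chartAt (Model 2) p
    have hc : c ∈ IsManifold.maximalAtlas (𝓡 2) ∞ M := IsManifold.chart_mem_maximalAtlas p
    have hps : p ∈ c.source := mem_chart_source _ p
    have hpt := c.map_source hps
    have hLM := localMetric_gram g hc
    have hLK := localKilling_of_mem hK hc
    have hzero : ∀ f : Model 2 → ℝ, ContDiffOn ℝ ∞ f c.target →
        (∀ x ∈ c.target, (∀ᶠ y in 𝓝 x, vecComp K c y = 0) → f x = 0) → f (c p) = 0 := by
      intro f hf hfz
      by_contra hne
      have hcont : ContinuousAt (fun q => f (c q)) p :=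
        ContinuousAt.comp (f := c) (hLM.differentiableAt_of hf hpt).continuousAt
          (c.continuousAt hps)
      obtain ⟨q, hqZ, hq1, hq2⟩ := (hfr.and_eventually ((hcont.eventually_ne hne).and
        (c.open_source.mem_nhds hps))).exists
      refine hq1 (hfz _ (c.map_source hq2) ?_)
      rw [eventually_vecComp_eq_zero hc (c.map_source hq2), c.left_inv hq2]
      exact hqZ
    have z : vecComp K c (c p) = 0 := by
      ext k
      exact hzero _ (hLK.contDiffOn_comp k) fun x _ hy => by simp [hy.self_of_nhds]
    have zr := hzero _ (hLK.contDiffOn_rotn hLM) fun x _ hy => rotn_eq_zero hy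
    have := hLK.eventually_eq_zero hLM hpt z zr
    rw [eventually_vecComp_eq_zero hc hpt, c.left_inv hps] at this
    exact this
  have hmem : e.symm u ∈ Z := by
    have := (localKilling_of_mem hK he).eventually_eq_zero (localMetric_gram g he) hu h0 h1
    rwa [eventually_vecComp_eq_zero he hu] at this
  have huniv : Z = univ := IsClopen.eq_univ ⟨hclosed, hopen⟩ ⟨_, hmem⟩
  ext p
  have hp : ∀ᶠ q in 𝓝 p, K q = 0 := show p ∈ Z from huniv ▸ mem_univ p
  rw [hp.self_of_nhds]; rfl

/-- The value and the rotation of a symmetry field at a point. -/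
def jet (g : Metric 2 M) (τ : OneForm 2 M) {e : OpenPartialHomeomorph M (Model 2)}
    (he : e ∈ IsManifold.maximalAtlas (𝓡 2) ∞ M) {u : Model 2} (hu : u ∈ e.target) :
    symmetryFields g τ →ₗ[ℝ] (Fin 3 → ℝ) where
  toFun K := ![fieldComp K.1 e 0 u, fieldComp K.1 e 1 u, rotn (gram g e) (vecComp K.1 e) u]
  map_add' := by
    intro K L
    have h : rotn (gram g e) (vecComp (K.1 + L.1 : VectorField 2 M) e) u =
        rotn (gram g e) (vecComp K.1 e) u + rotn (gram g e) (vecComp L.1 e) u := by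
      simp only [rotn_vecComp, Fin.sum_univ_two, pd_fieldComp_add K.1 L.1 he hu, fieldComp_add]
      ring
    ext k
    fin_cases k
    · exact fieldComp_add _ _ _ _ _
    · exact fieldComp_add _ _ _ _ _
    · exact h
  map_smul' := by
    intro c K
    have h : rotn (gram g e) (vecComp (c • K.1 : VectorField 2 M) e) u =
        c * rotn (gram g e) (vecComp K.1 e) u := by
      simp only [rotn_vecComp, Fin.sum_univ_two, pd_fieldComp_smul c K.1 he hu, fieldComp_smul]
      ring
    ext k
    fin_cases k
    · exact fieldComp_smul _ _ _ _ _
    · exact fieldComp_smul _ _ _ _ _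
    · exact h

/-- Three linearly independent symmetry fields act transitively on 1-jets. -/
lemma exists_symmetryField [ConnectedSpace M] {K : Fin 3 → VectorField 2 M}
    (hli : LinearIndependent ℝ K) (hK : ∀ i, K i ∈ symmetryFields g τ)
    {e : OpenPartialHomeomorph M (Model 2)} (he : e ∈ IsManifold.maximalAtlas (𝓡 2) ∞ M)
    {u : Model 2} (hu : u ∈ e.target) (a b r : ℝ) :
    ∃ L ∈ symmetryFields g τ, vecComp L e u 0 = a ∧ vecComp L e u 1 = b ∧
      rotn (gram g e) (vecComp L e) u = r := by
  set K' : Fin 3 → symmetryFields g τ := fun i => ⟨K i, hK i⟩ with hK'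
  have hli' : LinearIndependent ℝ K' :=
    LinearIndependent.of_comp (symmetryFields g τ).subtype hli
  have hjet : Function.Injective (jet g τ he hu) := by
    rw [injective_iff_map_eq_zero]
    intro L hL
    have h0 : vecComp L.1 e u 0 = 0 := congrFun hL 0
    have h1 : vecComp L.1 e u 1 = 0 := congrFun hL 1
    have h2 : rotn (gram g e) (vecComp L.1 e) u = 0 := congrFun hL 2
    refine Subtype.ext (eq_zero_of_jet_eq_zero L.2 he hu ?_ h2)
    ext k
    fin_cases k
    · exact h0
    · exact h1
  -- The jet map restricted to the span of the three fields is an injective endomorphism of ℝ³,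
  -- hence onto.
  have hinj : Function.Injective ((jet g τ he hu).comp (Fintype.linearCombination ℝ K')) :=
    hjet.comp hli'.fintypeLinearCombination_injective
  obtain ⟨c, hc⟩ := LinearMap.injective_iff_surjective.1 hinj ![a, b, r]
  refine ⟨(Fintype.linearCombination ℝ K' c).1, (Fintype.linearCombination ℝ K' c).2, ?_, ?_, ?_⟩
  · exact congrFun hc 0
  · exact congrFun hc 1
  · exact congrFun hc 2

end Surfaces

/-! ### Intrinsic functions and their constancy. -/

section ChartChange

set_option linter.unusedSectionVars false

variable {M : Type*} [TopologicalSpace M] [ChartedSpace (Model 2) M] [IsManifold (𝓡 2) ∞ M]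
  {e e' : OpenPartialHomeomorph M (Model 2)}

lemma trans_mem {u : Model 2} (hu' : e.symm u ∈ e'.source) : trans e e' u ∈ e'.target :=
  e'.map_source hu'

lemma extd_self {n : ℕ} (T : Fin n → Model n → ℝ) (u : Model n) (i : Fin n) :
    extd T u i i = 0 := sub_self _

lemma extd_one_zero (T : Fin 2 → Model 2 → ℝ) (u : Model 2) : extd T u 1 0 = - extd T u 0 1 :=
  (neg_sub _ _).symm

/-- The square of the density of the exterior derivative with respect to the area does not depend
on the chart. -/
lemma curlComp_sq_div_det_trans (g : Metric 2 M) {τ : (p : M) → TangentSpace (𝓡 2) p →L[ℝ] ℝ}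
    (hτ : ∀ i, ContDiffOn ℝ ∞ (comp1 τ e' i) e'.target)
    (he : e ∈ IsManifold.maximalAtlas (𝓡 2) ∞ M) (he' : e' ∈ IsManifold.maximalAtlas (𝓡 2) ∞ M)
    {u : Model 2} (hu : u ∈ e.target) (hu' : e.symm u ∈ e'.source) :
    curlComp τ e u * curlComp τ e u / (gram g e u).det =
      curlComp τ e' (trans e e' u) * curlComp τ e' (trans e e' u) /
        (gram g e' (trans e e' u)).det := by
  have h1 := extd_comp1_trans hτ he he' hu hu' 0 1
  have h2 := gram_trans g he he' hu hu'
  have hdet := gram_det_pos g he hu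
  set A := fun i : Fin 2 => fderiv ℝ (trans e e') u (EuclideanSpace.single i 1) with hA
  simp only [Fin.sum_univ_two, extd_self, extd_one_zero] at h1 h2
  -- The Jacobian determinant: the density scales by D and det g by D², so squaring the density
  -- removes the sign of D.
  set D := A 0 0 * A 1 1 - A 0 1 * A 1 0 with hD
  have h3 : curlComp τ e u = D * curlComp τ e' (trans e e' u) := by
    unfold curlComp; rw [h1, hD]; ring
  have h4 : (gram g e u).det = D * D * (gram g e' (trans e e' u)).det := by
    rw [(localMetric_gram g he).det_eq, (localMetric_gram g he').det_eq, h2, h2, h2, hD,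
      gram_symm g e' _ 1 0]
    ring
  have hD0 : D ≠ 0 := by
    rintro h
    rw [h4, h] at hdet
    simp at hdet
  rw [h3, h4, mul_mul_mul_comm, mul_div_mul_left _ _ (mul_ne_zero hD0 hD0)]

/-- The covector field dual to a vector field. -/
def flat (g : Metric 2 M) (K : (p : M) → TangentSpace (𝓡 2) p) (p : M) :
    TangentSpace (𝓡 2) p →L[ℝ] ℝ :=
  g.inner p (K p)

lemma comp1_flat (g : Metric 2 M) (K : (p : M) → TangentSpace (𝓡 2) p)
    (he : e ∈ IsManifold.maximalAtlas (𝓡 2) ∞ M) {u : Model 2} (hu : u ∈ e.target) (i : Fin 2) :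
    comp1 (flat g K) e i u =
      gram g e u i 0 * vecComp K e u 0 + gram g e u i 1 * vecComp K e u 1 := by
  have h := eq_sum_coordVec K he hu
  rw [Fin.sum_univ_two] at h
  rw [comp1, flat, h, gram_symm g e u i 0, gram_symm g e u i 1]
  simp only [map_add, map_smul, add_apply, smul_apply, smul_eq_mul, gram, Matrix.of_apply]
  ring

lemma contDiffOn_comp1_flat (g : Metric 2 M) (K : VectorField 2 M)
    (he : e ∈ IsManifold.maximalAtlas (𝓡 2) ∞ M) (i : Fin 2) :
    ContDiffOn ℝ ∞ (comp1 (flat g K) e i) e.target := by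
  have hc : ∀ k : Fin 2, ContDiffOn ℝ ∞ (fun u => vecComp K e u k) e.target := fun k =>
    (coordProj k).contDiff.comp_contDiffOn (contDiffOn_vecComp K he)
  exact (((contDiffOn_gram g he i 0).mul (hc 0)).add ((contDiffOn_gram g he i 1).mul (hc 1))).congr
    fun u hu => comp1_flat g K he hu i

lemma sqn_vecComp (g : Metric 2 M) (K : (p : M) → TangentSpace (𝓡 2) p)
    (he : e ∈ IsManifold.maximalAtlas (𝓡 2) ∞ M) {u : Model 2} (hu : u ∈ e.target) :
    sqn (gram g e) (vecComp K e) u = g.inner (e.symm u) (K (e.symm u)) (K (e.symm u)) := by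
  have h := inner_mfderiv_symm g e u (vecComp K e u) (vecComp K e u)
  rw [mfderiv_symm_vecComp K he hu] at h
  rw [h, sqn]
  simp only [Fin.sum_univ_two, gram_symm g e u 1 0]
  ring

lemma sqn_trans (g : Metric 2 M) (K : (p : M) → TangentSpace (𝓡 2) p)
    (he : e ∈ IsManifold.maximalAtlas (𝓡 2) ∞ M) (he' : e' ∈ IsManifold.maximalAtlas (𝓡 2) ∞ M)
    {u : Model 2} (hu : u ∈ e.target) (hu' : e.symm u ∈ e'.source) :
    sqn (gram g e) (vecComp K e) u = sqn (gram g e') (vecComp K e') (trans e e' u) := by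
  rw [sqn_vecComp g K he hu, sqn_vecComp g K he' (trans_mem hu')]
  exact congrArg (fun p => g.inner p (K p) (K p)) (e'.left_inv hu').symm

variable {g : Metric 2 M} {τ : OneForm 2 M}

/-- The right side is a quarter of (dK♭/Vol)², so rotn² det g is a function on the surface although
`rotn` alone depends on the chart. -/
lemma rotn_sq_eq {K : VectorField 2 M} (hK : K ∈ symmetryFields g τ)
    (he : e ∈ IsManifold.maximalAtlas (𝓡 2) ∞ M) {u : Model 2} (hu : u ∈ e.target) :
    rotn (gram g e) (vecComp K e) u * rotn (gram g e) (vecComp K e) u * (gram g e u).det =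
      curlComp (flat g K) e u * curlComp (flat g K) e u / (gram g e u).det / 4 := by
  have hLM := localMetric_gram g he
  have h1 := (localKilling_of_mem hK he).extd_dual hLM hu
  have h2 : curlComp (flat g K) e u = 2 * (rotn (gram g e) (vecComp K e) u * (gram g e u).det) := by
    rw [← h1]
    unfold curlComp extd
    rw [hLM.pd_congr_on (fun x hx => comp1_flat g K he hx 1) hu,
      hLM.pd_congr_on (fun x hx => comp1_flat g K he hx 0) hu]
  have h3 := (gram_det_pos g he hu).ne'
  rw [h2]
  field_simp
  norm_num

lemma rotn_sq_trans {K : VectorField 2 M} (hK : K ∈ symmetryFields g τ)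
    (he : e ∈ IsManifold.maximalAtlas (𝓡 2) ∞ M) (he' : e' ∈ IsManifold.maximalAtlas (𝓡 2) ∞ M)
    {u : Model 2} (hu : u ∈ e.target) (hu' : e.symm u ∈ e'.source) :
    rotn (gram g e) (vecComp K e) u * rotn (gram g e) (vecComp K e) u * (gram g e u).det =
      rotn (gram g e') (vecComp K e') (trans e e' u) *
        rotn (gram g e') (vecComp K e') (trans e e' u) * (gram g e' (trans e e' u)).det := by
  rw [rotn_sq_eq hK he hu, rotn_sq_eq hK he' (trans_mem hu'),
    curlComp_sq_div_det_trans g (contDiffOn_comp1_flat g K he') he he' hu hu']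

/-- In the presence of three independent symmetry fields, the Gauss curvature does not depend on
the chart. -/
lemma gaussCurv_trans [ConnectedSpace M] {K : Fin 3 → VectorField 2 M}
    (hli : LinearIndependent ℝ K) (hK : ∀ i, K i ∈ symmetryFields g τ)
    (he : e ∈ IsManifold.maximalAtlas (𝓡 2) ∞ M) (he' : e' ∈ IsManifold.maximalAtlas (𝓡 2) ∞ M)
    {u : Model 2} (hu : u ∈ e.target) (hu' : e.symm u ∈ e'.source) :
    gaussCurv (gram g e) u = gaussCurv (gram g e') (trans e e' u) := by
  -- With L = ∂₀ and rotation 1 at `u`, the derivative ∂₁|L|² is -2 det g ≠ 0, so κ at `u` can be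
  -- recovered from d(rotn² det g) = -κ d|L|² in either chart.
  obtain ⟨L, hL, hL0, -, hL2⟩ := exists_symmetryField hli hK he hu 1 0 1
  have hM := localMetric_gram g he
  have hM' := localMetric_gram g he'
  have hk := localKilling_of_mem hL he
  have hk' := localKilling_of_mem hL he'
  have hut := trans_mem hu'
  have hψ := ((contDiffAt_trans he he' hu hu').differentiableAt (by simp)).hasFDerivAt
  have hS := (hM'.differentiableAt_of (hk'.contDiffOn_sqn hM') hut).hasFDerivAt.comp u hψ
  have hN := (hM'.differentiableAt_of (((hk'.contDiffOn_rotn hM').mul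
    (hk'.contDiffOn_rotn hM')).mul hM'.contDiffOn_det) hut).hasFDerivAt.comp u hψ
  have eS : fderiv ℝ (sqn (gram g e) (vecComp L e)) u (EuclideanSpace.single 1 1) =
      fderiv ℝ (sqn (gram g e') (vecComp L e')) (trans e e' u)
        (fderiv ℝ (trans e e') u (EuclideanSpace.single 1 1)) := by
    have h : sqn (gram g e) (vecComp L e) =ᶠ[𝓝 u]
        sqn (gram g e') (vecComp L e') ∘ trans e e' := by
      filter_upwards [eventually_trans hu hu'] with x hx using sqn_trans g L he he' hx.1 hx.2
    rw [h.fderiv_eq, hS.fderiv]; rfl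
  have eN : fderiv ℝ (fun x => rotn (gram g e) (vecComp L e) x * rotn (gram g e) (vecComp L e) x *
      (gram g e x).det) u (EuclideanSpace.single 1 1) =
      fderiv ℝ (fun x => rotn (gram g e') (vecComp L e') x * rotn (gram g e') (vecComp L e') x *
        (gram g e' x).det) (trans e e' u)
        (fderiv ℝ (trans e e') u (EuclideanSpace.single 1 1)) := by
    have h : (fun x => rotn (gram g e) (vecComp L e) x * rotn (gram g e) (vecComp L e) x *
        (gram g e x).det) =ᶠ[𝓝 u] (fun x => rotn (gram g e') (vecComp L e') x *
          rotn (gram g e') (vecComp L e') x * (gram g e' x).det) ∘ trans e e' := by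
      filter_upwards [eventually_trans hu hu'] with x hx using rotn_sq_trans hL he he' hx.1 hx.2
    rw [h.fderiv_eq, hN.fderiv]; rfl
  have h1 := hk.pd_rotn_sq hM hu 1
  have h2 := (hk.pd_sqn hM hu).2
  have h3 : fderiv ℝ (fun x => rotn (gram g e') (vecComp L e') x *
      rotn (gram g e') (vecComp L e') x * (gram g e' x).det) (trans e e' u)
        (fderiv ℝ (trans e e') u (EuclideanSpace.single 1 1)) =
      - gaussCurv (gram g e') (trans e e' u) * fderiv ℝ (sqn (gram g e') (vecComp L e'))
        (trans e e' u) (fderiv ℝ (trans e e') u (EuclideanSpace.single 1 1)) := by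
    rw [fderiv_eq_sum_pd, fderiv_eq_sum_pd, Finset.mul_sum]
    refine Finset.sum_congr rfl fun i _ => ?_
    rw [hk'.pd_rotn_sq hM' hut i]
    ring
  rw [← eN, ← eS] at h3
  have h4 : pd 1 (sqn (gram g e) (vecComp L e)) u ≠ 0 := by
    rw [h2, hL0, hL2]
    have := gram_det_pos g he hu
    simp [this.ne']
  have h5 : - gaussCurv (gram g e) u * pd 1 (sqn (gram g e) (vecComp L e)) u =
    - gaussCurv (gram g e') (trans e e' u) * pd 1 (sqn (gram g e) (vecComp L e)) u :=
    h1.symm.trans h3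
  exact neg_injective (mul_right_cancel₀ h4 h5)

/-- A chart independent function with vanishing derivatives is constant on a connected surface. -/
lemma exists_const_of_pd_eq_zero [ConnectedSpace M]
    {F : OpenPartialHomeomorph M (Model 2) → Model 2 → ℝ}
    (hinv : ∀ e ∈ IsManifold.maximalAtlas (𝓡 2) ∞ M, ∀ e' ∈ IsManifold.maximalAtlas (𝓡 2) ∞ M,
      ∀ u ∈ e.target, e.symm u ∈ e'.source → F e u = F e' (trans e e' u))
    (hd : ∀ e ∈ IsManifold.maximalAtlas (𝓡 2) ∞ M, ContDiffOn ℝ ∞ (F e) e.target)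
    (h0 : ∀ e ∈ IsManifold.maximalAtlas (𝓡 2) ∞ M, ∀ u ∈ e.target, ∀ i, pd i (F e) u = 0) :
    ∃ c, ∀ e ∈ IsManifold.maximalAtlas (𝓡 2) ∞ M, ∀ u ∈ e.target, F e u = c := by
  -- Each point is read in its preferred chart; `hinv` makes every other chart give the same value.
  set f : M → ℝ := fun p => F (chartAt (Model 2) p) (chartAt (Model 2) p p) with hf
  have hfe : ∀ e ∈ IsManifold.maximalAtlas (𝓡 2) ∞ M, ∀ u ∈ e.target, F e u = f (e.symm u) :=
    fun e he u hu => hinv e he _ (IsManifold.chart_mem_maximalAtlas _) u hu (mem_chart_source _ _)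
  have hloc : IsLocallyConstant f := by
    rw [IsLocallyConstant.iff_eventually_eq]
    intro p
    have hc := IsManifold.chart_mem_maximalAtlas (I := 𝓡 2) (n := ∞) p
    have hps := mem_chart_source (Model 2) p
    set c := chartAt (Model 2) p
    have hpt := c.map_source hps
    obtain ⟨r, hr, hball⟩ := Metric.isOpen_iff.1 c.open_target _ hpt
    have hzero : EqOn (fderiv ℝ (F c)) 0 (Metric.ball (c p) r) := by
      intro x hx
      ext v
      rw [fderiv_eq_sum_pd]
      simp [h0 c hc x (hball hx)]
    filter_upwards [(c.continuousAt hps).eventually (Metric.ball_mem_nhds _ hr),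
      c.open_source.mem_nhds hps] with q hq hqs
    have h1 := hfe c hc (c q) (c.map_source hqs)
    have h2 := hfe c hc (c p) hpt
    rw [c.left_inv hqs] at h1
    rw [c.left_inv hps] at h2
    rw [← h1, ← h2]
    exact Metric.isOpen_ball.is_const_of_fderiv_eq_zero (convex_ball _ _).isPreconnected
      (((hd c hc).differentiableOn (by simp)).mono hball) hzero hq (Metric.mem_ball_self hr)
  obtain ⟨c, hc⟩ := hloc.exists_eq_const
  exact ⟨c, fun e he u hu => by rw [hfe e he u hu, hc]; rfl⟩

/-- Transitivity on tangent vectors forces invariant functions to be stationary. -/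
lemma pd_eq_zero_of_invariant [ConnectedSpace M] {K : Fin 3 → VectorField 2 M}
    (hli : LinearIndependent ℝ K) (hK : ∀ i, K i ∈ symmetryFields g τ)
    (he : e ∈ IsManifold.maximalAtlas (𝓡 2) ∞ M) {u : Model 2} (hu : u ∈ e.target)
    {f : Model 2 → ℝ} (hf : ∀ L ∈ symmetryFields g τ,
      vecComp L e u 0 * pd 0 f u + vecComp L e u 1 * pd 1 f u = 0) (i : Fin 2) :
    pd i f u = 0 := by
  obtain ⟨L, hL, h0, h1, -⟩ := exists_symmetryField hli hK he hu 1 0 0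
  obtain ⟨L', hL', h0', h1', -⟩ := exists_symmetryField hli hK he hu 0 1 0
  have a := hf L hL
  have b := hf L' hL'
  rw [h0, h1] at a
  rw [h0', h1'] at b
  fin_cases i
  · simpa using a
  · simpa using b

lemma exists_gaussCurv_eq [ConnectedSpace M] {K : Fin 3 → VectorField 2 M}
    (hli : LinearIndependent ℝ K) (hK : ∀ i, K i ∈ symmetryFields g τ) :
    ∃ κ, ∀ e ∈ IsManifold.maximalAtlas (𝓡 2) ∞ M, ∀ u ∈ e.target, gaussCurv (gram g e) u = κ :=
  exists_const_of_pd_eq_zero (F := fun e => gaussCurv (gram g e))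
    (fun _ he _ he' _ hu hu' => gaussCurv_trans hli hK he he' hu hu')
    (fun _ he => (localMetric_gram g he).contDiffOn_gaussCurv)
    fun _ he _ hu => pd_eq_zero_of_invariant hli hK he hu fun _ hL =>
      (localKilling_of_mem hL he).gaussCurv_invariant (localMetric_gram g he) hu

lemma contDiffOn_extd {n : ℕ} {T : Fin n → Model n → ℝ} {O : Set (Model n)} (hO : IsOpen O)
    (hT : ∀ i, ContDiffOn ℝ ∞ (T i) O) (i j : Fin n) : ContDiffOn ℝ ∞ (fun u => extd T u i j) O :=
  ((hT j).pd hO).sub ((hT i).pd hO)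

lemma exists_curlComp_sq_div_det_eq [ConnectedSpace M] {K : Fin 3 → VectorField 2 M}
    (hli : LinearIndependent ℝ K) (hK : ∀ i, K i ∈ symmetryFields g τ) :
    ∃ c, ∀ e ∈ IsManifold.maximalAtlas (𝓡 2) ∞ M, ∀ u ∈ e.target,
      curlComp τ e u * curlComp τ e u / (gram g e u).det = c := by
  have hc : ∀ e ∈ IsManifold.maximalAtlas (𝓡 2) ∞ M, ContDiffOn ℝ ∞ (curlComp τ e) e.target :=
    fun e he => contDiffOn_extd e.open_target (contDiffOn_comp1 τ he) 0 1
  exact exists_const_of_pd_eq_zero (F := fun e u => curlComp τ e u * curlComp τ e u / (gram g e u).det)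
    (fun _ he _ he' _ hu hu' => curlComp_sq_div_det_trans g (contDiffOn_comp1 τ he') he he' hu hu')
    (fun e he => ((hc e he).mul (hc e he)).div (localMetric_gram g he).contDiffOn_det
      fun u hu => (gram_det_pos g he hu).ne')
    fun e he u hu => pd_eq_zero_of_invariant hli hK he hu fun L hL =>
      (localKilling_of_mem hL he).density_invariant (localMetric_gram g he) (hc e he) hu
        (hL e he u hu).2

lemma riem_self {n : ℕ} (G : Model n → Matrix (Fin n) (Fin n) ℝ) (l k i : Fin n) (u : Model n) :
    riem G l k i i u = 0 := by
  simp [riem]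

lemma riem_swap {n : ℕ} (G : Model n → Matrix (Fin n) (Fin n) ℝ) (l k i j : Fin n) (u : Model n) :
    riem G l k j i u = - riem G l k i j u := by
  simp only [riem, Finset.sum_sub_distrib]
  ring

/-- All components of the curvature tensor are multiples of κ by `LocalMetric.riem_eq`, and the form
then collapses to κ times the Gram determinant of v and w. -/
lemma hasConstantSectionalCurvature_of_gaussCurv {κ : ℝ}
    (h : ∀ e ∈ IsManifold.maximalAtlas (𝓡 2) ∞ M, ∀ u ∈ e.target, gaussCurv (gram g e) u = κ) :
    HasConstantSectionalCurvature g κ := by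
  intro e he u hu v w
  obtain ⟨r1, r2, r3, r4⟩ := (localMetric_gram g he).riem_eq hu
  rw [h e he u hu] at r1 r2 r3 r4
  have hr : ∀ l k i j, riemann g e l k i j u = riem (gram g e) l k i j u := fun _ _ _ _ => rfl
  simp only [curvatureForm, coordInner, hr, Fin.sum_univ_two, riem_self,
    riem_swap (gram g e) _ _ 0 1, r1, r2, r3, r4, gram_symm g e u 1 0]
  ring

end ChartChange

/-! ### The exterior derivative as a smooth bilinear form. -/

section ExteriorDerivative

set_option linter.unusedSectionVars false

variable {M : Type*} [TopologicalSpace M] [ChartedSpace (Model 2) M] [IsManifold (𝓡 2) ∞ M]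
  {e e' : OpenPartialHomeomorph M (Model 2)}

/-- The bilinear form with the given coefficients. -/
def biform (A : Fin 2 → Fin 2 → ℝ) : Model 2 →L[ℝ] Model 2 →L[ℝ] ℝ :=
  ∑ i, ∑ j, A i j • (coordProj i).smulRight (coordProj j)

lemma biform_apply (A : Fin 2 → Fin 2 → ℝ) (v w : Model 2) :
    biform A v w = ∑ i, ∑ j, A i j * (v i * w j) := by
  simp [biform, coordProj_apply, Fin.sum_univ_two]

lemma biform_pullback {A A' : Fin 2 → Fin 2 → ℝ} {D : Model 2 →L[ℝ] Model 2}
    (h : ∀ i j, A i j = ∑ a, ∑ b, D (EuclideanSpace.single i 1) a *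
      D (EuclideanSpace.single j 1) b * A' a b) (x y : Model 2) :
    biform A' (D x) (D y) = biform A x y := by
  have hx := model_eq_sum x
  have hy := model_eq_sum y
  simp only [biform_apply, h]
  conv_lhs => rw [hx, hy]
  simp only [Fin.sum_univ_two, map_add, map_smul, PiLp.add_apply, PiLp.smul_apply, smul_eq_mul]
  ring

/-- A multiple of the exterior derivative at a point, computed in the preferred chart at the point. -/
def extDerivAt (k : ℝ) (τ : OneForm 2 M) (p : M) :
    TangentSpace (𝓡 2) p →L[ℝ] TangentSpace (𝓡 2) p →L[ℝ] ℝ :=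
  let D : Model 2 →L[ℝ] Model 2 := mfderiv (𝓡 2) (𝓡 2) (chartAt (Model 2) p) p
  (biform fun i j => k * extd (comp1 τ (chartAt (Model 2) p)) (chartAt (Model 2) p p) i j).bilinearComp D D

lemma mfderiv_eq_fderiv_trans (he : e ∈ IsManifold.maximalAtlas (𝓡 2) ∞ M)
    (he' : e' ∈ IsManifold.maximalAtlas (𝓡 2) ∞ M) {q : M} (hq : q ∈ e.source)
    (hq' : q ∈ e'.source) (v : TangentSpace (𝓡 2) q) :
    (mfderiv (𝓡 2) (𝓡 2) e' q v : Model 2) =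
      fderiv ℝ (trans e e') (e q) (mfderiv (𝓡 2) (𝓡 2) e q v : Model 2) := by
  have hu := e.map_source hq
  have hu' : e.symm (e q) ∈ e'.source := by rwa [e.left_inv hq]
  have h1 : MDifferentiableAt (𝓡 2) (𝓡 2) (trans e e') (e q) :=
    ((contDiffAt_trans he he' hu hu').differentiableAt (by simp)).mdifferentiableAt
  have h2 : MDifferentiableAt (𝓡 2) (𝓡 2) e q := (mdifferentiable_of_mem he).mdifferentiableAt hq
  have h3 : e' =ᶠ[𝓝 q] trans e e' ∘ e := by
    filter_upwards [e.open_source.mem_nhds hq] with x hx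
    simp [trans, e.left_inv hx]
  rw [h3.mfderiv_eq, mfderiv_comp q h1 h2, mfderiv_eq_fderiv]
  rfl

/-- Independence of the chart. The definition uses a chart that jumps from point to point, so
smoothness and all computations go through a fixed `e`. -/
lemma extDerivAt_apply (k : ℝ) (τ : OneForm 2 M) (he : e ∈ IsManifold.maximalAtlas (𝓡 2) ∞ M) {q : M}
    (hq : q ∈ e.source) (v w : TangentSpace (𝓡 2) q) :
    extDerivAt k τ q v w = biform (fun i j => k * extd (comp1 τ e) (e q) i j)
      (mfderiv (𝓡 2) (𝓡 2) e q v : Model 2) (mfderiv (𝓡 2) (𝓡 2) e q w : Model 2) := by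
  set c := chartAt (Model 2) q with hc
  have hcm : c ∈ IsManifold.maximalAtlas (𝓡 2) ∞ M := IsManifold.chart_mem_maximalAtlas q
  have hqc : q ∈ c.source := mem_chart_source _ q
  have h0 : extDerivAt k τ q v w = biform (fun i j => k * extd (comp1 τ c) (c q) i j)
      (mfderiv (𝓡 2) (𝓡 2) c q v : Model 2) (mfderiv (𝓡 2) (𝓡 2) c q w : Model 2) := rfl
  have ht : trans e c (e q) = c q := by rw [trans, e.left_inv hq]
  have h1 := extd_comp1_trans (contDiffOn_comp1 τ hcm) he hcm (e.map_source hq)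
    (by rwa [e.left_inv hq])
  rw [ht] at h1
  rw [h0, mfderiv_eq_fderiv_trans he hcm hq hqc, mfderiv_eq_fderiv_trans he hcm hq hqc]
  refine biform_pullback (fun i j => ?_) _ _
  rw [h1, Finset.mul_sum]
  refine Finset.sum_congr rfl fun a _ => ?_
  rw [Finset.mul_sum]
  exact Finset.sum_congr rfl fun b _ => mul_left_comm _ _ _

lemma mfderiv_coordVec (he : e ∈ IsManifold.maximalAtlas (𝓡 2) ∞ M) {u : Model 2}
    (hu : u ∈ e.target) (i : Fin 2) :
    (mfderiv (𝓡 2) (𝓡 2) e (e.symm u) (coordVec e u i) : Model 2) = EuclideanSpace.single i 1 :=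
  congrArg (fun L => L (EuclideanSpace.single i (1 : ℝ) : Model 2))
    ((mdifferentiable_of_mem he).comp_symm_deriv hu)

lemma extDerivAt_coordVec (k : ℝ) (τ : OneForm 2 M) (he : e ∈ IsManifold.maximalAtlas (𝓡 2) ∞ M)
    {u : Model 2} (hu : u ∈ e.target) (i j : Fin 2) :
    extDerivAt k τ (e.symm u) (coordVec e u i) (coordVec e u j) = k * extd (comp1 τ e) u i j := by
  rw [extDerivAt_apply k τ he (e.map_target hu), mfderiv_coordVec he hu, mfderiv_coordVec he hu,
    e.right_inv hu, biform_apply]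
  simp

lemma _root_.ContDiffOn.smul_vector {E F : Type*} [NormedAddCommGroup E] [NormedSpace ℝ E]
    [NormedAddCommGroup F] [NormedSpace ℝ F] {f : E → ℝ} {O : Set E} {m : ℕ∞ω}
    (hf : ContDiffOn ℝ m f O) (b : F) : ContDiffOn ℝ m (fun u => f u • b) O :=
  hf.smul contDiffOn_const

/-- Near `p` the preferred chart at `p` serves all points. The trivialization of the tangent bundle
at `p` is the derivative of this chart, so the trivialized section is the bilinear form with the
coordinate coefficients, which are smooth. -/
lemma contMDiff_extDerivAt (k : ℝ) (τ : OneForm 2 M) :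
    ContMDiff (𝓡 2) ((𝓡 2).prod 𝓘(ℝ, Model 2 →L[ℝ] Model 2 →L[ℝ] ℝ)) ∞
      fun p => TotalSpace.mk' (Model 2 →L[ℝ] Model 2 →L[ℝ] ℝ)
        (E := fun p : M => TangentSpace (𝓡 2) p →L[ℝ] TangentSpace (𝓡 2) p →L[ℝ] ℝ)
        p (extDerivAt k τ p) := by
  intro p
  rw [contMDiffAt_section]
  set c := chartAt (Model 2) p with hc
  have hcm : c ∈ IsManifold.maximalAtlas (𝓡 2) ∞ M := IsManifold.chart_mem_maximalAtlas p
  have hpc : p ∈ c.source := mem_chart_source _ p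
  have hB : ContDiffOn ℝ ∞ (fun u => biform (fun i j => k * extd (comp1 τ c) u i j)) c.target := by
    unfold biform
    exact ContDiffOn.sum fun i _ => ContDiffOn.sum fun j _ =>
      ContDiffOn.smul_vector (F := Model 2 →L[ℝ] Model 2 →L[ℝ] ℝ)
        (contDiffOn_const.mul (contDiffOn_extd c.open_target (contDiffOn_comp1 τ hcm) i j)) _
  have h1 : ContMDiffAt (𝓡 2) 𝓘(ℝ, Model 2 →L[ℝ] Model 2 →L[ℝ] ℝ) ∞
      (fun q => biform (fun i j => k * extd (comp1 τ c) (c q) i j)) p :=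
    (hB.contMDiffOn.contMDiffAt (c.open_target.mem_nhds (c.map_source hpc))).comp p
      ((contMDiffOn_of_mem_maximalAtlas hcm).contMDiffAt (c.open_source.mem_nhds hpc))
  refine h1.congr_of_eventuallyEq ?_
  filter_upwards [c.open_source.mem_nhds hpc] with q hq
  ext x y
  rw [hom_trivializationAt_apply]
  have hqb : q ∈ (trivializationAt (Model 2) (TangentSpace (𝓡 2)) p).baseSet := hq
  have h2 := inCoordinates_apply_eq₂ (𝕜 := ℝ) (ϕ := extDerivAt k τ q) (v := x) (w := y)
    (E₃ := Bundle.Trivial M ℝ) (F₃ := ℝ) hqb hqb (Set.mem_univ _)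
  refine h2.trans ?_
  have h3 : ∀ z : Model 2, (mfderiv (𝓡 2) (𝓡 2) c q
      ((trivializationAt (Model 2) (TangentSpace (𝓡 2)) p).symm q z) : Model 2) = z := by
    intro z
    have h4 := (trivializationAt (Model 2) (TangentSpace (𝓡 2) (M := M)) p).continuousLinearMapAt_symmL
      (R := ℝ) hqb z
    rw [TangentBundle.continuousLinearMapAt_trivializationAt hq] at h4
    rw [Trivialization.symmL_apply (hb := hqb)] at h4
    exact h4
  have h5 := extDerivAt_apply k τ hcm hq
    ((trivializationAt (Model 2) (TangentSpace (𝓡 2)) p).symm q x)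
    ((trivializationAt (Model 2) (TangentSpace (𝓡 2)) p).symm q y)
  rw [h3, h3] at h5
  exact (LinearMap.congr_fun (Bundle.Trivial.linearMapAt_trivialization ℝ M ℝ q) _).trans h5

/-- A multiple of the exterior derivative of a 1-form on a surface. -/
def extDerivForm (k : ℝ) (τ : OneForm 2 M) : BilinForm 2 M :=
  ⟨extDerivAt k τ, contMDiff_extDerivAt k τ⟩

end ExteriorDerivative

/-! ### The normalized exterior derivative is a volume form. -/

section VolumeForm

set_option linter.unusedSectionVars false

variable {M : Type*} [TopologicalSpace M] [ChartedSpace (Model 2) M] [IsManifold (𝓡 2) ∞ M]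
  {e : OpenPartialHomeomorph M (Model 2)}

/-- The components of a tangent vector in a chart. -/
def tangentCoord (e : OpenPartialHomeomorph M (Model 2)) {q : M} (v : TangentSpace (𝓡 2) q) :
    Model 2 :=
  mfderiv (𝓡 2) (𝓡 2) e q v

lemma inner_eq_sum_gram (g : Metric 2 M) (he : e ∈ IsManifold.maximalAtlas (𝓡 2) ∞ M) {q : M}
    (hq : q ∈ e.source) (v w : TangentSpace (𝓡 2) q) :
    g.inner q v w = ∑ i, ∑ j, tangentCoord e v i *
      tangentCoord e w j * gram g e (e q) i j := by
  have key : ∀ (p : M) (_ : p = q) (x y x' y' : Model 2), x = x' → y = y' →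
      g.inner q (show TangentSpace (𝓡 2) q from x) (show TangentSpace (𝓡 2) q from y) =
      g.inner p (show TangentSpace (𝓡 2) p from x') (show TangentSpace (𝓡 2) p from y') := by
    rintro p rfl x y x' y' rfl rfl; rfl
  rw [← inner_mfderiv_symm]
  exact key _ (e.left_inv hq) _ _ _ _ (mfderiv_symm_mfderiv he hq v).symm
    (mfderiv_symm_mfderiv he hq w).symm

lemma extDerivAt_eq_curlComp_mul (k : ℝ) (τ : OneForm 2 M) (he : e ∈ IsManifold.maximalAtlas (𝓡 2) ∞ M)
    {q : M} (hq : q ∈ e.source) (v w : TangentSpace (𝓡 2) q) :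
    extDerivAt k τ q v w = k * curlComp τ e (e q) *
      (tangentCoord e v 0 * tangentCoord e w 1 -
        tangentCoord e v 1 * tangentCoord e w 0) := by
  refine (extDerivAt_apply k τ he hq v w).trans ((biform_apply _ _ _).trans ?_)
  change ∑ i, ∑ j, k * extd (comp1 τ e) (e q) i j * (tangentCoord e v i * tangentCoord e w j) = _
  simp only [Fin.sum_univ_two, extd_self, extd_one_zero, curlComp]
  ring

variable {g : Metric 2 M} {τ : OneForm 2 M}

lemma isClosedForm_of_curlComp_eq_zero
    (h : ∀ e ∈ IsManifold.maximalAtlas (𝓡 2) ∞ M, ∀ u ∈ e.target, curlComp τ e u = 0) :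
    IsClosedForm τ := by
  intro e he u hu i j
  have h0 : extd (comp1 τ e) u 0 1 = 0 := h e he u hu
  rw [extDerivCoord_eq_extd]
  fin_cases i <;> fin_cases j
  · exact extd_self _ _ _
  · exact h0
  · exact (extd_one_zero _ _).trans (by rw [h0, neg_zero])
  · exact extd_self _ _ _

/-- If the exterior derivative has constant density with respect to the area, then, up to this
constant, it is a volume form. -/
lemma isVolumeForm_extDerivForm {c : ℝ} (hc : c ≠ 0)
    (h : ∀ e ∈ IsManifold.maximalAtlas (𝓡 2) ∞ M, ∀ u ∈ e.target,
      curlComp τ e u * curlComp τ e u / (gram g e u).det = c ^ 2) :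
    IsVolumeForm g (extDerivForm c⁻¹ τ) := by
  have happ : ∀ (p : M) (v w : TangentSpace (𝓡 2) p),
      extDerivForm c⁻¹ τ p v w = extDerivAt c⁻¹ τ p v w := fun _ _ _ => rfl
  refine ⟨fun p v => ?_, fun p v w hv hw hvw => ?_⟩
  · rw [happ, extDerivAt_eq_curlComp_mul c⁻¹ τ (IsManifold.chart_mem_maximalAtlas p)
      (mem_chart_source _ p)]
    ring
  · have he := IsManifold.chart_mem_maximalAtlas (I := 𝓡 2) (n := ∞) p
    have hp := mem_chart_source (Model 2) p
    rw [happ, extDerivAt_eq_curlComp_mul c⁻¹ τ he hp]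
    rw [inner_eq_sum_gram g he hp] at hv hw hvw
    generalize tangentCoord (chartAt (Model 2) p) v = x at hv hvw ⊢
    generalize tangentCoord (chartAt (Model 2) p) w = y at hw hvw ⊢
    have hu := (chartAt (Model 2) p).map_source hp
    have h1 := h _ he _ hu
    rw [div_eq_iff (gram_det_pos g he hu).ne', (localMetric_gram g he).det_eq] at h1
    simp only [Fin.sum_univ_two, gram_symm g _ _ 1 0] at hv hw hvw
    generalize gram g (chartAt (Model 2) p) (chartAt (Model 2) p p) 0 0 = a at *
    generalize gram g (chartAt (Model 2) p) (chartAt (Model 2) p p) 0 1 = b at *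
    generalize gram g (chartAt (Model 2) p) (chartAt (Model 2) p p) 1 1 = d at *
    -- The Gram determinant of an orthonormal pair is 1, and it equals det g times the squared
    -- determinant of the coordinates.
    have h2 : (a * d - b * b) * (x 0 * y 1 - x 1 * y 0) ^ 2 = 1 := by
      have : (a * d - b * b) * (x 0 * y 1 - x 1 * y 0) ^ 2 =
          (x 0 * x 0 * a + x 0 * x 1 * b + (x 1 * x 0 * b + x 1 * x 1 * d)) *
            (y 0 * y 0 * a + y 0 * y 1 * b + (y 1 * y 0 * b + y 1 * y 1 * d)) -
          (x 0 * y 0 * a + x 0 * y 1 * b + (x 1 * y 0 * b + x 1 * y 1 * d)) ^ 2 := by ring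
      rw [this, hv, hw, hvw]
      norm_num
    rw [← abs_one (α := ℝ), ← sq_eq_sq_iff_abs_eq_abs, mul_pow, mul_pow, pow_two (curlComp _ _ _),
      h1, mul_assoc, mul_assoc (c ^ 2), h2, mul_one, ← mul_pow, inv_mul_cancel₀ hc]

lemma extDerivEqMul_extDerivForm {c : ℝ} (hc : c ≠ 0) :
    ExtDerivEqMul τ c (extDerivForm c⁻¹ τ) := by
  intro e he u hu i j
  have happ : extDerivForm c⁻¹ τ (e.symm u) (coordVec e u i) (coordVec e u j) =
      extDerivAt c⁻¹ τ (e.symm u) (coordVec e u i) (coordVec e u j) := rfl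
  rw [happ, extDerivAt_coordVec c⁻¹ τ he hu, extDerivCoord_eq_extd, mul_inv_cancel_left₀ hc]

end VolumeForm

end Randers

end

/-! ### The theorem. -/

theorem theorem3 {M : Type*} [TopologicalSpace M] [ChartedSpace (Randers.Model 2) M]
    [IsManifold (𝓡 2) ∞ M] [T2Space M] [SecondCountableTopology M] [ConnectedSpace M]
    (g : Randers.Metric 2 M) (τ : Randers.OneForm 2 M) (hτ : Randers.NormLTOne g τ)
    (hnot : ¬ Randers.IsConstCurvClosed g τ)
    (hK : ∃ K : Fin 3 → Randers.VectorField 2 M, LinearIndependent ℝ K ∧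
      ∀ i, Randers.IsAlmostKilling (Randers.randers g τ) (fun p => K i p)) :
    (∃ κ : ℝ, Randers.HasConstantSectionalCurvature g κ) ∧
      ∃ (vol : Randers.BilinForm 2 M) (c : ℝ), Randers.IsVolumeForm g vol ∧ c ≠ 0 ∧
        Randers.ExtDerivEqMul τ c vol := by
  obtain ⟨K, hli, hK⟩ := hK
  have hmem := fun i => Randers.mem_symmetryFields_of_isAlmostKilling hτ (hK i)
  obtain ⟨κ, hκ⟩ := Randers.exists_gaussCurv_eq hli hmem
  obtain ⟨a, ha⟩ := Randers.exists_curlComp_sq_div_det_eq hli hmem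
  have hcurv : ∃ κ : ℝ, Randers.HasConstantSectionalCurvature g κ :=
    ⟨κ, Randers.hasConstantSectionalCurvature_of_gaussCurv hκ⟩
  refine ⟨hcurv, ?_⟩
  -- If a = 0 then dτ = 0, and with the constant curvature just obtained this is the excluded case.
  have hne : a ≠ 0 := by
    rintro rfl
    refine hnot ⟨hcurv, Randers.isClosedForm_of_curlComp_eq_zero fun e he u hu => ?_⟩
    simpa [(Randers.gram_det_pos g he hu).ne'] using ha e he u hu
  have hnonneg : 0 ≤ a := by
    obtain ⟨p⟩ := (inferInstance : Nonempty M)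
    have he := IsManifold.chart_mem_maximalAtlas (I := 𝓡 2) (n := ∞) p
    have hu := (chartAt (Randers.Model 2) p).map_source (mem_chart_source _ p)
    rw [← ha _ he _ hu]
    exact div_nonneg (mul_self_nonneg _) (Randers.gram_det_pos g he hu).le
  -- Since (dτ/Vol)² = a, dividing dτ by √a gives ±1 on orthonormal frames. Taking this form as
  -- `vol` chooses the orientation and makes the constant √a.
  have hc : √a ≠ 0 := (Real.sqrt_pos.2 (lt_of_le_of_ne hnonneg hne.symm)).ne'
  exact ⟨Randers.extDerivForm (√a)⁻¹ τ, √a,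
    Randers.isVolumeForm_extDerivForm hc fun e he u hu => by
      rw [ha e he u hu, Real.sq_sqrt hnonneg],
    hc, Randers.extDerivEqMul_extDerivForm hc⟩
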